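/- Let $q\ge 2$ be an integer, let $X$ be (the vertex set of) a $q$-homogeneous tree, i.e. a connected graph without cycles in which every vertex has exactly $q+1$ neighbours, fix an origin $o\in X$ and put $|x|=d(o,x)$, where $d$ is the graph distance. For $x\ne o$ let $p(x)$ be the unique neighbour of $x$ with $|p(x)|=|x|-1$, and for $x\in X$ let $T_x=\{y\in X: x=p^\ell(y)\text{ for some }\ell\ge 0\}$ be the sector of $x$. For $m\ge 0$ let $\mathcal D_m$ be the partition of $X$ into the singletons $\{v\}$ with $|v|<m$ and the sectors $T_v$ with $|v|=m$, and let $\mathcal D=\bigcup_{m\ge0}\mathcal D_m$. Let $\alpha>1$, let $\mu_\alpha$ be the (finite) measure on $X$ with $\mu_\alpha(\{x\})=q^{-\alpha|x|}$, and $L^r_\alpha=L^r(\mu_\alpha)$. $\mathrm{BMO}_\alpha$ is the space of functions $f\in L^1_\alpha$ with $$\|f\|_{\mathrm{BMO}_\alpha}=\sup_{D\in\mathcal D}\frac1{\mu_\alpha(D)}\sum_{x\in D}|f(x)-f_D|\,q^{-\alpha|x|}+\Big|\sum_{x\in X}f(x)q^{-\alpha|x|}\Big|<\infty,\qquad f_D=\frac1{\mu_\alpha(D)}\sum_{x\in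 D}f(x)q^{-\alpha|x|}.$$ An atom is either the constant function $\mu_\alpha(X)^{-1}$ or a function $a$ supported in some $D\in\mathcal D$ with $\|a\|_\infty\le\mu_\alpha(D)^{-1}$ and $\sum_{x\in D}a(x)q^{-\alpha|x|}=0$. $H^1_\alpha$ is the space of $g\in L^1_\alpha$ of the form $g=\sum_j\lambda_ja_j$ with atoms $a_j$ and $\sum_j|\lambda_j|<\infty$, $\lambda_j\in\mathbb C$; its norm is the infimum of $\sum_j|\lambda_j|$ over all such representations. For two normed spaces $A_0,A_1$ of functions on $X$, $A_0+A_1$ carries the norm $\inf\{\|f_0\|_{A_0}+\|f_1\|_{A_1}: f=f_0+f_1\}$. Let $\Sigma=\{z\in\mathbb C:0<\operatorname{Re}z<1\}$. Let $\mathcal F(A_0,A_1)$ be the space of $F:\overline\Sigma\to A_0+A_1$ such that for every bounded linear functional $\ell$ on $A_0+A_1$ the function $z\mapsto\ell(F(z))$ is continuous and bounded on $\overline\Sigma$ and analytic on $\Sigma$, and such that $$\|F\|_{\mathcal F}=\sup_{t\in\mathbb R}\max\big(\|F(it)\|_{A_0},\|F(1+it)\|_{A_1}\big)<\infty .$$ For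 $0<\theta<1$ let $(A_0,A_1)_{[\theta]}=\{F(\theta):F\in\mathcal F(A_0,A_1)\}$, with norm $\|f\|_{[\theta]}=\inf\{\|F\|_{\mathcal F}:F\in\mathcal F(A_0,A_1),\ F(\theta)=f\}$. **Theorem.** The following equalities hold, as equalities of sets of functions with equivalence of norms. (i) If $\theta\in(0,1)$ and $1<p_1<p<\infty$ satisfy $\frac1p=\frac{1-\theta}{p_1}$, then $(L^{p_1}_\alpha,\mathrm{BMO}_\alpha)_{[\theta]}=L^p_\alpha$. (ii) If $\theta\in(0,1)$ and $1<p<p_1<\infty$ satisfy $\frac1p=1-\theta+\frac{\theta}{p_1}$, then $(H^1_\alpha,L^{p_1}_\alpha)_{[\theta]}=L^p_\alpha$. -/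

import Mathlib

open MeasureTheory Set
open scoped ENNReal NNReal

namespace TreeInterp

noncomputable section

/-! ### Homogeneous trees, sectors, dyadic sets, exponentially decreasing measures -/

/-- `u` is the predecessor of `v` in the tree `G` with origin `o`: `u` is a neighbour of `v` and
`|v| = |u| + 1`, where `|x| = d(o, x)`. -/
def IsPredecessor {X : Type*} (G : SimpleGraph X) (o u v : X) : Prop :=
  G.Adj u v ∧ G.dist o v = G.dist o u + 1

/-- The sector `T_x`: all `y` such that `x = p^ℓ(y)` for some `ℓ ≥ 0`, where `p` is the
predecessor map. -/
def sector {X : Type*} (G : SimpleGraph X) (o x : X) : Set X :=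
  {y | Relation.ReflTransGen (IsPredecessor G o) x y}

/-- The partition `𝒟_m`: the singletons `{v}` with `|v| < m` and the sectors `T_v` with
`|v| = m`. -/
def dyadicPartition {X : Type*} (G : SimpleGraph X) (o : X) (m : ℕ) : Set (Set X) :=
  {D | ∃ v, (G.dist o v < m ∧ D = {v}) ∨ (G.dist o v = m ∧ D = sector G o v)}

/-- The family `𝒟 = ⋃_m 𝒟_m` of dyadic sets. -/
def dyadicSets {X : Type*} (G : SimpleGraph X) (o : X) : Set (Set X) :=
  ⋃ m : ℕ, dyadicPartition G o m

/-- The measure `μ_α({x}) = q^{-α|x|}`. -/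
def expMeasure {X : Type*} [MeasurableSpace X] (G : SimpleGraph X) (o : X) (q : ℕ) (α : ℝ) :
    Measure X :=
  Measure.sum fun x => ENNReal.ofReal ((q : ℝ) ^ (-α * (G.dist o x : ℝ))) • Measure.dirac x

/-! ### Extended (semi)norms on a complex vector space, and the spaces where they are finite -/

/-- An extended seminorm on a complex vector space `V`. It describes the seminormed space of all
`f : V` of finite extended seminorm. -/
structure ExtNorm (V : Type*) [AddCommGroup V] [Module ℂ V] where
  toFun : V → ℝ≥0∞
  map_zero' : toFun 0 = 0
  add_le' : ∀ f g, toFun (f + g) ≤ toFun f + toFun g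
  smul_le' : ∀ (c : ℂ) f, toFun (c • f) ≤ ‖c‖ₑ * toFun f

namespace ExtNorm

variable {V : Type*} [AddCommGroup V] [Module ℂ V]

instance : CoeFun (ExtNorm V) fun _ => V → ℝ≥0∞ := ⟨ExtNorm.toFun⟩

/-- The space `{f | N f < ∞}`. -/
def space (N : ExtNorm V) : Submodule ℂ V where
  carrier := {f | N f < ∞}
  zero_mem' := by simp [N.map_zero']
  add_mem' := fun {f g} hf hg =>
    (N.add_le' f g).trans_lt (ENNReal.add_lt_top.2 ⟨hf, hg⟩)
  smul_mem' := fun c f hf =>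
    (N.smul_le' c f).trans_lt (ENNReal.mul_lt_top enorm_lt_top hf)

/-- The norm of `A₀ + A₁`: `inf {‖f₀‖_{A₀} + ‖f₁‖_{A₁} | f = f₀ + f₁}`. -/
def sum (A₀ A₁ : ExtNorm V) : ExtNorm V where
  toFun f := ⨅ g : V, A₀ g + A₁ (f - g)
  map_zero' := by
    refine le_antisymm ((iInf_le _ 0).trans ?_) bot_le
    simp [A₀.map_zero', A₁.map_zero']
  add_le' f g := by
    rw [ENNReal.iInf_add]
    refine le_iInf fun u => ?_
    rw [ENNReal.add_iInf]
    refine le_iInf fun v => (iInf_le _ (u + v)).trans ?_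
    rw [show f + g - (u + v) = (f - u) + (g - v) by abel, add_add_add_comm (A₀ u)]
    exact add_le_add (A₀.add_le' u v) (A₁.add_le' _ _)
  smul_le' c f := by
    rcases eq_or_ne c 0 with rfl | hc
    · refine (iInf_le _ 0).trans ?_
      simp [A₀.map_zero', A₁.map_zero']
    · rw [ENNReal.mul_iInf_of_ne (by simpa using hc) enorm_ne_top]
      refine le_iInf fun u => (iInf_le _ (c • u)).trans ?_
      rw [← smul_sub, mul_add]
      exact add_le_add (A₀.smul_le' c u) (A₁.smul_le' c _)

end ExtNorm

/-! ### Complex interpolation -/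

section Interpolation

variable {V : Type*} [AddCommGroup V] [Module ℂ V]

/-- `ℓ` is a bounded linear functional on the space of `N`. -/
def IsBoundedFunctional (N : ExtNorm V) (l : N.space →ₗ[ℂ] ℂ) : Prop :=
  ∃ C : ℝ≥0, ∀ f : N.space, ‖l f‖ₑ ≤ C * N (f : V)

/-- The norm of `F` in `𝓕(A₀, A₁)`: `sup_t max (‖F(it)‖_{A₀}, ‖F(1 + it)‖_{A₁})`. -/
def stripNorm (A₀ A₁ : ExtNorm V) (F : ℂ → (A₀.sum A₁).space) : ℝ≥0∞ :=
  ⨆ t : ℝ, max (A₀ (F (Complex.I * t) : V)) (A₁ (F (1 + Complex.I * t) : V))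

/-- `F` belongs to `𝓕(A₀, A₁)`: for every bounded linear functional `ℓ` on `A₀ + A₁` the function
`z ↦ ℓ (F z)` is continuous and bounded on the closed strip `0 ≤ Re z ≤ 1` and analytic on the open
strip, and `F` is bounded into `A₀` on `Re z = 0` and into `A₁` on `Re z = 1`. The values
of `F` outside the closed strip play no role. -/
structure IsAdmissible (A₀ A₁ : ExtNorm V) (F : ℂ → (A₀.sum A₁).space) : Prop where
  continuousOn : ∀ l, IsBoundedFunctional (A₀.sum A₁) l →
    ContinuousOn (fun z => l (F z)) (Complex.HadamardThreeLines.verticalClosedStrip 0 1)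
  bounded : ∀ l, IsBoundedFunctional (A₀.sum A₁) l →
    ∃ C : ℝ, ∀ z ∈ Complex.HadamardThreeLines.verticalClosedStrip 0 1, ‖l (F z)‖ ≤ C
  analyticOn : ∀ l, IsBoundedFunctional (A₀.sum A₁) l →
    DifferentiableOn ℂ (fun z => l (F z)) (Complex.HadamardThreeLines.verticalStrip 0 1)
  stripNorm_lt_top : stripNorm A₀ A₁ F < ∞

/-- The complex interpolation space `(A₀, A₁)_{[θ]}`. -/
def interpSpace (A₀ A₁ : ExtNorm V) (θ : ℝ) : Set V :=
  {f | ∃ F, IsAdmissible A₀ A₁ F ∧ (F (θ : ℂ) : V) = f}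

/-- The norm of `(A₀, A₁)_{[θ]}`. -/
def interpNorm (A₀ A₁ : ExtNorm V) (θ : ℝ) (f : V) : ℝ≥0∞ :=
  ⨅ (F : ℂ → (A₀.sum A₁).space) (_ : IsAdmissible A₀ A₁ F) (_ : (F (θ : ℂ) : V) = f),
    stripNorm A₀ A₁ F

/-- The two spaces coincide, with equivalent norms:
`(A₀, A₁)_{[θ]} = B`. -/
def InterpEq (A₀ A₁ : ExtNorm V) (θ : ℝ) (B : ExtNorm V) : Prop :=
  interpSpace A₀ A₁ θ = {f | B f < ∞} ∧
    ∃ C : ℝ≥0, ∀ f : V, B f < ∞ →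
      B f ≤ C * interpNorm A₀ A₁ θ f ∧ interpNorm A₀ A₁ θ f ≤ C * B f

end Interpolation

/-! ### The spaces `L^p`, `BMO` and `H¹` -/

section Spaces

variable {X : Type*} [MeasurableSpace X]

/-- The space `L^p(μ)` of functions on a discrete space, `1 ≤ p`. -/
def lpNorm [DiscreteMeasurableSpace X] (μ : Measure X) (p : ℝ≥0∞) (hp : 1 ≤ p) : ExtNorm (X → ℂ) where
  toFun f := eLpNorm f p μ
  map_zero' := eLpNorm_zero
  add_le' _ _ := eLpNorm_add_le (Measurable.of_discrete.aestronglyMeasurable)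
    (Measurable.of_discrete.aestronglyMeasurable) hp
  smul_le' c f := (eLpNorm_const_smul c f p μ).le

open Classical in
/-- The `BMO` norm
`sup_{D ∈ 𝒟} μ(D)⁻¹ ∑_{x ∈ D} |f(x) - f_D| μ(x) + |∑_x f(x) μ(x)|`, which is finite only
for integrable `f`. -/
def bmoFun (μ : Measure X) (𝒟 : Set (Set X)) (f : X → ℂ) : ℝ≥0∞ :=
  if Integrable f μ then
    (⨆ D ∈ 𝒟, ⨍⁻ x in D, ‖f x - ⨍ y in D, f y ∂μ‖ₑ ∂μ) + ‖∫ x, f x ∂μ‖ₑ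
  else ∞

/-- The space `BMO`. -/
def bmoNorm [DiscreteMeasurableSpace X] (μ : Measure X) (𝒟 : Set (Set X)) : ExtNorm (X → ℂ) where
  toFun := bmoFun μ 𝒟
  map_zero' := by simp [bmoFun]
  add_le' f g := by
    by_cases hf : Integrable f μ
    swap
    · simp [bmoFun, hf]
    by_cases hg : Integrable g μ
    swap
    · simp [bmoFun, hg]
    rw [bmoFun, bmoFun, bmoFun, if_pos hf, if_pos hg, if_pos (hf.add hg), add_add_add_comm]
    refine add_le_add (iSup₂_le fun D hD => ?_) ?_
    · refine le_trans ?_ (add_le_add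
        (le_iSup₂ (f := fun D (_ : D ∈ 𝒟) => ⨍⁻ x in D, ‖f x - ⨍ y in D, f y ∂μ‖ₑ ∂μ) D hD)
        (le_iSup₂ (f := fun D (_ : D ∈ 𝒟) => ⨍⁻ x in D, ‖g x - ⨍ y in D, g y ∂μ‖ₑ ∂μ) D hD))
      have h : ⨍ y in D, (f + g) y ∂μ = ⨍ y in D, f y ∂μ + ⨍ y in D, g y ∂μ := by
        simp only [setAverage_eq, Pi.add_apply]
        rw [integral_add hf.integrableOn hg.integrableOn, smul_add]
      rw [h, setLAverage_eq, setLAverage_eq, setLAverage_eq, ← ENNReal.add_div,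
        ← lintegral_add_left Measurable.of_discrete]
      refine ENNReal.div_le_div_right (lintegral_mono fun x => ?_) _
      rw [Pi.add_apply, add_sub_add_comm]
      exact enorm_add_le _ _
    · simp only [Pi.add_apply]
      rw [integral_add hf hg]
      exact enorm_add_le _ _
  smul_le' c f := by
    rcases eq_or_ne c 0 with rfl | hc
    · simp [bmoFun]
    by_cases hf : Integrable f μ
    swap
    · simp [bmoFun, hf, hc]
    rw [bmoFun, bmoFun, if_pos hf, if_pos (hf.smul c), mul_add]
    refine add_le_add (iSup₂_le fun D hD => ?_) ?_
    · refine le_trans ?_ (mul_le_mul_right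
        (le_iSup₂ (f := fun D (_ : D ∈ 𝒟) => ⨍⁻ x in D, ‖f x - ⨍ y in D, f y ∂μ‖ₑ ∂μ) D hD) _)
      have h : ⨍ y in D, (c • f) y ∂μ = c • ⨍ y in D, f y ∂μ := by
        simp only [setAverage_eq, Pi.smul_apply]
        rw [integral_smul, smul_comm]
      rw [h, setLAverage_eq, setLAverage_eq, ← mul_div_assoc,
        ← lintegral_const_mul _ Measurable.of_discrete]
      refine ENNReal.div_le_div_right (lintegral_mono fun x => ?_) _
      rw [Pi.smul_apply, ← smul_sub, enorm_smul]
    · simp only [Pi.smul_apply]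
      rw [integral_smul, enorm_smul]

/-- `(1, ∞)`-atoms: the constant function `μ(X)⁻¹`, and the functions `a` supported in some
`D ∈ 𝒟` with `‖a‖_∞ ≤ μ(D)⁻¹` and mean zero on `D`. -/
def IsAtom (μ : Measure X) (𝒟 : Set (Set X)) (a : X → ℂ) : Prop :=
  (a = fun _ => (((μ.real univ)⁻¹ : ℝ) : ℂ)) ∨
    ∃ D ∈ 𝒟, Function.support a ⊆ D ∧ eLpNorm a ∞ μ ≤ (μ D)⁻¹ ∧ ∫ x in D, a x ∂μ = 0

/-- `g ∈ L¹` has the atomic decomposition `g = ∑ⱼ λⱼ aⱼ`, with `(λⱼ)` summable. -/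
structure IsAtomicDecomp (μ : Measure X) (𝒟 : Set (Set X)) (g : X → ℂ) (lam : ℕ → ℂ)
    (a : ℕ → X → ℂ) : Prop where
  atom : ∀ j, IsAtom μ 𝒟 (a j)
  summable : Summable fun j => ‖lam j‖
  memLp : MemLp g 1 μ
  hasSum : ∀ x, HasSum (fun j => lam j * a j x) (g x)

/-- The `H¹` norm `inf ∑ⱼ |λⱼ|` over all atomic decompositions (`∞` if there is none). -/
def h1Fun (μ : Measure X) (𝒟 : Set (Set X)) (g : X → ℂ) : ℝ≥0∞ :=
  ⨅ (lam : ℕ → ℂ) (a : ℕ → X → ℂ) (_ : IsAtomicDecomp μ 𝒟 g lam a), ∑' j, ‖lam j‖ₑ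

theorem h1Fun_zero (μ : Measure X) (𝒟 : Set (Set X)) : h1Fun μ 𝒟 0 = 0 := by
  refine le_antisymm ((iInf₂_le (fun _ => 0)
    (fun _ _ => (((μ.real univ)⁻¹ : ℝ) : ℂ))).trans ((iInf_le _ ?_).trans ?_)) bot_le
  · exact ⟨fun _ => Or.inl rfl, by simp, MemLp.zero,
      fun x => by simp⟩
  · simp

/-- The atomic Hardy space `H¹`. -/
def h1Norm (μ : Measure X) (𝒟 : Set (Set X)) : ExtNorm (X → ℂ) where
  toFun := h1Fun μ 𝒟
  map_zero' := h1Fun_zero μ 𝒟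
  add_le' f g := by
    simp only [h1Fun, ENNReal.iInf_add, ENNReal.add_iInf]
    refine le_iInf fun l₂ => le_iInf fun a₂ => le_iInf fun h₂ => le_iInf fun l₁ =>
      le_iInf fun a₁ => le_iInf fun h₁ => ?_
    let e : ℕ ≃ ℕ ⊕ ℕ := Equiv.natSumNatEquivNat.symm
    refine (iInf₂_le (fun j => Sum.elim l₁ l₂ (e j))
      (fun j => Sum.elim a₁ a₂ (e j))).trans ((iInf_le _ ?_).trans ?_)
    · refine ⟨fun j => ?_, ?_, h₁.memLp.add h₂.memLp, fun x => ?_⟩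
      · rcases e j with i | i
        · exact h₁.atom i
        · exact h₂.atom i
      · refine (e.summable_iff (f := fun s => ‖Sum.elim l₁ l₂ s‖)).2 ?_
        exact Summable.sum (f := fun s => ‖Sum.elim l₁ l₂ s‖) h₁.summable h₂.summable
      · refine (e.hasSum_iff (f := fun s => Sum.elim l₁ l₂ s * Sum.elim a₁ a₂ s x)).2 ?_
        exact HasSum.sum (f := fun s => Sum.elim l₁ l₂ s * Sum.elim a₁ a₂ s x)
          (h₁.hasSum x) (h₂.hasSum x)
    · rw [e.tsum_eq (fun s => ‖Sum.elim l₁ l₂ s‖ₑ)]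
      exact (ENNReal.summable.tsum_sum (f := fun s => ‖Sum.elim l₁ l₂ s‖ₑ) ENNReal.summable).le
  smul_le' c f := by
    rcases eq_or_ne c 0 with rfl | hc
    · rw [zero_smul]
      exact (h1Fun_zero μ 𝒟).le.trans bot_le
    have hc' : ‖c‖ₑ ≠ 0 := by simpa using hc
    simp only [h1Fun, ENNReal.mul_iInf_of_ne hc' enorm_ne_top]
    refine le_iInf fun l => le_iInf fun a => le_iInf fun h => ?_
    refine (iInf₂_le (fun j => c * l j) a).trans ((iInf_le _ ?_).trans ?_)
    · refine ⟨h.atom, ?_, h.memLp.const_smul c, fun x => ?_⟩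
      · simpa only [norm_mul] using h.summable.mul_left ‖c‖
      · simpa only [mul_assoc, Pi.smul_apply, smul_eq_mul] using (h.hasSum x).mul_left c
    · simp only [enorm_mul]
      rw [ENNReal.tsum_mul_left]

end Spaces

end

end TreeInterp

set_option linter.unusedSectionVars false

namespace TreeInterp

/-! Only a few properties of the tree matter, and `IsRegularDyadic` collects them. The essential
ones are that dyadic sets are nested, finitely many contain a given point, and each nonempty proper
one lies strictly inside another of comparable measure. `isRegularDyadic_dyadicSets` verifies them;
`α > 1` enters by making a sector comparable in measure to its vertex.

Two of the four inclusions are proved as if BMO were `L^∞` and `H¹` were `L¹`. The Riesz–Thorin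
family `sgn(f) |f| ^ s` works because bounded functions lie in BMO (giving `L^p ⊆ (L^{p₁}, BMO)`)
and because `H¹` embeds in `L¹` (giving `(H¹, L^{p₁}) ⊆ L^p` by duality and the three lines
theorem).

The other two inclusions rest on one construction, `czFamily`. For `‖g‖_r ≤ 1` let `g_k` be the
Calderón–Zygmund good part of `g` at height `2 ^ k` and put `G_s = g_0 + ∑ 2^{k(s-1)} (g_{k+1} -
g_k)`, so that `G_1 = g`. With `Ω_k` the set where the dyadic maximal function exceeds `2 ^ k`, the
difference `g_{k+1} - g_k` is `O(2 ^ k)`, lives on `Ω_k` and has mean zero on the stopping cells.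
Hence its `H¹` norm is `O(2 ^ k μ(Ω_k))`, and its pairing with `b` is `O(2 ^ k μ(Ω_k) ‖b‖_BMO)`. The
weak type inequality gives `∑ 2^{kr} μ(Ω_k) ≲ ‖g‖_r^r`
(`IsRegularDyadic.exists_tsum_measure_overAvg_le`). So `G_s` is bounded in `H¹`, and against BMO, on
`Re s = r`, and bounded in `L^{r₁}` on `Re s = r / r₁`. With `s` affine in `z`, this family yields
`L^p ⊆ (H¹, L^{p₁})` directly. Applied to test functions of the dual exponent it yields `(L^{p₁},
BMO) ⊆ L^p` through the three lines theorem. Neither a full `H¹`–BMO duality nor a sharp maximal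
function is needed. -/

/-- A family `𝒟` of sets in a discrete finite measure space which is nested, contains the
singletons and the whole space, has finitely many members through each point, and in which every
nonempty proper member `D` is strictly contained in a member of measure at most `K μ(D)`. -/
structure IsRegularDyadic {X : Type*} [MeasurableSpace X] (μ : Measure X) (𝒟 : Set (Set X))
    (K : ℝ) : Prop where
  univ_mem : univ ∈ 𝒟
  singleton_mem : ∀ x, {x} ∈ 𝒟
  finite_containing : ∀ x, {D | D ∈ 𝒟 ∧ x ∈ D}.Finite
  nested : ∀ D ∈ 𝒟, ∀ E ∈ 𝒟, ∀ x, x ∈ D → x ∈ E → D ⊆ E ∨ E ⊆ D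
  exists_parent : ∀ D ∈ 𝒟, D.Nonempty → D ≠ univ → ∃ E ∈ 𝒟, D ⊂ E ∧ μ.real E ≤ K * μ.real D
  measure_singleton_ne_zero : ∀ x, μ {x} ≠ 0
  one_le_measure_univ : 1 ≤ μ.real univ
  one_le_const : 1 ≤ K

/-! ### Combinatorics of rooted trees: predecessors, sectors, successors. -/

section Tree

variable {X : Type*} {G : SimpleGraph X} {o u v w : X}

theorem exists_isPredecessor (hG : G.IsTree) (hv : v ≠ o) : ∃ u, IsPredecessor G o u v := by
  obtain ⟨p, hp⟩ := hG.connected.exists_walk_length_eq_dist v o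
  cases p with
  | nil => exact absurd rfl hv
  | cons h p =>
    rename_i u
    refine ⟨u, h.symm, ?_⟩
    have h1 := SimpleGraph.dist_le p
    have h2 := hG.dist_eq_dist_add_one_of_adj o h
    simp only [SimpleGraph.Walk.length_cons] at hp
    rw [SimpleGraph.dist_comm (u := v)] at hp
    rw [SimpleGraph.dist_comm (u := u)] at h1
    omega

/-- A geodesic from `o` to a predecessor, followed by the last edge, is again a geodesic, hence a
path; paths in a tree are unique, so their penultimate vertices agree. -/
theorem IsPredecessor.eq (hG : G.IsTree) (hu : IsPredecessor G o u w)
    (hv : IsPredecessor G o v w) : u = v := by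
  have key : ∀ {u}, IsPredecessor G o u w → ∃ p : G.Walk o w, p.IsPath ∧ p.penultimate = u := by
    intro u hu
    obtain ⟨p, hp⟩ := hG.connected.exists_walk_length_eq_dist o u
    refine ⟨p.concat hu.1, SimpleGraph.Walk.isPath_of_length_eq_dist _ ?_, by simp⟩
    rw [SimpleGraph.Walk.length_concat, hp, hu.2]
  obtain ⟨p, hp, rfl⟩ := key hu
  obtain ⟨p', hp', rfl⟩ := key hv
  rw [(hG.existsUnique_path o w).unique hp hp']

theorem self_mem_sector (G : SimpleGraph X) (o v : X) : v ∈ sector G o v :=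
  Relation.ReflTransGen.refl

theorem dist_le_of_mem_sector (h : w ∈ sector G o v) : G.dist o v ≤ G.dist o w := by
  induction h with
  | refl => exact le_rfl
  | tail _ h ih => exact ih.trans (by rw [h.2]; omega)

theorem sector_subset (h : w ∈ sector G o v) : sector G o w ⊆ sector G o v :=
  fun _ hy => Relation.ReflTransGen.trans h hy

theorem sector_origin (hG : G.IsTree) (o : X) : sector G o o = univ := by
  refine eq_univ_of_forall fun x => ?_
  induction hn : G.dist o x generalizing x with
  | zero =>
    rw [hG.connected.dist_eq_zero_iff] at hn
    exact hn ▸ self_mem_sector G o o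
  | succ n ih =>
    have hx : x ≠ o := by rintro rfl; simp at hn
    obtain ⟨u, hu⟩ := exists_isPredecessor hG hx
    have h2 := hu.2
    exact (ih u (by omega)).tail hu

/-- Predecessors are unique, so the ancestors of `x` form a chain. -/
theorem sector_nested (hG : G.IsTree) {x : X} (hu : x ∈ sector G o u) (hv : x ∈ sector G o v) :
    sector G o u ⊆ sector G o v ∨ sector G o v ⊆ sector G o u := by
  have h := Relation.ReflTransGen.total_of_right_unique
    (r := Function.swap (IsPredecessor G o)) (fun a b c hb hc => IsPredecessor.eq hG hb hc)
    (Relation.reflTransGen_swap.2 hu) (Relation.reflTransGen_swap.2 hv)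
  exact h.imp (fun h => sector_subset (Relation.reflTransGen_swap.1 h))
    (fun h => sector_subset (Relation.reflTransGen_swap.1 h))

theorem finite_setOf_dist_le [G.LocallyFinite] (hG : G.IsTree) (o : X) (n : ℕ) :
    {x | G.dist o x ≤ n}.Finite := by
  induction n with
  | zero =>
    refine (finite_singleton o).subset fun x hx => ?_
    have hx : G.dist o x = 0 := Nat.le_zero.1 hx
    rw [hG.connected.dist_eq_zero_iff] at hx
    exact hx.symm
  | succ n ih =>
    refine (ih.union (ih.biUnion fun u _ => (G.neighborSet u).toFinite)).subset fun x hx => ?_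
    by_cases hxn : G.dist o x ≤ n
    · exact Or.inl hxn
    · have hx0 : x ≠ o := by rintro rfl; simp at hxn
      obtain ⟨u, hu⟩ := exists_isPredecessor hG hx0
      have h1 := hu.2
      have h2 : G.dist o x ≤ n + 1 := hx
      exact Or.inr (mem_iUnion₂.2 ⟨u, show G.dist o u ≤ n by omega, hu.1⟩)

theorem countable_of_isTree [G.LocallyFinite] (hG : G.IsTree) (o : X) : Countable X := by
  refine countable_univ_iff.1 ((countable_iUnion fun n =>
    (finite_setOf_dist_le hG o n).countable).mono fun x _ => ?_)
  exact mem_iUnion.2 ⟨G.dist o x, le_refl (G.dist o x)⟩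

variable [G.LocallyFinite]

open Classical in
/-- The successors of a vertex. -/
noncomputable def successors (G : SimpleGraph X) [G.LocallyFinite] (o v : X) : Finset X :=
  (G.neighborFinset v).filter fun w => IsPredecessor G o v w

theorem mem_successors : w ∈ successors G o v ↔ IsPredecessor G o v w := by
  simp only [successors, Finset.mem_filter, SimpleGraph.mem_neighborFinset]
  exact ⟨fun h => h.2, fun h => ⟨h.1, h⟩⟩

theorem card_successors_le {q : ℕ} (hreg : G.IsRegularOfDegree (q + 1)) (o v : X) :
    (successors G o v).card ≤ q + 1 := by
  classical
  rw [← hreg v]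
  exact Finset.card_filter_le _ _

theorem card_successors_le_of_ne {q : ℕ} (hG : G.IsTree) (hreg : G.IsRegularOfDegree (q + 1))
    (hv : v ≠ o) : (successors G o v).card ≤ q := by
  classical
  obtain ⟨u, hu⟩ := exists_isPredecessor hG hv
  have h := Finset.card_erase_of_mem (s := G.neighborFinset v) (a := u) (by simpa using hu.1.symm)
  rw [SimpleGraph.card_neighborFinset_eq_degree, hreg v, Nat.add_sub_cancel] at h
  rw [← h]
  refine Finset.card_le_card fun w hw => ?_
  rw [mem_successors] at hw
  refine Finset.mem_erase.2 ⟨?_, by simpa using hw.1⟩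
  rintro rfl
  have h1 := hu.2
  have h2 := hw.2
  omega

/-- Of two distinct neighbours at most one is the predecessor. This is what makes `{v}` a proper
subset of its sector. -/
theorem successors_nonempty {q : ℕ} (hq : 0 < q) (hG : G.IsTree)
    (hreg : G.IsRegularOfDegree (q + 1)) (o v : X) : (successors G o v).Nonempty := by
  classical
  have h : 1 < (G.neighborFinset v).card := by
    rw [SimpleGraph.card_neighborFinset_eq_degree, hreg v]; omega
  obtain ⟨a, ha, b, hb, hab⟩ := Finset.one_lt_card.1 h
  rw [SimpleGraph.mem_neighborFinset] at ha hb
  rcases hG.dist_eq_dist_add_one_of_adj o ha with h1 | h1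
  · rcases hG.dist_eq_dist_add_one_of_adj o hb with h2 | h2
    · exact absurd (IsPredecessor.eq hG ⟨ha.symm, h1⟩ ⟨hb.symm, h2⟩) hab
    · exact ⟨b, mem_successors.2 ⟨hb, h2⟩⟩
  · exact ⟨a, mem_successors.2 ⟨ha, h1⟩⟩

theorem sector_subset_insert_biUnion (G : SimpleGraph X) [G.LocallyFinite] (o v : X) :
    sector G o v ⊆ {v} ∪ ⋃ w ∈ successors G o v, sector G o w := by
  intro y hy
  rcases Relation.ReflTransGen.cases_head hy with rfl | ⟨w, hw, hwy⟩
  · exact Or.inl rfl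
  · exact Or.inr (mem_iUnion₂.2 ⟨w, mem_successors.2 hw, hwy⟩)

end Tree

/-! ### The measure of sectors and the regularity of the dyadic family. -/

section Measure

variable {X : Type*} [MeasurableSpace X] [DiscreteMeasurableSpace X] {G : SimpleGraph X}
  {o : X} {q : ℕ} {α : ℝ}

theorem expMeasure_singleton (x : X) :
    expMeasure G o q α {x} = ENNReal.ofReal ((q : ℝ) ^ (-α * (G.dist o x : ℝ))) := by
  rw [expMeasure, Measure.sum_apply _ (MeasurableSet.singleton x), tsum_eq_single x]
  · simp
  · intro y hy
    simp [hy]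

theorem expMeasure_successor (hq : 1 < q) {v w : X} (hw : IsPredecessor G o v w) :
    expMeasure G o q α {w} = ENNReal.ofReal ((q : ℝ) ^ (-α)) * expMeasure G o q α {v} := by
  have hq0 : (0 : ℝ) < q := by positivity
  rw [expMeasure_singleton, expMeasure_singleton, hw.2, ← ENNReal.ofReal_mul (by positivity),
    ← Real.rpow_add hq0]
  congr 2
  push_cast
  ring

/-- The fixed point equation `1 + ρ C = C` of the recursion over successors. -/
theorem ofReal_geom {ρ : ℝ} (h0 : 0 ≤ ρ) (h1 : ρ < 1) :
    1 + ENNReal.ofReal ρ * ENNReal.ofReal (1 - ρ)⁻¹ = ENNReal.ofReal (1 - ρ)⁻¹ := by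
  have : 0 < 1 - ρ := by linarith
  rw [← ENNReal.ofReal_one, ← ENNReal.ofReal_mul h0, ← ENNReal.ofReal_add zero_le_one (by positivity)]
  congr 1
  field_simp
  ring

variable [G.LocallyFinite]

/-- One step of the recursion: each successor carries `q ^ (-α)` times the mass of `v`, and there
are at most `n` of them. The sets `S w` are left free so that truncated and full sectors can both be
used. -/
theorem expMeasure_le_of_successors (hq : 1 < q) {n : ℕ} (C : ℝ≥0∞) (v : X)
    (hn : (successors G o v).card ≤ n) (S : X → Set X)
    (hS : ∀ w ∈ successors G o v, expMeasure G o q α (S w) ≤ C * expMeasure G o q α {w}) :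
    expMeasure G o q α ({v} ∪ ⋃ w ∈ successors G o v, S w)
      ≤ (1 + n * ENNReal.ofReal ((q : ℝ) ^ (-α)) * C) * expMeasure G o q α {v} := by
  refine (measure_union_le _ _).trans ?_
  rw [add_mul, one_mul]
  gcongr
  refine (measure_biUnion_finset_le _ _).trans ((Finset.sum_le_card_nsmul _ _
    (C * (ENNReal.ofReal ((q : ℝ) ^ (-α)) * expMeasure G o q α {v})) fun w hw => ?_).trans ?_)
  · rw [← expMeasure_successor hq (mem_successors.1 hw)]
    exact hS w hw
  · rw [nsmul_eq_mul]
    calc ((successors G o v).card : ℝ≥0∞) * (C * (ENNReal.ofReal ((q : ℝ) ^ (-α)) *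
          expMeasure G o q α {v}))
        ≤ n * (C * (ENNReal.ofReal ((q : ℝ) ^ (-α)) * expMeasure G o q α {v})) := by gcongr
      _ = _ := by ring

theorem mul_rpow_neg_lt_one (hq : 1 < q) (hα : 1 < α) : (q : ℝ) * (q : ℝ) ^ (-α) < 1 := by
  have hq1 : (1 : ℝ) < q := by exact_mod_cast hq
  have hq0 : (0 : ℝ) < q := by linarith
  nth_rewrite 1 [← Real.rpow_one (q : ℝ)]
  rw [← Real.rpow_add hq0]
  exact Real.rpow_lt_one_of_one_lt_of_neg hq1 (by linarith)

/-- Away from the origin there are at most `q` successors, so the sector is dominated by a geometric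
series of ratio `q ^ (1 - α) < 1`. -/
theorem expMeasure_sector_le_of_ne (hq : 1 < q) (hG : G.IsTree)
    (hreg : G.IsRegularOfDegree (q + 1)) (hα : 1 < α) {v : X} (hv : v ≠ o) :
    expMeasure G o q α (sector G o v) ≤
      ENNReal.ofReal (1 - (q : ℝ) * (q : ℝ) ^ (-α))⁻¹ * expMeasure G o q α {v} := by
  set C := ENNReal.ofReal (1 - (q : ℝ) * (q : ℝ) ^ (-α))⁻¹ with hC
  -- Sectors are truncated at depth `n` to allow induction with a constant independent of `n`; the
  -- truncation of depth zero is empty.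
  have key : ∀ (n : ℕ) (v : X), v ≠ o →
      expMeasure G o q α (sector G o v ∩ {y | G.dist o y < G.dist o v + n})
        ≤ C * expMeasure G o q α {v} := by
    intro n
    induction n with
    | zero =>
      intro v _
      rw [show sector G o v ∩ {y | G.dist o y < G.dist o v + 0} = ∅ from ?_]
      · simp
      · refine eq_empty_of_forall_notMem fun y hy => ?_
        have h1 := dist_le_of_mem_sector hy.1
        have h2 : G.dist o y < G.dist o v + 0 := hy.2
        omega
    | succ n ih =>
      intro v hv
      refine (measure_mono ?_).trans ((expMeasure_le_of_successors hq C v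
        (card_successors_le_of_ne hG hreg hv)
        (fun w => sector G o w ∩ {y | G.dist o y < G.dist o w + n}) fun w hw => ih w ?_).trans ?_)
      · rintro y ⟨hy, hyn⟩
        rcases sector_subset_insert_biUnion G o v hy with h | h
        · exact Or.inl h
        · obtain ⟨w, hw, hyw⟩ := mem_iUnion₂.1 h
          refine Or.inr (mem_iUnion₂.2 ⟨w, hw, hyw, ?_⟩)
          have h1 := (mem_successors.1 hw).2
          have h2 : G.dist o y < G.dist o v + (n + 1) := hyn
          show G.dist o y < G.dist o w + n
          omega
      · rintro rfl
        have h1 := (mem_successors.1 hw).2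
        simp at h1
      · rw [hC, ← ENNReal.ofReal_natCast, ← ENNReal.ofReal_mul (by positivity),
          ofReal_geom (by positivity) (mul_rpow_neg_lt_one hq hα)]
  have hU : sector G o v = ⋃ n : ℕ, sector G o v ∩ {y | G.dist o y < G.dist o v + n} := by
    ext y
    simp only [mem_iUnion, mem_inter_iff, mem_ofPred_eq, exists_and_left, iff_self_and]
    exact fun _ => ⟨G.dist o y + 1, by omega⟩
  rw [hU, Monotone.measure_iUnion]
  · exact iSup_le fun n => key n v hv
  · intro m n hmn y hy
    exact ⟨hy.1, lt_of_lt_of_le (show G.dist o y < G.dist o v + m from hy.2) (by omega)⟩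

/-- The origin may have `q + 1` successors, where the fixed point argument fails. One further step
of the recursion, over successors that are not the origin, covers every vertex. -/
theorem exists_expMeasure_sector_le (hq : 1 < q) (hG : G.IsTree)
    (hreg : G.IsRegularOfDegree (q + 1)) (o : X) (hα : 1 < α) :
    ∃ C : ℝ≥0, 1 ≤ C ∧ ∀ v, expMeasure G o q α (sector G o v) ≤ C * expMeasure G o q α {v} := by
  let C₀ : ℝ≥0 := Real.toNNReal (1 - (q : ℝ) * (q : ℝ) ^ (-α))⁻¹
  refine ⟨1 + (q + 1 : ℕ) * Real.toNNReal ((q : ℝ) ^ (-α)) * C₀, by simp, fun v => ?_⟩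
  refine (measure_mono (sector_subset_insert_biUnion G o v)).trans
    ((expMeasure_le_of_successors hq C₀ v (card_successors_le hreg o v) _ fun w hw =>
      expMeasure_sector_le_of_ne hq hG hreg hα ?_).trans ?_)
  · rintro rfl
    have h1 := (mem_successors.1 hw).2
    simp at h1
  · push_cast
    exact le_rfl

theorem isFiniteMeasure_expMeasure (hq : 1 < q) (hG : G.IsTree)
    (hreg : G.IsRegularOfDegree (q + 1)) (o : X) (hα : 1 < α) :
    IsFiniteMeasure (expMeasure G o q α) := by
  obtain ⟨C, -, hC⟩ := exists_expMeasure_sector_le hq hG hreg o hα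
  refine ⟨?_⟩
  rw [← sector_origin hG o]
  refine (hC o).trans_lt ?_
  rw [expMeasure_singleton]
  exact ENNReal.mul_lt_top ENNReal.coe_lt_top ENNReal.ofReal_lt_top

theorem isRegularDyadic_dyadicSets (hq : 1 < q) (hG : G.IsTree)
    (hreg : G.IsRegularOfDegree (q + 1)) (o : X) (hα : 1 < α) :
    ∃ K, IsRegularDyadic (expMeasure G o q α) (dyadicSets G o) K := by
  have := isFiniteMeasure_expMeasure hq hG hreg o hα
  obtain ⟨C, hC1, hC⟩ := exists_expMeasure_sector_le hq hG hreg o hα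
  have hq1 : (1 : ℝ) < q := by exact_mod_cast hq
  have hq0 : (0 : ℝ) < q := by linarith
  -- In the union over all levels the level is irrelevant: `{v}` occurs at level `|v| + 1` and the
  -- sector of `v` at level `|v|`.
  have hmem : ∀ D, D ∈ dyadicSets G o ↔ ∃ v, D = {v} ∨ D = sector G o v := by
    intro D
    simp only [dyadicSets, dyadicPartition, mem_iUnion, mem_ofPred_eq]
    constructor
    · rintro ⟨m, v, h | h⟩
      exacts [⟨v, Or.inl h.2⟩, ⟨v, Or.inr h.2⟩]
    · rintro ⟨v, h | h⟩
      exacts [⟨G.dist o v + 1, v, Or.inl ⟨by omega, h⟩⟩, ⟨_, v, Or.inr ⟨rfl, h⟩⟩]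
  have hCr : ∀ v, (expMeasure G o q α).real (sector G o v) ≤
      C * (expMeasure G o q α).real {v} := by
    intro v
    have := ENNReal.toReal_mono (ENNReal.mul_ne_top ENNReal.coe_ne_top (measure_ne_top _ _)) (hC v)
    rwa [ENNReal.toReal_mul] at this
  have hqα : 1 ≤ (q : ℝ) ^ α := Real.one_le_rpow hq1.le (by linarith)
  have hC1' : (1 : ℝ) ≤ C := by exact_mod_cast hC1
  -- The parent of `{v}` is the sector of `v`, at cost `C`. The parent of that sector is the sector
  -- of the predecessor, at cost `C * q ^ α`, since the predecessor has `q ^ α` times the mass of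
  -- `v`.
  refine ⟨C * (q : ℝ) ^ α, ?_, ?_, ?_, ?_, ?_, ?_, ?_, ?_⟩
  · exact (hmem _).2 ⟨o, Or.inr (sector_origin hG o).symm⟩
  · exact fun x => (hmem _).2 ⟨x, Or.inl rfl⟩
  · intro x
    refine (((finite_setOf_dist_le hG o (G.dist o x)).image (sector G o)).insert {x}).subset ?_
    rintro D ⟨hD, hx⟩
    obtain ⟨v, rfl | rfl⟩ := (hmem D).1 hD
    · rw [mem_singleton_iff.1 hx]
      exact mem_insert _ _
    · exact Or.inr ⟨v, dist_le_of_mem_sector hx, rfl⟩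
  · intro D hD E hE x hxD hxE
    obtain ⟨v, rfl | rfl⟩ := (hmem D).1 hD
    · rw [mem_singleton_iff] at hxD
      subst hxD
      exact Or.inl (singleton_subset_iff.2 hxE)
    obtain ⟨w, rfl | rfl⟩ := (hmem E).1 hE
    · rw [mem_singleton_iff] at hxE
      subst hxE
      exact Or.inr (singleton_subset_iff.2 hxD)
    · exact sector_nested hG hxD hxE
  · intro D hD _ hDu
    obtain ⟨v, rfl | rfl⟩ := (hmem D).1 hD
    · refine ⟨sector G o v, (hmem _).2 ⟨v, Or.inr rfl⟩, ?_, (hCr v).trans ?_⟩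
      · refine ⟨singleton_subset_iff.2 (self_mem_sector G o v), fun h => ?_⟩
        obtain ⟨w, hw⟩ := successors_nonempty (by omega) hG hreg o v
        rw [mem_successors] at hw
        have := h (Relation.ReflTransGen.single hw)
        exact hw.1.ne (mem_singleton_iff.1 this).symm
      · gcongr
        nlinarith
    · have hv : v ≠ o := by
        rintro rfl
        exact hDu (sector_origin hG v)
      obtain ⟨u, hu⟩ := exists_isPredecessor hG hv
      refine ⟨sector G o u, (hmem _).2 ⟨u, Or.inr rfl⟩, ?_, (hCr u).trans ?_⟩
      · refine ⟨sector_subset (Relation.ReflTransGen.single hu), fun h => ?_⟩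
        have h1 := dist_le_of_mem_sector (h (self_mem_sector G o u))
        have h2 := hu.2
        omega
      · rw [mul_assoc]
        gcongr
        have h1 : (expMeasure G o q α).real {v} ≤ (expMeasure G o q α).real (sector G o v) :=
          measureReal_mono (singleton_subset_iff.2 (self_mem_sector G o v))
        refine le_trans (le_of_eq ?_) (mul_le_mul_of_nonneg_left h1 (by positivity))
        have h2 := congrArg ENNReal.toReal (expMeasure_successor (α := α) hq hu)
        rw [ENNReal.toReal_mul, ENNReal.toReal_ofReal (by positivity)] at h2
        rw [measureReal_def, measureReal_def, h2, ← mul_assoc, ← Real.rpow_add hq0]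
        simp
  · intro x
    rw [expMeasure_singleton]
    simpa using Real.rpow_pos_of_pos hq0 _
  · have h : expMeasure G o q α {o} = 1 := by
      rw [expMeasure_singleton]
      simp
    have h2 := measureReal_mono (μ := expMeasure G o q α) (subset_univ {o})
    rwa [measureReal_def, h, ENNReal.toReal_one] at h2
  · nlinarith

end Measure

/-! ### Averaging over the cells of a partition. -/

section Cells

variable {X : Type*}

/-- `Q` assigns to each point its cell in some partition of `X`. -/
structure IsCellMap (Q : X → Set X) : Prop where
  mem : ∀ x, x ∈ Q x
  eq_of_mem : ∀ x, ∀ y ∈ Q x, Q y = Q x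

theorem IsCellMap.mem_comm {Q : X → Set X} (hQ : IsCellMap Q) {x y : X} : y ∈ Q x ↔ x ∈ Q y :=
  ⟨fun h => hQ.eq_of_mem x y h ▸ hQ.mem x, fun h => hQ.eq_of_mem y x h ▸ hQ.mem y⟩

variable [MeasurableSpace X] [DiscreteMeasurableSpace X] [Countable X] {μ : Measure X}
  [IsFiniteMeasure μ] {Q : X → Set X}

theorem measureReal_pos_of_mem (hμ : ∀ x, μ {x} ≠ 0) {S : Set X} {x : X} (hx : x ∈ S) :
    0 < μ.real S :=
  ENNReal.toReal_pos (fun h => hμ x (measure_mono_null (singleton_subset_iff.2 hx) h))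
    (measure_ne_top _ _)

variable {E : Type*} [NormedAddCommGroup E] [NormedSpace ℝ E]

/-- The averaging kernel `1_{y ∈ Q x} / μ(Q x)` is symmetric because `Q x = Q y` whenever it is
nonzero; Fubini can then integrate in `x` first. -/
theorem cell_kernel_symm (hQ : IsCellMap Q) {D : Set X} (hD : ∀ x ∈ D, Q x ⊆ D) (h : X → E)
    (x y : X) :
    D.indicator (fun x => (Q x).indicator (fun y => (μ.real (Q x))⁻¹ • h y) y) x =
      D.indicator (fun y => (Q y).indicator (fun _ => (μ.real (Q y))⁻¹ • h y) x) y := by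
  by_cases hxy : y ∈ Q x
  · have hyx := hQ.mem_comm.1 hxy
    have hDxy : x ∈ D ↔ y ∈ D := ⟨fun h => hD x h hxy, fun h => hD y h hyx⟩
    by_cases hx : x ∈ D
    · simp [hx, hDxy.1 hx, hxy, hQ.eq_of_mem x y hxy, hQ.mem x]
    · simp [hx, mt hDxy.2 hx]
  · have hyx := mt hQ.mem_comm.2 hxy
    by_cases hx : x ∈ D <;> by_cases hy : y ∈ D <;> simp [hx, hy, hxy, hyx]

theorem integral_cell_kernel (hμ : ∀ x, μ {x} ≠ 0) (hQ : IsCellMap Q) [CompleteSpace E]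
    (c : E) (y : X) :
    ∫ x, (Q y).indicator (fun _ => (μ.real (Q y))⁻¹ • c) x ∂μ = c := by
  rw [integral_indicator .of_discrete, setIntegral_const, smul_smul,
    mul_inv_cancel₀ (measureReal_pos_of_mem hμ (hQ.mem y)).ne', one_smul]

theorem integrable_cell_kernel (hμ : ∀ x, μ {x} ≠ 0) (hQ : IsCellMap Q) {D : Set X}
    (hD : ∀ x ∈ D, Q x ⊆ D) {h : X → E} (hh : Integrable h μ) :
    Integrable (Function.uncurry fun x y => D.indicator
      (fun x => (Q x).indicator (fun y => (μ.real (Q x))⁻¹ • h y) y) x) (μ.prod μ) := by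
  have : MeasurableSingletonClass (X × X) := inferInstance
  have hm : AEStronglyMeasurable (Function.uncurry fun x y => D.indicator
      (fun x => (Q x).indicator (fun y => (μ.real (Q x))⁻¹ • h y) y) x) (μ.prod μ) :=
    StronglyMeasurable.aestronglyMeasurable (StronglyMeasurable.of_discrete)
  rw [integrable_prod_iff' hm]
  simp only [Function.uncurry, cell_kernel_symm hQ hD h]
  refine ⟨.of_forall fun y => ?_, ?_⟩
  · by_cases hy : y ∈ D
    · simpa [hy] using (integrable_const ((μ.real (Q y))⁻¹ • h y)).indicator .of_discrete
    · simp [hy]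
  · refine (hh.norm.indicator (s := D) .of_discrete).congr (.of_forall fun y => ?_)
    by_cases hy : y ∈ D
    · have : ∀ x, ‖(Q y).indicator (fun _ => (μ.real (Q y))⁻¹ • h y) x‖ =
          (Q y).indicator (fun _ => (μ.real (Q y))⁻¹ • ‖h y‖) x := by
        intro x
        by_cases hx : x ∈ Q y <;> simp [hx, norm_smul]
      simp only [hy, indicator_of_mem, this, integral_cell_kernel hμ hQ]
    · simp [hy]

/-- Averaging over the cells of a partition does not change the integral over unions of cells. -/
theorem setIntegral_average_cell (hμ : ∀ x, μ {x} ≠ 0) (hQ : IsCellMap Q) {D : Set X}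
    (hD : ∀ x ∈ D, Q x ⊆ D) [CompleteSpace E] {h : X → E} (hh : Integrable h μ) :
    ∫ x in D, (⨍ y in Q x, h y ∂μ) ∂μ = ∫ x in D, h x ∂μ := by
  have hk := integrable_cell_kernel hμ hQ hD hh
  -- Integrating the kernel in `y` produces the cell averages; integrating it in `x` gives back `h
  -- y`.
  have h1 := integral_integral_swap hk
  rw [← integral_indicator .of_discrete, ← integral_indicator .of_discrete]
  convert! h1 using 2
  · ext x
    by_cases hx : x ∈ D
    · simp only [hx, indicator_of_mem]
      rw [integral_indicator .of_discrete, integral_smul, setAverage_eq]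
    · simp [hx]
  · ext y
    simp only [cell_kernel_symm hQ hD h]
    by_cases hy : y ∈ D
    · simp only [hy, indicator_of_mem, integral_cell_kernel hμ hQ]
    · simp [hy]

theorem integrableOn_average_cell (hμ : ∀ x, μ {x} ≠ 0) (hQ : IsCellMap Q) {D : Set X}
    (hD : ∀ x ∈ D, Q x ⊆ D) {h : X → E} (hh : Integrable h μ) :
    IntegrableOn (fun x => ⨍ y in Q x, h y ∂μ) D μ := by
  have hk := (integrable_cell_kernel hμ hQ hD hh).integral_prod_left
  rw [← integrable_indicator_iff .of_discrete]
  convert! hk using 1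
  ext x
  by_cases hx : x ∈ D
  · simp only [hx, indicator_of_mem, Function.uncurry]
    rw [integral_indicator .of_discrete, integral_smul, setAverage_eq]
  · simp [hx]

theorem norm_setAverage_le (S : Set X) (h : X → E) :
    ‖⨍ y in S, h y ∂μ‖ ≤ ⨍ y in S, ‖h y‖ ∂μ :=
  norm_integral_le_integral_norm _

theorem hasSum_measureReal_singleton (S : Set X) :
    HasSum (S.indicator fun x => μ.real {x}) (μ.real S) := by
  have h1 : ∑' x, S.indicator (fun x => μ {x}) x = μ S :=
    Measure.tsum_indicator_apply_singleton μ S .of_discrete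
  have h2 := ENNReal.hasSum_toReal (f := S.indicator (fun x => μ {x}))
    (by rw [h1]; exact measure_ne_top _ _)
  convert! h2 using 1
  · ext x
    by_cases hx : x ∈ S <;> simp [hx, measureReal_def]
  · rw [← ENNReal.tsum_toReal_eq, h1, measureReal_def]
    intro x
    by_cases hx : x ∈ S <;> simp [hx]

end Cells

/-! ### Estimates from above for the `H¹` norm. -/

section Hardy

variable {X : Type*} [MeasurableSpace X] [DiscreteMeasurableSpace X] [Countable X] {μ : Measure X}
  [IsFiniteMeasure μ] {𝒟 : Set (Set X)}

theorem IsAtom.lintegral_enorm_le {a : X → ℂ} (ha : IsAtom μ 𝒟 a) : ∫⁻ x, ‖a x‖ₑ ∂μ ≤ 1 := by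
  rcases ha with rfl | ⟨D, -, hs, hb, -⟩
  · rw [lintegral_const]
    rcases eq_or_ne (μ univ) 0 with h | h
    · simp [h]
    · rw [← ofReal_norm, Complex.norm_real, Real.norm_of_nonneg (by positivity),
        measureReal_def, ← ENNReal.toReal_inv, ENNReal.ofReal_toReal (by simpa using h),
        ENNReal.inv_mul_cancel h (measure_ne_top _ _)]
  · have h1 : ∫⁻ x, ‖a x‖ₑ ∂μ = ∫⁻ x in D, ‖a x‖ₑ ∂μ := by
      rw [setLIntegral_eq_of_support_subset]
      intro x hx
      exact hs (by simpa using hx)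
    rw [h1]
    calc ∫⁻ x in D, ‖a x‖ₑ ∂μ ≤ ∫⁻ _ in D, (μ D)⁻¹ ∂μ := by
          refine lintegral_mono_ae (ae_restrict_of_ae ?_)
          filter_upwards [enorm_ae_le_eLpNormEssSup a μ] with x hx
          exact hx.trans (by simpa using hb)
      _ ≤ 1 := by
          rw [setLIntegral_const]
          exact ENNReal.inv_mul_le_one _

/-- Since points have positive mass, the `L¹` bound controls values. This gives absolute convergence
of atomic series at each point. -/
theorem IsAtom.norm_le (hμ : ∀ x, μ {x} ≠ 0) {a : X → ℂ} (ha : IsAtom μ 𝒟 a) (x : X) :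
    ‖a x‖ ≤ (μ.real {x})⁻¹ := by
  have h1 : ‖a x‖ₑ * μ {x} ≤ 1 := by
    rw [← lintegral_singleton (fun x => ‖a x‖ₑ)]
    exact (setLIntegral_le_lintegral _ _).trans ha.lintegral_enorm_le
  have hp := measureReal_pos_of_mem hμ (mem_singleton x)
  have h2 := ENNReal.toReal_mono ENNReal.one_ne_top h1
  rw [ENNReal.toReal_mul, toReal_enorm, ENNReal.toReal_one] at h2
  rwa [← one_div, le_div_iff₀ hp]

theorem lintegral_enorm_le_tsum {ι : Type*} [Countable ι] {g : X → ℂ} {f : ι → X → ℂ}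
    (h : ∀ x, HasSum (fun i => f i x) (g x)) :
    ∫⁻ x, ‖g x‖ₑ ∂μ ≤ ∑' i, ∫⁻ x, ‖f i x‖ₑ ∂μ := by
  rw [← lintegral_tsum fun i => Measurable.aemeasurable .of_discrete]
  refine lintegral_mono fun x => ?_
  rw [← (h x).tsum_eq]
  exact enorm_tsum_le_tsum_enorm

theorem lintegral_atoms_le {ι : Type*} {lam : ι → ℂ} {a : ι → X → ℂ}
    (ha : ∀ i, IsAtom μ 𝒟 (a i)) :
    ∑' i, ∫⁻ x, ‖lam i * a i x‖ₑ ∂μ ≤ ∑' i, ‖lam i‖ₑ := by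
  refine ENNReal.tsum_le_tsum fun i => ?_
  simp only [enorm_mul]
  rw [lintegral_const_mul _ .of_discrete]
  exact (mul_le_mul_right (ha i).lintegral_enorm_le _).trans (mul_one _).le

theorem lintegral_enorm_le_h1Fun (g : X → ℂ) : ∫⁻ x, ‖g x‖ₑ ∂μ ≤ h1Fun μ 𝒟 g :=
  le_iInf fun _ => le_iInf fun _ => le_iInf fun h =>
    (lintegral_enorm_le_tsum h.hasSum).trans (lintegral_atoms_le h.atom)

/-- Decompositions over any countable index set are allowed: they are transported to `ℕ` and padded
with zero coefficients and the constant atom. -/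
theorem h1Fun_le_of_atoms {ι : Type*} [Countable ι] {g : X → ℂ} {lam : ι → ℂ} {a : ι → X → ℂ}
    (ha : ∀ i, IsAtom μ 𝒟 (a i)) (hg : ∀ x, HasSum (fun i => lam i * a i x) (g x)) :
    h1Fun μ 𝒟 g ≤ ∑' i, ‖lam i‖ₑ := by
  by_cases hfin : ∑' i, ‖lam i‖ₑ = ∞
  · rw [hfin]; exact le_top
  obtain ⟨e, he⟩ := exists_injective_nat ι
  let c : X → ℂ := fun _ => (((μ.real univ)⁻¹ : ℝ) : ℂ)
  have hprod : ∀ x, (fun j => Function.extend e lam 0 j * Function.extend e a (fun _ => c) j x) =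
      Function.extend e (fun i => lam i * a i x) 0 := by
    intro x
    ext j
    by_cases hj : ∃ i, e i = j
    · obtain ⟨i, rfl⟩ := hj
      simp only [he.extend_apply]
    · simp [Function.extend_apply' _ _ _ hj]
  have hnorm : (fun j => ‖Function.extend e lam 0 j‖ₑ) =
      Function.extend e (fun i => ‖lam i‖ₑ) 0 := by
    ext j
    by_cases hj : ∃ i, e i = j
    · obtain ⟨i, rfl⟩ := hj
      simp only [he.extend_apply]
    · simp [Function.extend_apply' _ _ _ hj]
  have htsum : ∑' j, ‖Function.extend e lam 0 j‖ₑ = ∑' i, ‖lam i‖ₑ := by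
    rw [hnorm, tsum_extend_zero he]
  rw [← htsum] at hfin ⊢
  refine iInf₂_le_of_le (Function.extend e lam 0) (Function.extend e a (fun _ => c))
    (iInf_le _ ⟨fun j => ?_, ?_, ?_, fun x => ?_⟩)
  · by_cases hj : ∃ i, e i = j
    · obtain ⟨i, rfl⟩ := hj
      simpa only [he.extend_apply] using ha i
    · rw [Function.extend_apply' _ _ _ hj]
      exact Or.inl rfl
  · simpa only [toReal_enorm] using ENNReal.summable_toReal hfin
  · rw [memLp_one_iff_integrable]
    refine ⟨Measurable.of_discrete.aestronglyMeasurable, ?_⟩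
    refine ((lintegral_enorm_le_tsum hg).trans (lintegral_atoms_le ha)).trans_lt ?_
    rw [← htsum]
    exact lt_top_iff_ne_top.2 hfin
  · rw [hprod x, hasSum_extend_zero he]
    exact hg x

theorem exists_decomp_of_h1Fun_lt {g : X → ℂ} {C : ℝ≥0∞} (h : h1Fun μ 𝒟 g < C) :
    ∃ lam a, IsAtomicDecomp μ 𝒟 g lam a ∧ ∑' j, ‖lam j‖ₑ < C := by
  simp only [h1Fun, iInf_lt_iff] at h
  obtain ⟨lam, a, h, hlt⟩ := h
  exact ⟨lam, a, h, hlt⟩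

/-- Countable subadditivity of the `H¹` norm. -/
theorem h1Fun_le_tsum (hμ : ∀ x, μ {x} ≠ 0) {ι : Type*} [Countable ι] {g : X → ℂ}
    {f : ι → X → ℂ} (hg : ∀ x, HasSum (fun i => f i x) (g x)) :
    h1Fun μ 𝒟 g ≤ ∑' i, h1Fun μ 𝒟 (f i) := by
  by_cases hfin : ∑' i, h1Fun μ 𝒟 (f i) = ∞
  · rw [hfin]; exact le_top
  refine ENNReal.le_of_forall_pos_le_add fun ε hε _ => ?_
  obtain ⟨δ, hδ, hδε⟩ := ENNReal.exists_pos_sum_of_countable (ENNReal.coe_pos.2 hε).ne' ι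
  have hlt : ∀ i, h1Fun μ 𝒟 (f i) < h1Fun μ 𝒟 (f i) + δ i := fun i =>
    ENNReal.lt_add_right (ENNReal.ne_top_of_tsum_ne_top hfin i) (ENNReal.coe_pos.2 (hδ i)).ne'
  choose lam a hdec hsum using fun i => exists_decomp_of_h1Fun_lt (hlt i)
  have htot : ∑' p : ι × ℕ, ‖lam p.1 p.2‖ₑ ≤ ∑' i, h1Fun μ 𝒟 (f i) + ε := by
    rw [ENNReal.tsum_prod (f := fun i j => ‖lam i j‖ₑ)]
    refine (ENNReal.tsum_le_tsum fun i => (hsum i).le).trans ?_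
    rw [ENNReal.tsum_add]
    gcongr
  refine (h1Fun_le_of_atoms (lam := fun p : ι × ℕ => lam p.1 p.2) (a := fun p => a p.1 p.2)
    (fun p => (hdec p.1).atom p.2) fun x => ?_).trans htot
  -- Absolute convergence at `x` of the double family, which permits regrouping it into the given
  -- sum.
  have hs : Summable fun p : ι × ℕ => lam p.1 p.2 * a p.1 p.2 x := by
    have h1 : Summable fun p : ι × ℕ => ‖lam p.1 p.2‖ := by
      simpa only [toReal_enorm] using ENNReal.summable_toReal
        (ne_top_of_le_ne_top (ENNReal.add_ne_top.2 ⟨hfin, ENNReal.coe_ne_top⟩) htot)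
    refine Summable.of_norm_bounded (h1.mul_right (μ.real {x})⁻¹) fun p => ?_
    rw [norm_mul]
    exact mul_le_mul_of_nonneg_left (((hdec p.1).atom p.2).norm_le hμ x) (norm_nonneg _)
  have h2 := hs.hasSum.prod_fiberwise fun i => (hdec i).hasSum x
  rw [(hg x).unique h2]
  exact hs.hasSum

theorem h1Fun_const_le (c : ℂ) (hμ : μ univ ≠ 0) : h1Fun μ 𝒟 (fun _ => c) ≤ ‖c‖ₑ * μ univ := by
  have hpos : 0 < μ.real univ := ENNReal.toReal_pos hμ (measure_ne_top _ _)
  refine (h1Fun_le_of_atoms (ι := Unit) (lam := fun _ => c * (μ.real univ : ℂ))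
    (a := fun _ _ => (((μ.real univ)⁻¹ : ℝ) : ℂ)) (fun _ => Or.inl rfl) fun x => ?_).trans ?_
  · have h0 : (μ.real univ : ℂ) ≠ 0 := by exact_mod_cast hpos.ne'
    rw [Complex.ofReal_inv, mul_inv_cancel_right₀ h0]
    exact hasSum_unique (fun _ : Unit => c)
  · rw [tsum_fintype, Fintype.sum_unique, enorm_mul]
    gcongr
    rw [← ofReal_norm, Complex.norm_real, Real.norm_of_nonneg hpos.le, measureReal_def,
      ENNReal.ofReal_toReal (measure_ne_top _ _)]

/-- Dividing `a` by `M * μ(D)` turns it into an atom. -/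
theorem h1Fun_le_of_meanZero (hμ : ∀ x, μ {x} ≠ 0) {D : Set X} (hD : D ∈ 𝒟) (hne : D.Nonempty)
    {a : X → ℂ} {M : ℝ} (hs : Function.support a ⊆ D) (hM : ∀ x, ‖a x‖ ≤ M)
    (hmean : ∫ x in D, a x ∂μ = 0) : h1Fun μ 𝒟 a ≤ ENNReal.ofReal M * μ D := by
  obtain ⟨x₀, hx₀⟩ := hne
  have hpos := measureReal_pos_of_mem hμ hx₀
  rcases ((norm_nonneg _).trans (hM x₀)).eq_or_lt with h0 | h0
  · have : a = 0 := by
      ext x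
      simpa [← h0] using hM x
    rw [this, h1Fun_zero]
    exact bot_le
  have hne : ((M * μ.real D : ℝ) : ℂ) ≠ 0 := by exact_mod_cast (mul_pos h0 hpos).ne'
  refine (h1Fun_le_of_atoms (ι := Unit) (lam := fun _ => ((M * μ.real D : ℝ) : ℂ))
    (a := fun _ x => ((M * μ.real D : ℝ) : ℂ)⁻¹ * a x)
    (fun _ => Or.inr ⟨D, hD, fun x hx => hs ?_, ?_, ?_⟩) fun x => ?_).trans ?_
  · simp only [Function.mem_support] at hx ⊢
    exact right_ne_zero_of_mul hx
  · have hμD : (μ D)⁻¹ = ENNReal.ofReal (μ.real D)⁻¹ := by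
      rw [ENNReal.ofReal_inv_of_pos hpos, measureReal_def, ENNReal.ofReal_toReal (measure_ne_top _ _)]
    rw [hμD, eLpNorm_exponent_top]
    refine eLpNormEssSup_le_of_ae_bound (.of_forall fun x => ?_)
    rw [norm_mul, norm_inv, Complex.norm_real, Real.norm_of_nonneg (by positivity), mul_inv,
      mul_comm M⁻¹, mul_assoc]
    refine mul_le_of_le_one_right (by positivity) ?_
    rw [inv_mul_le_iff₀ h0, mul_one]
    exact hM x
  · rw [integral_const_mul, hmean, mul_zero]
  · convert! hasSum_unique (β := Unit) _ using 1
    rw [mul_inv_cancel_left₀ hne]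
  · rw [tsum_fintype, Fintype.sum_unique, ← ofReal_norm, Complex.norm_real,
      Real.norm_of_nonneg (by positivity), ENNReal.ofReal_mul h0.le, measureReal_def,
      ENNReal.ofReal_toReal (measure_ne_top _ _)]

/-- `A` is bounded by `M`, vanishes outside the union `Ω` of cells of `Q`, and has mean zero on the
cells, which belong to `𝒟`. -/
structure IsMolecule (μ : Measure X) (𝒟 : Set (Set X)) (Q : X → Set X) (Ω : Set X) (M : ℝ)
    (A : X → ℂ) : Prop where
  cellMap : IsCellMap Q
  cell_mem : ∀ x, Q x ∈ 𝒟
  cell_subset : ∀ x ∈ Ω, Q x ⊆ Ω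
  eq_zero : ∀ x ∉ Ω, A x = 0
  norm_le : ∀ x, ‖A x‖ ≤ M
  mean_zero : ∀ x, ∫ y in Q x, A y ∂μ = 0

theorem IsMolecule.disjoint {Q : X → Set X} {Ω : Set X} {M : ℝ} {A : X → ℂ}
    (hA : IsMolecule μ 𝒟 Q Ω M A) {x y : X} (hx : x ∉ Ω) (hy : y ∈ Q x) : y ∉ Ω :=
  fun h => hx (hA.cell_subset y h (hA.cellMap.mem_comm.1 hy))

/-- Restricted to one cell, `A` is a multiple of an atom of size `M` times the measure of the cell;
the cells inside `Ω` are disjoint, and their costs add up to `M * μ Ω`. -/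
theorem IsMolecule.h1Fun_le (hμ : ∀ x, μ {x} ≠ 0) {Q : X → Set X} {Ω : Set X} {M : ℝ}
    {A : X → ℂ} (hA : IsMolecule μ 𝒟 Q Ω M A) : h1Fun μ 𝒟 A ≤ ENNReal.ofReal M * μ Ω := by
  have hQ := hA.cellMap
  -- The sum is indexed by points rather than cells. The point `x` contributes the fraction `μ{x} /
  -- μ(Q x)` of its cell, and these fractions sum to one over each cell.
  let f : X → X → ℂ := fun x y => ((μ.real {x} / μ.real (Q x) : ℝ) : ℂ) • (Q x).indicator A y
  have hsum : ∀ y, HasSum (fun x => f x y) (A y) := by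
    intro y
    have hpos := measureReal_pos_of_mem hμ (hQ.mem y)
    have h1 : HasSum (fun x => ((Q y).indicator (fun x => μ.real {x}) x / μ.real (Q y) : ℝ)) 1 := by
      rw [← div_self hpos.ne']
      exact (hasSum_measureReal_singleton (μ := μ) (Q y)).div_const _
    have h2 := (Complex.hasSum_ofReal.2 h1).mul_right (A y)
    rw [Complex.ofReal_one, one_mul] at h2
    convert! h2 using 2 with x
    by_cases hxy : y ∈ Q x
    · have hyx := hQ.mem_comm.1 hxy
      simp [f, hxy, hQ.eq_of_mem x y hxy, hQ.mem x]
    · have hyx := mt hQ.mem_comm.2 hxy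
      simp [f, hxy, hyx]
  refine (h1Fun_le_tsum hμ hsum).trans ?_
  calc ∑' x, h1Fun μ 𝒟 (f x) ≤ ∑' x, ENNReal.ofReal M * Ω.indicator (fun x => μ {x}) x := by
        refine ENNReal.tsum_le_tsum fun x => ?_
        have hpos := measureReal_pos_of_mem hμ (hQ.mem x)
        by_cases hx : x ∈ Ω
        · refine ((h1Norm μ 𝒟).smul_le' _ _).trans ?_
          have h3 : h1Fun μ 𝒟 ((Q x).indicator A) ≤ ENNReal.ofReal M * μ (Q x) := by
            refine h1Fun_le_of_meanZero hμ (hA.cell_mem x) ⟨x, hQ.mem x⟩ support_indicator_subset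
              (fun y => (norm_indicator_le_norm_self A y).trans (hA.norm_le y)) ?_
            rw [setIntegral_indicator .of_discrete, inter_self]
            exact hA.mean_zero x
          refine (mul_le_mul_right h3 _).trans ?_
          rw [indicator_of_mem hx, ← ofReal_norm, Complex.norm_real,
            Real.norm_of_nonneg (by positivity), ENNReal.ofReal_div_of_pos hpos, measureReal_def,
            measureReal_def, ENNReal.ofReal_toReal (measure_ne_top _ _),
            ENNReal.ofReal_toReal (measure_ne_top _ _), mul_left_comm,
            ENNReal.div_mul_cancel _ (measure_ne_top _ _)]
          exact fun h => hμ x (measure_mono_null (singleton_subset_iff.2 (hQ.mem x)) h)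
        · have : f x = 0 := by
            ext y
            by_cases hy : y ∈ Q x
            · simp [f, hy, hA.eq_zero y (hA.disjoint hx hy)]
            · simp [f, hy]
          rw [this, h1Fun_zero]
          exact bot_le
    _ = ENNReal.ofReal M * μ Ω := by
        rw [ENNReal.tsum_mul_left, Measure.tsum_indicator_apply_singleton μ Ω .of_discrete]

/-- The mean is a multiple of the constant atom and costs `M * μ(X)`; the remainder has mean zero
and size at most `2 * M`. -/
theorem h1Fun_le_of_bounded (hμ : ∀ x, μ {x} ≠ 0) (hu : univ ∈ 𝒟) [Nonempty X] {h : X → ℂ} {M : ℝ}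
    (hM : ∀ x, ‖h x‖ ≤ M) : h1Fun μ 𝒟 h ≤ ENNReal.ofReal (3 * M) * μ univ := by
  obtain ⟨x₀⟩ := ‹Nonempty X›
  have hM0 : 0 ≤ M := (norm_nonneg _).trans (hM x₀)
  have hpos := measureReal_pos_of_mem (μ := μ) hμ (mem_univ x₀)
  have hint : Integrable h μ :=
    Integrable.of_bound Measurable.of_discrete.aestronglyMeasurable M (.of_forall hM)
  set c : ℂ := ⨍ x, h x ∂μ with hc
  have hcM : ‖c‖ ≤ M := by
    rw [hc, average_eq, norm_smul, norm_inv, Real.norm_of_nonneg hpos.le, inv_mul_le_iff₀ hpos,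
      mul_comm]
    exact norm_integral_le_of_norm_le_const (.of_forall hM)
  have h1 : h = (fun _ => c) + fun x => h x - c := by
    ext x
    simp
  rw [h1, show 3 * M = M + 2 * M by ring, ENNReal.ofReal_add hM0 (by positivity), add_mul]
  refine ((h1Norm μ 𝒟).add_le' _ _).trans (add_le_add ?_ ?_)
  · refine (h1Fun_const_le c (fun h0 => hpos.ne' (by simp [measureReal_def, h0]))).trans ?_
    gcongr
    rw [← ofReal_norm]
    exact ENNReal.ofReal_le_ofReal hcM
  · refine h1Fun_le_of_meanZero hμ hu ⟨x₀, mem_univ _⟩ (subset_univ _) (fun x => ?_) ?_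
    · refine (norm_sub_le _ _).trans ?_
      linarith [hM x]
    · rw [setIntegral_univ]
      exact integral_sub_average μ h

end Hardy

/-! ### Pairing BMO functions with molecules. -/

section BMO

variable {X : Type*} [MeasurableSpace X] [DiscreteMeasurableSpace X] [Countable X] {μ : Measure X}
  [IsFiniteMeasure μ] {𝒟 : Set (Set X)}

theorem lintegral_oscillation_le {b : X → ℂ} {D : Set X} (hD : D ∈ 𝒟) (hμD : μ D ≠ 0) :
    ∫⁻ x in D, ‖b x - ⨍ y in D, b y ∂μ‖ₑ ∂μ ≤ bmoFun μ 𝒟 b * μ D := by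
  by_cases hi : Integrable b μ
  · rw [← ENNReal.div_le_iff hμD (measure_ne_top _ _), ← setLAverage_eq, bmoFun, if_pos hi]
    exact (le_iSup₂ (f := fun D (_ : D ∈ 𝒟) => ⨍⁻ x in D, ‖b x - ⨍ y in D, b y ∂μ‖ₑ ∂μ)
      D hD).trans le_self_add
  · rw [bmoFun, if_neg hi, ENNReal.top_mul hμD]
    exact le_top

/-- Oscillation on the whole space controls `b` minus its mean, and the last term of the norm
controls the mean. -/
theorem lintegral_enorm_le_bmoFun (hu : univ ∈ 𝒟) (hμ : μ univ ≠ 0) (b : X → ℂ) :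
    ∫⁻ x, ‖b x‖ₑ ∂μ ≤ (μ univ + 1) * bmoFun μ 𝒟 b := by
  by_cases hi : Integrable b μ
  swap
  · rw [bmoFun, if_neg hi, ENNReal.mul_top (by simp)]
    exact le_top
  set c : ℂ := ⨍ x, b x ∂μ with hc
  have hpos : 0 < μ.real univ := ENNReal.toReal_pos hμ (measure_ne_top _ _)
  have h2 : ‖c‖ₑ * μ univ = ‖∫ x, b x ∂μ‖ₑ := by
    rw [← measure_smul_average, enorm_smul, mul_comm, ← ofReal_norm (μ.real univ),
      Real.norm_of_nonneg hpos.le, measureReal_def, ENNReal.ofReal_toReal (measure_ne_top _ _)]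
  calc ∫⁻ x, ‖b x‖ₑ ∂μ ≤ ∫⁻ x, (‖b x - c‖ₑ + ‖c‖ₑ) ∂μ := by
        refine lintegral_mono fun x => ?_
        simpa using enorm_add_le (b x - c) c
    _ = ∫⁻ x in univ, ‖b x - ⨍ y in univ, b y ∂μ‖ₑ ∂μ + ‖∫ x, b x ∂μ‖ₑ := by
        rw [lintegral_add_left .of_discrete, lintegral_const, h2]
        simp only [Measure.restrict_univ, hc]
    _ ≤ bmoFun μ 𝒟 b * μ univ + bmoFun μ 𝒟 b := by
        refine add_le_add (lintegral_oscillation_le hu hμ) ?_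
        rw [bmoFun, if_pos hi]
        exact le_add_self
    _ = _ := by ring

/-- As `A` has mean zero on `D`, the average of `b` may be subtracted, leaving the oscillation of
`b`. -/
theorem enorm_setIntegral_mul_le {b A : X → ℂ} {D : Set X} {M : ℝ} (hb : Integrable b μ)
    (hM : ∀ x, ‖A x‖ ≤ M) (hmean : ∫ x in D, A x ∂μ = 0) (hD : D ∈ 𝒟) (hμD : μ D ≠ 0) :
    ‖∫ x in D, b x * A x ∂μ‖ₑ ≤ ENNReal.ofReal M * (bmoFun μ 𝒟 b * μ D) := by
  set c : ℂ := ⨍ x in D, b x ∂μ with hc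
  have hA : Integrable A μ :=
    Integrable.of_bound Measurable.of_discrete.aestronglyMeasurable M (.of_forall hM)
  have hbA : Integrable (fun x => b x * A x) μ :=
    hb.mul_bdd (c := M) Measurable.of_discrete.aestronglyMeasurable (.of_forall hM)
  have h1 : ∫ x in D, b x * A x ∂μ = ∫ x in D, (b x - c) * A x ∂μ := by
    simp only [sub_mul]
    rw [integral_sub hbA.integrableOn (hA.const_mul c).integrableOn, integral_const_mul, hmean,
      mul_zero, sub_zero]
  rw [h1]
  refine (enorm_integral_le_lintegral_enorm _).trans
    (le_trans ?_ (mul_le_mul_right (lintegral_oscillation_le (b := b) hD hμD) _))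
  rw [← lintegral_const_mul _ .of_discrete]
  refine lintegral_mono fun x => ?_
  rw [enorm_mul, mul_comm]
  gcongr
  rw [← ofReal_norm]
  exact ENNReal.ofReal_le_ofReal (hM x)

/-- The part of `H¹`–BMO duality that is needed, proved cell by cell. The integral of `b A` equals
the integral of its cell averages, which are at most `M * ‖b‖` on `Ω` and vanish elsewhere. -/
theorem IsMolecule.enorm_integral_mul_le (hμ : ∀ x, μ {x} ≠ 0) {Q : X → Set X} {Ω : Set X} {M : ℝ}
    {A b : X → ℂ} (hA : IsMolecule μ 𝒟 Q Ω M A) (hb : Integrable b μ) :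
    ‖∫ x, b x * A x ∂μ‖ₑ ≤ ENNReal.ofReal M * bmoFun μ 𝒟 b * μ Ω := by
  have hQ := hA.cellMap
  have hbA : Integrable (fun x => b x * A x) μ :=
    hb.mul_bdd (c := M) Measurable.of_discrete.aestronglyMeasurable (.of_forall hA.norm_le)
  have h1 := setIntegral_average_cell hμ hQ (D := univ) (fun _ _ => subset_univ _) hbA
  rw [setIntegral_univ, setIntegral_univ] at h1
  rw [← h1]
  refine (enorm_integral_le_lintegral_enorm _).trans ?_
  rw [← setLIntegral_const, ← lintegral_indicator .of_discrete]
  refine lintegral_mono fun x => ?_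
  have hμQ : μ (Q x) ≠ 0 :=
    fun h => hμ x (measure_mono_null (singleton_subset_iff.2 (hQ.mem x)) h)
  by_cases hx : x ∈ Ω
  · rw [indicator_of_mem hx, setAverage_eq, enorm_smul, enorm_inv, ← ofReal_norm,
      Real.norm_of_nonneg measureReal_nonneg, measureReal_def,
      ENNReal.ofReal_toReal (measure_ne_top _ _)]
    · refine (mul_le_mul_right (enorm_setIntegral_mul_le hb hA.norm_le (hA.mean_zero x)
        (hA.cell_mem x) hμQ) _).trans ?_
      rw [← mul_assoc (ENNReal.ofReal M), mul_comm _ (μ (Q x)),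
        ENNReal.inv_mul_cancel_left hμQ (measure_ne_top _ _)]
    · exact (measureReal_pos_of_mem hμ (hQ.mem x)).ne'
  · have h2 : ∫ y in Q x, b y * A y ∂μ = 0 :=
      setIntegral_eq_zero_of_forall_eq_zero fun y hy => by
        rw [hA.eq_zero y (hA.disjoint hx hy), mul_zero]
    rw [setAverage_eq, h2]
    simp

end BMO

/-! ### Geometric sums are comparable to their largest term. -/

section Geometric

theorem sum_range_two_rpow_le {a : ℝ} (ha : 0 < a) (n : ℕ) :
    ∑ k ∈ Finset.range (n + 1), (2 : ℝ) ^ ((k : ℝ) * a)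
      ≤ (1 - (2 : ℝ) ^ (-a))⁻¹ * (2 : ℝ) ^ ((n : ℝ) * a) := by
  have h1 : (2 : ℝ) ^ (-a) < 1 := Real.rpow_lt_one_of_one_lt_of_neg one_lt_two (by linarith)
  have h0 : (0 : ℝ) < 2 ^ (-a) := by positivity
  have hpos : 0 < 1 - (2 : ℝ) ^ (-a) := by linarith
  rw [inv_mul_eq_div, le_div_iff₀ hpos]
  induction n with
  | zero => simp only [zero_add, Finset.range_one, Finset.sum_singleton, Nat.cast_zero, zero_mul,
      Real.rpow_zero]; linarith
  | succ n ih =>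
    rw [Finset.sum_range_succ, add_mul]
    have h2 : (2 : ℝ) ^ ((n : ℝ) * a) = 2 ^ (((n + 1 : ℕ) : ℝ) * a) * 2 ^ (-a) := by
      rw [← Real.rpow_add two_pos]
      congr 1
      push_cast
      ring
    rw [h2] at ih
    linarith

/-- Every finite partial sum is at most a constant times its top term, and that term is at most `B`.
The constant depends on `a` only, so the bound can be used pointwise with `P` and `B` varying with
`x`. -/
theorem exists_tsum_two_rpow_le {a : ℝ} (ha : 0 < a) : ∃ C : ℝ≥0, ∀ (P : Set ℕ) (B : ℝ≥0∞),
    (∀ k ∈ P, ENNReal.ofReal ((2 : ℝ) ^ ((k : ℝ) * a)) ≤ B) →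
      ∑' k, P.indicator (fun k : ℕ => ENNReal.ofReal ((2 : ℝ) ^ ((k : ℝ) * a))) k ≤ C * B := by
  classical
  refine ⟨Real.toNNReal (1 - (2 : ℝ) ^ (-a))⁻¹, fun P B hB => ?_⟩
  rw [ENNReal.tsum_eq_iSup_sum]
  refine iSup_le fun s => ?_
  simp only [indicator_apply]
  rw [← Finset.sum_filter]
  rcases (s.filter (· ∈ P)).eq_empty_or_nonempty with h | h
  · simp [h]
  · set m := (s.filter (· ∈ P)).max' h with hm
    have hmP : m ∈ P := (Finset.mem_filter.1 (Finset.max'_mem _ h)).2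
    calc ∑ k ∈ s.filter (· ∈ P), ENNReal.ofReal ((2 : ℝ) ^ ((k : ℝ) * a))
        ≤ ∑ k ∈ Finset.range (m + 1), ENNReal.ofReal ((2 : ℝ) ^ ((k : ℝ) * a)) :=
          Finset.sum_le_sum_of_subset fun k hk =>
            Finset.mem_range.2 (Nat.lt_succ_of_le (Finset.le_max' _ k hk))
      _ ≤ ENNReal.ofReal ((1 - (2 : ℝ) ^ (-a))⁻¹ * (2 : ℝ) ^ ((m : ℝ) * a)) := by
          rw [← ENNReal.ofReal_sum_of_nonneg fun k _ => by positivity]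
          exact ENNReal.ofReal_le_ofReal (sum_range_two_rpow_le ha m)
      _ ≤ _ := by
          rw [ENNReal.ofReal_mul' (by positivity)]
          exact mul_le_mul_right (hB m hmP) _

end Geometric

/-! ### Calderón–Zygmund decompositions at dyadic heights. -/

section CalderonZygmund

variable {X : Type*} [MeasurableSpace X] [DiscreteMeasurableSpace X] [Countable X] {μ : Measure X}
  [IsFiniteMeasure μ] {𝒟 : Set (Set X)} {K : ℝ} {g : X → ℂ} {s t : ℝ} {x y : X}

/-- The set where the dyadic maximal function of `g` exceeds `t`. -/
def overAvg (μ : Measure X) (𝒟 : Set (Set X)) (g : X → ℂ) (t : ℝ) : Set X :=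
  {x | ∃ D ∈ 𝒟, x ∈ D ∧ t < ⨍ y in D, ‖g y‖ ∂μ}

/-- The largest member of `𝒟` through `x` on which the average of `‖g‖` exceeds `t`, and `{x}` if
there is none. -/
def stopCell (μ : Measure X) (𝒟 : Set (Set X)) (g : X → ℂ) (t : ℝ) (x : X) : Set X :=
  ⋃₀ {D | D ∈ 𝒟 ∧ x ∈ D ∧ (D = {x} ∨ t < ⨍ y in D, ‖g y‖ ∂μ)}

/-- The good part of the Calderón–Zygmund decomposition of `g` at height `t`. -/
noncomputable def goodPart (μ : Measure X) (𝒟 : Set (Set X)) (g : X → ℂ) (t : ℝ) (x : X) : ℂ :=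
  ⨍ y in stopCell μ 𝒟 g t x, g y ∂μ

/-- The difference of the good parts at heights `2 ^ (k + 1)` and `2 ^ k`. -/
noncomputable def czPiece (μ : Measure X) (𝒟 : Set (Set X)) (g : X → ℂ) (k : ℕ) (x : X) : ℂ :=
  goodPart μ 𝒟 g (2 ^ (k + 1)) x - goodPart μ 𝒟 g (2 ^ k) x

theorem subset_stopCell {D : Set X} (hD : D ∈ 𝒟) (hx : x ∈ D)
    (h : D = {x} ∨ t < ⨍ y in D, ‖g y‖ ∂μ) : D ⊆ stopCell μ 𝒟 g t x :=
  subset_sUnion_of_mem (show D ∈ {D | D ∈ 𝒟 ∧ x ∈ D ∧ (D = {x} ∨ t < ⨍ y in D, ‖g y‖ ∂μ)} from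
    ⟨hD, hx, h⟩)

/-- Finitely many dyadic sets contain `x` and any two are nested, so a maximal candidate is the
largest and equals the union. -/
theorem IsRegularDyadic.stopCell_spec (h : IsRegularDyadic μ 𝒟 K) (g : X → ℂ) (t : ℝ) (x : X) :
    stopCell μ 𝒟 g t x ∈ 𝒟 ∧ x ∈ stopCell μ 𝒟 g t x ∧
      (stopCell μ 𝒟 g t x = {x} ∨ t < ⨍ y in stopCell μ 𝒟 g t x, ‖g y‖ ∂μ) := by
  set F : Set (Set X) := {D | D ∈ 𝒟 ∧ x ∈ D ∧ (D = {x} ∨ t < ⨍ y in D, ‖g y‖ ∂μ)} with hF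
  have hfin : F.Finite := (h.finite_containing x).subset fun D hD => ⟨hD.1, hD.2.1⟩
  have hne : F.Nonempty := ⟨{x}, h.singleton_mem x, rfl, Or.inl rfl⟩
  obtain ⟨D, hD⟩ := hfin.exists_maximal hne
  have hDF : D ∈ F := hD.prop
  have hU : stopCell μ 𝒟 g t x = D := by
    refine (sUnion_subset fun E hE => ?_).antisymm (subset_sUnion_of_mem hDF)
    rcases h.nested D hDF.1 E hE.1 x hDF.2.1 hE.2.1 with h1 | h1
    · exact hD.le_of_ge hE h1
    · exact h1
  rw [hU]
  exact hDF

/-- A stopping cell with large average is a candidate for each of its points `y`, hence contained in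
the cell of `y`; the converse inclusion follows in the same way, or because the cell of `y` is
`{y}`. -/
theorem IsRegularDyadic.isCellMap_stopCell (h : IsRegularDyadic μ 𝒟 K) (g : X → ℂ) (t : ℝ) :
    IsCellMap (stopCell μ 𝒟 g t) := by
  refine ⟨fun x => (h.stopCell_spec g t x).2.1, fun x y hy => ?_⟩
  obtain ⟨hxD, hx, hxt⟩ := h.stopCell_spec g t x
  obtain ⟨hyD, hyy, hyt⟩ := h.stopCell_spec g t y
  rcases hxt with hxt | hxt
  · rw [hxt, mem_singleton_iff] at hy
    rw [hy]
  · have h1 : stopCell μ 𝒟 g t x ⊆ stopCell μ 𝒟 g t y := subset_stopCell hxD hy (Or.inr hxt)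
    refine Subset.antisymm ?_ h1
    rcases hyt with hyt | hyt
    · rw [hyt]
      exact singleton_subset_iff.2 hy
    · exact subset_stopCell hyD (h1 hx) (Or.inr hyt)

/-- On this set even a singleton stopping cell has large average: a set witnessing membership must
coincide with it. -/
theorem IsRegularDyadic.lt_setAverage_stopCell (h : IsRegularDyadic μ 𝒟 K)
    (hx : x ∈ overAvg μ 𝒟 g t) : t < ⨍ y in stopCell μ 𝒟 g t x, ‖g y‖ ∂μ := by
  obtain ⟨D, hD, hxD, hlt⟩ := hx
  rcases (h.stopCell_spec g t x).2.2 with h1 | h1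
  · have h2 : D ⊆ stopCell μ 𝒟 g t x := subset_stopCell hD hxD (Or.inr hlt)
    rw [h1, subset_singleton_iff_eq] at h2
    rcases h2 with rfl | h2
    · exact absurd hxD (notMem_empty x)
    · rw [h1, ← h2]
      exact hlt
  · exact h1

theorem IsRegularDyadic.stopCell_eq_singleton (h : IsRegularDyadic μ 𝒟 K)
    (hx : x ∉ overAvg μ 𝒟 g t) : stopCell μ 𝒟 g t x = {x} := by
  obtain ⟨h1, h2, h3 | h3⟩ := h.stopCell_spec g t x
  · exact h3
  · exact absurd ⟨_, h1, h2, h3⟩ hx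

theorem IsRegularDyadic.stopCell_subset_overAvg (h : IsRegularDyadic μ 𝒟 K)
    (hx : x ∈ overAvg μ 𝒟 g t) : stopCell μ 𝒟 g t x ⊆ overAvg μ 𝒟 g t :=
  fun _ hy => ⟨_, (h.stopCell_spec g t x).1, hy, h.lt_setAverage_stopCell hx⟩

/-- The partition at a greater height refines the one at a lower height. This makes differences of
good parts have mean zero on the coarser cells. -/
theorem stopCell_anti (hst : s ≤ t) : stopCell μ 𝒟 g t x ⊆ stopCell μ 𝒟 g s x :=
  sUnion_subset fun _ hD => subset_stopCell hD.1 hD.2.1 (hD.2.2.imp_right fun h => hst.trans_lt h)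

theorem overAvg_anti (hst : s ≤ t) : overAvg μ 𝒟 g t ⊆ overAvg μ 𝒟 g s :=
  fun _ ⟨D, hD, hx, h⟩ => ⟨D, hD, hx, hst.trans_lt h⟩

theorem setAverage_singleton (hμ : ∀ x, μ {x} ≠ 0) {E : Type*} [NormedAddCommGroup E]
    [NormedSpace ℝ E] [CompleteSpace E] (f : X → E) (x : X) : ⨍ y in {x}, f y ∂μ = f x := by
  rw [setAverage_eq, integral_singleton, smul_smul,
    inv_mul_cancel₀ (measureReal_pos_of_mem hμ (mem_singleton x)).ne', one_smul]

theorem IsRegularDyadic.norm_le_of_notMem (h : IsRegularDyadic μ 𝒟 K)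
    (hx : x ∉ overAvg μ 𝒟 g t) : ‖g x‖ ≤ t := by
  by_contra! hlt
  refine hx ⟨{x}, h.singleton_mem x, rfl, ?_⟩
  rwa [setAverage_singleton h.measure_singleton_ne_zero]

theorem IsRegularDyadic.goodPart_eq (h : IsRegularDyadic μ 𝒟 K)
    (hx : x ∉ overAvg μ 𝒟 g t) : goodPart μ 𝒟 g t x = g x := by
  rw [goodPart, h.stopCell_eq_singleton hx, setAverage_singleton h.measure_singleton_ne_zero]

/-- The parent of a stopping cell was not selected, so its average is at most `t`; passing to the
cell costs `K`. The parent exists because `hgt` keeps the whole space from being selected. -/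
theorem IsRegularDyadic.norm_goodPart_le (h : IsRegularDyadic μ 𝒟 K) (hg : Integrable g μ)
    (ht : 0 ≤ t) (hgt : ⨍ y, ‖g y‖ ∂μ ≤ t) (x : X) : ‖goodPart μ 𝒟 g t x‖ ≤ K * t := by
  by_cases hx : x ∈ overAvg μ 𝒟 g t
  · obtain ⟨hD, hxD, -⟩ := h.stopCell_spec g t x
    set D := stopCell μ 𝒟 g t x with hDdef
    have hlt := h.lt_setAverage_stopCell hx
    rw [← hDdef] at hlt
    have hDu : D ≠ univ := by
      intro h1
      rw [h1, Measure.restrict_univ] at hlt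
      linarith
    obtain ⟨E, hE, hDE, hEK⟩ := h.exists_parent D hD ⟨x, hxD⟩ hDu
    have hEt : ⨍ y in E, ‖g y‖ ∂μ ≤ t := by
      by_contra! h1
      exact hDE.2 (subset_stopCell hE (hDE.1 hxD) (Or.inr h1))
    have hpD := measureReal_pos_of_mem h.measure_singleton_ne_zero hxD
    have hpE := measureReal_pos_of_mem h.measure_singleton_ne_zero (hDE.1 hxD)
    refine (norm_setAverage_le _ _).trans ?_
    rw [← hDdef, setAverage_eq, smul_eq_mul, inv_mul_le_iff₀ hpD]
    rw [setAverage_eq, smul_eq_mul, inv_mul_le_iff₀ hpE] at hEt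
    calc ∫ y in D, ‖g y‖ ∂μ ≤ ∫ y in E, ‖g y‖ ∂μ :=
          setIntegral_mono_set hg.norm.integrableOn (.of_forall fun y => norm_nonneg _)
            hDE.1.eventuallyLE
      _ ≤ μ.real E * t := hEt
      _ ≤ K * μ.real D * t := by gcongr
      _ = _ := by ring
  · rw [h.goodPart_eq hx]
    have := h.norm_le_of_notMem hx
    nlinarith [h.one_le_const]

theorem IsRegularDyadic.setIntegral_goodPart (h : IsRegularDyadic μ 𝒟 K) (hg : Integrable g μ)
    {D : Set X} (hD : ∀ x ∈ D, stopCell μ 𝒟 g t x ⊆ D) :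
    ∫ x in D, goodPart μ 𝒟 g t x ∂μ = ∫ x in D, g x ∂μ :=
  setIntegral_average_cell h.measure_singleton_ne_zero (h.isCellMap_stopCell g t) hD hg

/-- Both good parts have the integral of `g` over the cells at height `2 ^ k`. The size bound is `K
* 2 ^ (k + 1) + K * 2 ^ k`. -/
theorem IsRegularDyadic.isMolecule_czPiece (h : IsRegularDyadic μ 𝒟 K) (hg : Integrable g μ)
    (hg1 : ⨍ y, ‖g y‖ ∂μ ≤ 1) (k : ℕ) :
    IsMolecule μ 𝒟 (stopCell μ 𝒟 g (2 ^ k)) (overAvg μ 𝒟 g (2 ^ k)) (3 * K * 2 ^ k)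
      (czPiece μ 𝒟 g k) := by
  have hQ := h.isCellMap_stopCell g (2 ^ k)
  have h2k : (1 : ℝ) ≤ 2 ^ k := one_le_pow₀ one_le_two
  have h2k1 : (1 : ℝ) ≤ 2 ^ (k + 1) := one_le_pow₀ one_le_two
  have hle : (2 : ℝ) ^ k ≤ 2 ^ (k + 1) := pow_le_pow_right₀ one_le_two (Nat.le_succ k)
  have hb := fun x => h.norm_goodPart_le hg (by positivity) (hg1.trans h2k) x
  have hb1 := fun x => h.norm_goodPart_le hg (by positivity) (hg1.trans h2k1) x
  refine ⟨hQ, fun x => (h.stopCell_spec g _ x).1, fun x hx => h.stopCell_subset_overAvg hx,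
    fun x hx => ?_, fun x => ?_, fun x => ?_⟩
  · rw [czPiece, h.goodPart_eq hx, h.goodPart_eq fun h1 => hx (overAvg_anti hle h1), sub_self]
  · refine (norm_sub_le _ _).trans ((add_le_add (hb1 x) (hb x)).trans (le_of_eq ?_))
    ring
  · simp only [czPiece]
    have hi : ∀ (t M : ℝ), (∀ x, ‖goodPart μ 𝒟 g t x‖ ≤ M) → Integrable (goodPart μ 𝒟 g t) μ :=
      fun t M hM =>
        Integrable.of_bound Measurable.of_discrete.aestronglyMeasurable M (.of_forall hM)
    rw [integral_sub (hi _ _ hb1).integrableOn (hi _ _ hb).integrableOn,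
      h.setIntegral_goodPart hg, h.setIntegral_goodPart hg, sub_self]
    · exact fun y hy => (hQ.eq_of_mem x y hy).le
    · exact fun y hy => (stopCell_anti hle).trans (hQ.eq_of_mem x y hy).le

theorem IsRegularDyadic.setAverage_norm_le (h : IsRegularDyadic μ 𝒟 K) (hg : Integrable g μ)
    {D : Set X} (hx : x ∈ D) : ⨍ y in D, ‖g y‖ ∂μ ≤ (μ.real {x})⁻¹ * ∫ y, ‖g y‖ ∂μ := by
  have hp := measureReal_pos_of_mem (μ := μ) h.measure_singleton_ne_zero (mem_singleton x)
  rw [setAverage_eq, smul_eq_mul]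
  exact mul_le_mul (inv_anti₀ hp (measureReal_mono (singleton_subset_iff.2 hx)))
    (setIntegral_le_integral hg.norm (.of_forall fun y => norm_nonneg _))
    (integral_nonneg fun y => norm_nonneg _) (inv_nonneg.2 hp.le)

/-- Averages over sets containing `x` are at most `‖g‖₁ / μ{x}`. Hence every series of pieces is a
finite sum at each point. -/
theorem IsRegularDyadic.exists_notMem_overAvg (h : IsRegularDyadic μ 𝒟 K) (hg : Integrable g μ)
    (x : X) : ∃ N : ℕ, ∀ k, N ≤ k → x ∉ overAvg μ 𝒟 g (2 ^ k) := by
  obtain ⟨N, hN⟩ := pow_unbounded_of_one_lt ((μ.real {x})⁻¹ * ∫ y, ‖g y‖ ∂μ) one_lt_two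
  refine ⟨N, fun k hk => ?_⟩
  rintro ⟨D, -, hx, hlt⟩
  have h1 := h.setAverage_norm_le hg hx
  have h2 : (2 : ℝ) ^ N ≤ 2 ^ k := pow_le_pow_right₀ one_le_two hk
  linarith

theorem IsRegularDyadic.czPiece_eq_zero (h : IsRegularDyadic μ 𝒟 K) {k : ℕ}
    (hx : x ∉ overAvg μ 𝒟 g (2 ^ k)) : czPiece μ 𝒟 g k x = 0 := by
  have hle : (2 : ℝ) ^ k ≤ 2 ^ (k + 1) := pow_le_pow_right₀ one_le_two (Nat.le_succ k)
  rw [czPiece, h.goodPart_eq hx, h.goodPart_eq fun h1 => hx (overAvg_anti hle h1), sub_self]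

theorem IsRegularDyadic.hasSum_mul_czPiece (h : IsRegularDyadic μ 𝒟 K) (hg : Integrable g μ)
    (c : ℕ → ℂ) (x : X) :
    HasSum (fun k => c k * czPiece μ 𝒟 g k x) (∑' k, c k * czPiece μ 𝒟 g k x) := by
  obtain ⟨N, hN⟩ := h.exists_notMem_overAvg hg x
  refine (summable_of_ne_finset_zero (s := Finset.range N) fun k hk => ?_).hasSum
  rw [h.czPiece_eq_zero (hN k (by simpa using hk)), mul_zero]

theorem IsRegularDyadic.tsum_czPiece (h : IsRegularDyadic μ 𝒟 K) (hg : Integrable g μ) (x : X) :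
    goodPart μ 𝒟 g 1 x + ∑' k, czPiece μ 𝒟 g k x = g x := by
  obtain ⟨N, hN⟩ := h.exists_notMem_overAvg hg x
  rw [tsum_eq_sum (s := Finset.range N) fun k hk => h.czPiece_eq_zero (hN k (by simpa using hk))]
  simp only [czPiece]
  rw [Finset.sum_range_sub (fun k => goodPart μ 𝒟 g (2 ^ k) x), h.goodPart_eq (hN N le_rfl),
    pow_zero]
  ring

theorem overAvg_eq_empty {M : ℝ} (hμ : ∀ x, μ {x} ≠ 0) (hM : ∀ x, ‖g x‖ ≤ M) (hMt : M ≤ t) :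
    overAvg μ 𝒟 g t = ∅ := by
  refine eq_empty_of_forall_notMem ?_
  rintro x ⟨D, -, hx, hlt⟩
  have hp := measureReal_pos_of_mem hμ hx
  have hg : Integrable g μ :=
    Integrable.of_bound Measurable.of_discrete.aestronglyMeasurable M (.of_forall hM)
  have h1 : ∫ y in D, ‖g y‖ ∂μ ≤ μ.real D * M := by
    rw [← smul_eq_mul, ← setIntegral_const]
    exact setIntegral_mono hg.norm.integrableOn (integrable_const M).integrableOn hM
  rw [setAverage_eq, smul_eq_mul, lt_inv_mul_iff₀ hp] at hlt
  nlinarith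

/-- The weak type inequality for the dyadic maximal function. -/
theorem IsRegularDyadic.measure_overAvg_le (h : IsRegularDyadic μ 𝒟 K) (hg : Integrable g μ)
    (ht : 0 < t) : μ (overAvg μ 𝒟 g t) ≤
      ENNReal.ofReal (2 / t) * ∫⁻ x, {x | t < 2 * ‖g x‖}.indicator (fun x => ‖g x‖ₑ) x ∂μ := by
  set Ω := overAvg μ 𝒟 g t
  -- The part of `|g|` above `t / 2`. The rest has averages at most `t / 2`, so on a stopping cell
  -- with average above `t` the average of `u` exceeds `t / 2`.
  set u : X → ℝ := {x | t < 2 * ‖g x‖}.indicator fun x => ‖g x‖ with hu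
  have hui : Integrable u μ := hg.norm.indicator .of_discrete
  have hu0 : ∀ x, 0 ≤ u x := fun x => indicator_nonneg (fun _ _ => norm_nonneg _) x
  have hgu : ∀ x, ‖g x‖ ≤ t / 2 + u x := by
    intro x
    by_cases hx : x ∈ {x | t < 2 * ‖g x‖}
    · rw [hu, indicator_of_mem hx]
      linarith
    · rw [hu, indicator_of_notMem hx]
      have : ¬ t < 2 * ‖g x‖ := hx
      linarith
  have hQ := h.isCellMap_stopCell g t
  have hsat : ∀ x ∈ Ω, stopCell μ 𝒟 g t x ⊆ Ω := fun x hx => h.stopCell_subset_overAvg hx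
  have hμ := h.measure_singleton_ne_zero
  have hreal : μ.real Ω ≤ 2 / t * ∫ x, u x ∂μ := by
    calc μ.real Ω = ∫ x in Ω, (1 : ℝ) ∂μ := by simp
      _ ≤ ∫ x in Ω, 2 / t * ⨍ y in stopCell μ 𝒟 g t x, u y ∂μ ∂μ := by
          refine setIntegral_mono_on (integrable_const _).integrableOn
            ((integrableOn_average_cell hμ hQ hsat hui).const_mul _) .of_discrete fun x hx => ?_
          have hlt := h.lt_setAverage_stopCell hx
          have hp := measureReal_pos_of_mem (μ := μ) hμ (hQ.mem x)
          have hle : ⨍ y in stopCell μ 𝒟 g t x, ‖g y‖ ∂μ ≤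
              t / 2 + ⨍ y in stopCell μ 𝒟 g t x, u y ∂μ := by
            rw [setAverage_eq, setAverage_eq, smul_eq_mul, smul_eq_mul, inv_mul_le_iff₀ hp,
              mul_add, mul_inv_cancel_left₀ hp.ne', ← smul_eq_mul, ← setIntegral_const,
              ← integral_add (integrable_const _).integrableOn hui.integrableOn]
            exact setIntegral_mono hg.norm.integrableOn
              ((integrable_const _).add hui).integrableOn hgu
          rw [div_mul_eq_mul_div, le_div_iff₀ ht]
          linarith
      _ = 2 / t * ∫ x in Ω, u x ∂μ := by
          rw [integral_const_mul, setIntegral_average_cell hμ hQ hsat hui]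
      _ ≤ 2 / t * ∫ x, u x ∂μ := by
          exact mul_le_mul_of_nonneg_left (setIntegral_le_integral hui (.of_forall hu0))
            (by positivity)
  have h1 := ENNReal.ofReal_le_ofReal hreal
  rw [measureReal_def, ENNReal.ofReal_toReal (measure_ne_top _ _),
    ENNReal.ofReal_mul (by positivity),
    ofReal_integral_eq_lintegral_ofReal hui (.of_forall hu0)] at h1
  refine h1.trans (le_of_eq ?_)
  congr 2
  ext x
  by_cases hx : x ∈ {x | t < 2 * ‖g x‖}
  · rw [hu, indicator_of_mem hx, indicator_of_mem hx, ofReal_norm]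
  · rw [hu, indicator_of_notMem hx, indicator_of_notMem hx, ENNReal.ofReal_zero]

/-- Sum the weak type inequality over `k` and exchange sum and integral. At `x` there remains the
sum of `2^{k(r-1)}` over `2 ^ k < 2 |g x|`, a geometric sum comparable to at most `(2 |g x|)^{r-1}`
because `r > 1`. -/
theorem IsRegularDyadic.exists_tsum_measure_overAvg_le (h : IsRegularDyadic μ 𝒟 K) {r : ℝ}
    (hr : 1 < r) : ∃ C : ℝ≥0, ∀ g : X → ℂ, Integrable g μ →
      ∑' k : ℕ, ENNReal.ofReal ((2 : ℝ) ^ ((k : ℝ) * r)) * μ (overAvg μ 𝒟 g (2 ^ k)) ≤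
        C * ∫⁻ x, ‖g x‖ₑ ^ r ∂μ := by
  have hr1 : 0 < r - 1 := by linarith
  obtain ⟨C, hC⟩ := exists_tsum_two_rpow_le hr1
  refine ⟨C * (2 : ℝ≥0) ^ r, fun g hg => ?_⟩
  have hterm : ∀ k : ℕ, ENNReal.ofReal ((2 : ℝ) ^ ((k : ℝ) * r)) * μ (overAvg μ 𝒟 g (2 ^ k)) ≤
      ∫⁻ x, 2 * ‖g x‖ₑ * {k : ℕ | (2 : ℝ) ^ k < 2 * ‖g x‖}.indicator
        (fun k : ℕ => ENNReal.ofReal ((2 : ℝ) ^ ((k : ℝ) * (r - 1)))) k ∂μ := by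
    intro k
    refine (mul_le_mul_right (h.measure_overAvg_le hg (by positivity)) _).trans ?_
    rw [← mul_assoc, ← ENNReal.ofReal_mul (by positivity), ← lintegral_const_mul _ .of_discrete]
    refine lintegral_mono fun x => ?_
    have h1 : (2 : ℝ) ^ ((k : ℝ) * r) * (2 / 2 ^ k) = 2 * 2 ^ ((k : ℝ) * (r - 1)) := by
      rw [mul_sub, Real.rpow_sub two_pos, mul_one, Real.rpow_natCast]
      ring
    by_cases hx : (2 : ℝ) ^ k < 2 * ‖g x‖
    · rw [indicator_of_mem (show x ∈ {x | (2 : ℝ) ^ k < 2 * ‖g x‖} from hx),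
        indicator_of_mem (show k ∈ {k : ℕ | (2 : ℝ) ^ k < 2 * ‖g x‖} from hx), h1,
        ENNReal.ofReal_mul two_pos.le, ENNReal.ofReal_ofNat]
      exact le_of_eq (by ring)
    · rw [indicator_of_notMem (show x ∉ {x | (2 : ℝ) ^ k < 2 * ‖g x‖} from hx), mul_zero]
      exact bot_le
  refine (ENNReal.tsum_le_tsum hterm).trans ?_
  rw [← lintegral_tsum fun k => Measurable.aemeasurable .of_discrete,
    ← lintegral_const_mul _ .of_discrete]
  refine lintegral_mono fun x => ?_
  rw [ENNReal.tsum_mul_left]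
  have h2 : (2 : ℝ≥0∞) * ‖g x‖ₑ = ENNReal.ofReal (2 * ‖g x‖) := by
    rw [ENNReal.ofReal_mul two_pos.le, ofReal_norm, ENNReal.ofReal_ofNat]
  calc 2 * ‖g x‖ₑ * _ ≤ 2 * ‖g x‖ₑ * (C * (2 * ‖g x‖ₑ) ^ (r - 1)) := by
        refine mul_le_mul_right (hC _ _ fun k hk => ?_) _
        rw [Real.rpow_mul two_pos.le, Real.rpow_natCast, ← ENNReal.ofReal_rpow_of_pos (by positivity), h2]
        gcongr
        exact (show (2 : ℝ) ^ k < 2 * ‖g x‖ from hk).le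
    _ = C * (2 * ‖g x‖ₑ) ^ r := by
        rw [mul_left_comm]
        congr 1
        nth_rewrite 1 [← ENNReal.rpow_one (2 * ‖g x‖ₑ)]
        rw [← ENNReal.rpow_add_of_nonneg _ _ zero_le_one hr1.le]
        congr 1
        ring
    _ = _ := by
        rw [ENNReal.mul_rpow_of_nonneg _ _ (by linarith), ENNReal.coe_mul, mul_assoc,
          ENNReal.coe_rpow_of_nonneg _ (by linarith)]
        rfl

end CalderonZygmund

/-! ### The analytic family built from the decompositions, and its boundary estimates. -/

section AnalyticFamily

variable {X : Type*} [MeasurableSpace X] [DiscreteMeasurableSpace X] [Countable X] {μ : Measure X}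
  [IsFiniteMeasure μ] {𝒟 : Set (Set X)} {K : ℝ} {g : X → ℂ} {s : ℂ} {r : ℝ}

/-- The coefficient `2 ^ (k (s - 1))`. -/
noncomputable def levelCoeff (k : ℕ) (s : ℂ) : ℂ := (2 : ℂ) ^ ((k : ℂ) * (s - 1))

/-- The analytic family through `g` obtained from the Calderón–Zygmund decompositions of `g` at the
heights `2 ^ k`. -/
noncomputable def czFamily (μ : Measure X) (𝒟 : Set (Set X)) (g : X → ℂ) (s : ℂ) (x : X) : ℂ :=
  goodPart μ 𝒟 g 1 x + ∑' k, levelCoeff k s * czPiece μ 𝒟 g k x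

theorem norm_levelCoeff (k : ℕ) (s : ℂ) : ‖levelCoeff k s‖ = (2 : ℝ) ^ ((k : ℝ) * (s.re - 1)) := by
  have h := Complex.norm_cpow_eq_rpow_re_of_pos (two_pos (α := ℝ)) ((k : ℂ) * (s - 1))
  rw [Complex.ofReal_ofNat] at h
  rw [levelCoeff, h]
  simp

/-- The piece at level `k` has size about `2 ^ k`, so after weighting its size is governed by `2^{k
Re s}`. -/
theorem norm_levelCoeff_mul (k : ℕ) (s : ℂ) :
    ‖levelCoeff k s‖ * 2 ^ k = (2 : ℝ) ^ ((k : ℝ) * s.re) := by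
  rw [norm_levelCoeff, ← Real.rpow_natCast, ← Real.rpow_add two_pos]
  congr 1
  ring

theorem levelCoeff_one (k : ℕ) : levelCoeff k 1 = 1 := by
  simp [levelCoeff]

theorem differentiable_levelCoeff (k : ℕ) : Differentiable ℂ (levelCoeff k) := by
  unfold levelCoeff
  fun_prop (disch := simp)

/-- The weighted measures of the level sets of the dyadic maximal function. -/
noncomputable def levelMass (μ : Measure X) (𝒟 : Set (Set X)) (g : X → ℂ) (r : ℝ) (k : ℕ) : ℝ≥0∞ :=
  ENNReal.ofReal ((2 : ℝ) ^ ((k : ℝ) * r)) * μ (overAvg μ 𝒟 g (2 ^ k))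

theorem IsRegularDyadic.ofReal_norm_levelCoeff_mul_le (h : IsRegularDyadic μ 𝒟 K) (hs : s.re ≤ r)
    (k : ℕ) : ‖levelCoeff k s‖ₑ * (ENNReal.ofReal (3 * K * 2 ^ k) * μ (overAvg μ 𝒟 g (2 ^ k))) ≤
      ENNReal.ofReal (3 * K) * levelMass μ 𝒟 g r k := by
  have hK := h.one_le_const
  rw [levelMass, ← mul_assoc, ← mul_assoc, ← ofReal_norm, ← ENNReal.ofReal_mul (by positivity),
    ← ENNReal.ofReal_mul (by positivity), mul_left_comm, norm_levelCoeff_mul]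
  gcongr
  exact one_le_two

theorem IsRegularDyadic.norm_goodPart_one_le (h : IsRegularDyadic μ 𝒟 K) (hg : Integrable g μ)
    (hg1 : ⨍ y, ‖g y‖ ∂μ ≤ 1) (x : X) : ‖goodPart μ 𝒟 g 1 x‖ ≤ K := by
  simpa using h.norm_goodPart_le hg zero_le_one hg1 x

theorem IsRegularDyadic.czFamily_one (h : IsRegularDyadic μ 𝒟 K) (hg : Integrable g μ) :
    czFamily μ 𝒟 g 1 = g := by
  ext x
  simp only [czFamily, levelCoeff_one, one_mul]
  exact h.tsum_czPiece hg x

theorem IsRegularDyadic.h1Fun_levelCoeff_mul_le (h : IsRegularDyadic μ 𝒟 K) (hg : Integrable g μ)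
    (hg1 : ⨍ y, ‖g y‖ ∂μ ≤ 1) (hs : s.re ≤ r) (k : ℕ) :
    h1Fun μ 𝒟 (levelCoeff k s • czPiece μ 𝒟 g k) ≤
      ENNReal.ofReal (3 * K) * levelMass μ 𝒟 g r k :=
  ((h1Norm μ 𝒟).smul_le' _ _).trans ((mul_le_mul_right
    ((h.isMolecule_czPiece hg hg1 k).h1Fun_le h.measure_singleton_ne_zero) _).trans
      (h.ofReal_norm_levelCoeff_mul_le hs k))

/-- The bound is uniform in `s` with `Re s ≤ r`. It serves both for approximation by finite sums
and, with `S = ∅`, for the norm of the family. -/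
theorem IsRegularDyadic.h1Fun_czFamily_sub_le (h : IsRegularDyadic μ 𝒟 K) (hg : Integrable g μ)
    (hg1 : ⨍ y, ‖g y‖ ∂μ ≤ 1) (hs : s.re ≤ r) (S : Finset ℕ) :
    h1Fun μ 𝒟 (czFamily μ 𝒟 g s -
        (goodPart μ 𝒟 g 1 + ∑ k ∈ S, levelCoeff k s • czPiece μ 𝒟 g k)) ≤
      ENNReal.ofReal (3 * K) * ∑' k : {k // k ∉ S}, levelMass μ 𝒟 g r k := by
  rw [← ENNReal.tsum_mul_left]
  refine (h1Fun_le_tsum h.measure_singleton_ne_zero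
    (f := fun k : {k // k ∉ S} => levelCoeff k s • czPiece μ 𝒟 g k) fun x => ?_).trans
      (ENNReal.tsum_le_tsum fun k => h.h1Fun_levelCoeff_mul_le hg hg1 hs k)
  have h1 := h.hasSum_mul_czPiece hg (fun k => levelCoeff k s) x
  refine (Finset.hasSum_compl_iff S (f := fun k => levelCoeff k s * czPiece μ 𝒟 g k x)).2 ?_
  convert! h1 using 1
  simp [czFamily]

theorem IsRegularDyadic.h1Fun_czFamily_le [Nonempty X] (h : IsRegularDyadic μ 𝒟 K)
    (hg : Integrable g μ) (hg1 : ⨍ y, ‖g y‖ ∂μ ≤ 1) (hs : s.re ≤ r) :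
    h1Fun μ 𝒟 (czFamily μ 𝒟 g s) ≤
      ENNReal.ofReal (3 * K) * (μ univ + ∑' k, levelMass μ 𝒟 g r k) := by
  have h1 : czFamily μ 𝒟 g s = goodPart μ 𝒟 g 1 + (czFamily μ 𝒟 g s - goodPart μ 𝒟 g 1) := by
    abel
  have h2 := h.h1Fun_czFamily_sub_le hg hg1 hs ∅
  simp only [Finset.sum_empty, add_zero] at h2
  rw [h1, mul_add]
  refine ((h1Norm μ 𝒟).add_le' _ _).trans (add_le_add
    (h1Fun_le_of_bounded h.measure_singleton_ne_zero h.univ_mem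
      (h.norm_goodPart_one_le hg hg1)) (h2.trans ?_))
  gcongr
  exact ENNReal.tsum_comp_le_tsum_of_injective Subtype.val_injective _

theorem IsRegularDyadic.enorm_czFamily_le (h : IsRegularDyadic μ 𝒟 K) (hg : Integrable g μ)
    (hg1 : ⨍ y, ‖g y‖ ∂μ ≤ 1) (x : X) : ‖czFamily μ 𝒟 g s x‖ₑ ≤ ENNReal.ofReal (3 * K) *
      (1 + ∑' k, {k : ℕ | x ∈ overAvg μ 𝒟 g (2 ^ k)}.indicator
        (fun k : ℕ => ENNReal.ofReal ((2 : ℝ) ^ ((k : ℝ) * s.re))) k) := by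
  have hK := h.one_le_const
  rw [mul_add, mul_one, ← ENNReal.tsum_mul_left]
  refine (enorm_add_le _ _).trans (add_le_add ?_ (enorm_tsum_le_tsum_enorm.trans
    (ENNReal.tsum_le_tsum fun k => ?_)))
  · rw [← ofReal_norm]
    refine ENNReal.ofReal_le_ofReal ((h.norm_goodPart_one_le hg hg1 x).trans ?_)
    linarith
  · by_cases hx : x ∈ overAvg μ 𝒟 g (2 ^ k)
    · rw [indicator_of_mem (show k ∈ {k : ℕ | x ∈ overAvg μ 𝒟 g (2 ^ k)} from hx), ← ofReal_norm,
        ← ENNReal.ofReal_mul (by positivity), ← norm_levelCoeff_mul, norm_mul]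
      refine ENNReal.ofReal_le_ofReal ?_
      have h1 := (h.isMolecule_czPiece hg hg1 k).norm_le x
      calc ‖levelCoeff k s‖ * ‖czPiece μ 𝒟 g k x‖ ≤ ‖levelCoeff k s‖ * (3 * K * 2 ^ k) := by gcongr
        _ = _ := by ring
    · rw [h.czPiece_eq_zero hx, mul_zero, enorm_zero]
      exact bot_le

/-- At `x` the family is controlled by one plus the sum of `2^{k r / r₁}` over the levels with `x ∈
Ω_k`. That geometric sum is comparable to its largest term, so its `r₁`-th power is controlled by
the sum of `2^{k r}`, which integrates to the total level mass. -/
theorem IsRegularDyadic.exists_lintegral_czFamily_le (h : IsRegularDyadic μ 𝒟 K) {r₁ : ℝ}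
    (hr : 0 < r) (hr₁ : 1 ≤ r₁) : ∃ C : ℝ≥0, ∀ (g : X → ℂ) (s : ℂ), Integrable g μ →
      ⨍ y, ‖g y‖ ∂μ ≤ 1 → s.re = r / r₁ →
      ∫⁻ x, ‖czFamily μ 𝒟 g s x‖ₑ ^ r₁ ∂μ ≤ C * (μ univ + ∑' k, levelMass μ 𝒟 g r k) := by
  have hr₁0 : 0 < r₁ := by linarith
  obtain ⟨C, hC⟩ := exists_tsum_two_rpow_le (div_pos hr hr₁0)
  let M : ℝ≥0 := Real.toNNReal (3 * K) ^ r₁ * (2 : ℝ≥0) ^ (r₁ - 1) * (1 + C ^ r₁)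
  refine ⟨M, fun g s hg hg1 hs => ?_⟩
  let B : X → ℝ≥0∞ := fun x => ∑' k, {k : ℕ | x ∈ overAvg μ 𝒟 g (2 ^ k)}.indicator
    (fun k : ℕ => ENNReal.ofReal ((2 : ℝ) ^ ((k : ℝ) * r))) k
  have hB : ∫⁻ x, B x ∂μ = ∑' k, levelMass μ 𝒟 g r k := by
    simp only [B]
    rw [lintegral_tsum fun k => Measurable.aemeasurable .of_discrete]
    refine tsum_congr fun k => ?_
    rw [levelMass, ← setLIntegral_const, ← lintegral_indicator .of_discrete]
    rfl
  have hpt : ∀ x, ‖czFamily μ 𝒟 g s x‖ₑ ^ r₁ ≤ M * (1 + B x) := by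
    intro x
    have h1 := hC {k : ℕ | x ∈ overAvg μ 𝒟 g (2 ^ k)} (B x ^ r₁⁻¹) fun k hk => by
      rw [ENNReal.le_rpow_inv_iff hr₁0, ENNReal.ofReal_rpow_of_pos (by positivity),
        ← Real.rpow_mul two_pos.le, mul_assoc, div_mul_cancel₀ _ hr₁0.ne']
      refine le_trans (le_of_eq ?_) (ENNReal.le_tsum k)
      rw [indicator_of_mem hk]
    have h2 := h.enorm_czFamily_le (s := s) hg hg1 x
    rw [hs] at h2
    calc ‖czFamily μ 𝒟 g s x‖ₑ ^ r₁
        ≤ (ENNReal.ofReal (3 * K) * (1 + C * B x ^ r₁⁻¹)) ^ r₁ := by gcongr; exact h2.trans (by gcongr)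
      _ ≤ ENNReal.ofReal (3 * K) ^ r₁ * (2 ^ (r₁ - 1) * (1 + C ^ r₁ * B x)) := by
          rw [ENNReal.mul_rpow_of_nonneg _ _ hr₁0.le]
          gcongr
          refine (ENNReal.rpow_add_le_mul_rpow_add_rpow _ _ hr₁).trans ?_
          rw [ENNReal.one_rpow, ENNReal.mul_rpow_of_nonneg _ _ hr₁0.le, ← ENNReal.rpow_mul,
            inv_mul_cancel₀ hr₁0.ne', ENNReal.rpow_one]
      _ ≤ ENNReal.ofReal (3 * K) ^ r₁ * (2 ^ (r₁ - 1) * ((1 + C ^ r₁) * (1 + B x))) := by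
          gcongr
          rw [add_mul, one_mul]
          gcongr
          · exact le_self_add
          · exact le_add_self
      _ = M * (1 + B x) := by
          simp only [M, ENNReal.coe_mul, ENNReal.coe_add, ENNReal.coe_one]
          rw [ENNReal.coe_rpow_of_nonneg _ hr₁0.le, ENNReal.coe_rpow_of_nonneg _ hr₁0.le,
            ENNReal.coe_rpow_of_nonneg _ (by linarith)]
          rw [← mul_assoc, ← mul_assoc]
          rfl
  calc ∫⁻ x, ‖czFamily μ 𝒟 g s x‖ₑ ^ r₁ ∂μ ≤ ∫⁻ x, M * (1 + B x) ∂μ := lintegral_mono hpt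
    _ = _ := by
        rw [lintegral_const_mul _ .of_discrete, lintegral_add_left .of_discrete, hB,
          lintegral_const, one_mul]

/-- The bounded part is paired using BMO `⊆ L¹`, the pieces using cancellation. -/
theorem IsRegularDyadic.enorm_integral_mul_czFamily_le (h : IsRegularDyadic μ 𝒟 K)
    (hg : Integrable g μ) (hg1 : ⨍ y, ‖g y‖ ∂μ ≤ 1) (hs : s.re ≤ r) (S : Finset ℕ) {b : X → ℂ}
    (hb : Integrable b μ) :
    ‖∫ x, b x * goodPart μ 𝒟 g 1 x ∂μ +
        ∑ k ∈ S, levelCoeff k s * ∫ x, b x * czPiece μ 𝒟 g k x ∂μ‖ₑ ≤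
      ENNReal.ofReal (3 * K) * (μ univ + 1 + ∑' k, levelMass μ 𝒟 g r k) * bmoFun μ 𝒟 b := by
  have hK := h.one_le_const
  have hu : μ univ ≠ 0 := by
    intro h0
    have := h.one_le_measure_univ
    simp [measureReal_def, h0] at this
    linarith
  rw [mul_add, add_mul]
  refine (enorm_add_le _ _).trans (add_le_add ?_ ((enorm_sum_le _ _).trans ?_))
  · refine (enorm_integral_le_lintegral_enorm _).trans ?_
    calc ∫⁻ x, ‖b x * goodPart μ 𝒟 g 1 x‖ₑ ∂μ ≤ ∫⁻ x, ENNReal.ofReal (3 * K) * ‖b x‖ₑ ∂μ := by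
          refine lintegral_mono fun x => ?_
          rw [enorm_mul, mul_comm, ← ofReal_norm (goodPart μ 𝒟 g 1 x)]
          gcongr
          linarith [h.norm_goodPart_one_le hg hg1 x]
      _ ≤ _ := by
          rw [lintegral_const_mul _ .of_discrete, mul_assoc]
          gcongr
          exact lintegral_enorm_le_bmoFun h.univ_mem hu b
  · rw [mul_right_comm, ← ENNReal.tsum_mul_left]
    refine (Finset.sum_le_sum fun k _ => ?_).trans (ENNReal.sum_le_tsum S)
    have h1 := (h.isMolecule_czPiece hg hg1 k).enorm_integral_mul_le h.measure_singleton_ne_zero hb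
    rw [enorm_mul]
    calc ‖levelCoeff k s‖ₑ * _ ≤ ‖levelCoeff k s‖ₑ *
          (ENNReal.ofReal (3 * K * 2 ^ k) * bmoFun μ 𝒟 b * μ (overAvg μ 𝒟 g (2 ^ k))) := by gcongr
      _ = ‖levelCoeff k s‖ₑ * (ENNReal.ofReal (3 * K * 2 ^ k) * μ (overAvg μ 𝒟 g (2 ^ k))) *
          bmoFun μ 𝒟 b := by ring
      _ ≤ ENNReal.ofReal (3 * K) * levelMass μ 𝒟 g r k * bmoFun μ 𝒟 b := by
          exact mul_le_mul_left (h.ofReal_norm_levelCoeff_mul_le hs k) _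
      _ = _ := by ring

/-- By Hölder and `μ(X) ≥ 1`, `‖g‖₁ ≤ μ(X)^{1 - 1/r} ≤ μ(X)`. This makes height `1` a legitimate
first height for every normalised `g`. -/
theorem IsRegularDyadic.average_norm_le_one (h : IsRegularDyadic μ 𝒟 K) (hr : 1 ≤ r)
    (hg : eLpNorm g (ENNReal.ofReal r) μ ≤ 1) : Integrable g μ ∧ ⨍ y, ‖g y‖ ∂μ ≤ 1 := by
  have hm : AEStronglyMeasurable g μ := Measurable.of_discrete.aestronglyMeasurable
  have hu1 : 1 ≤ μ univ := by
    have := ENNReal.ofReal_le_ofReal h.one_le_measure_univ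
    rwa [ENNReal.ofReal_one, measureReal_def, ENNReal.ofReal_toReal (measure_ne_top _ _)] at this
  have h1 : eLpNorm g 1 μ ≤ μ univ := by
    refine (eLpNorm_le_eLpNorm_mul_rpow_measure_univ (ENNReal.one_le_ofReal.2 hr) hm).trans ?_
    refine (mul_le_mul_left hg _).trans ?_
    rw [one_mul]
    conv_rhs => rw [← ENNReal.rpow_one (μ univ)]
    refine ENNReal.rpow_le_rpow_of_exponent_le hu1 ?_
    rw [ENNReal.toReal_ofReal (by linarith), ENNReal.toReal_one]
    have : 0 ≤ 1 / r := by positivity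
    linarith
  have hi : Integrable g μ := memLp_one_iff_integrable.1
    ⟨hm, h1.trans_lt (measure_lt_top _ _)⟩
  refine ⟨hi, ?_⟩
  rw [average_eq, smul_eq_mul, inv_mul_le_iff₀ (by linarith [h.one_le_measure_univ]), mul_one,
    integral_norm_eq_lintegral_enorm hm, measureReal_def]
  rw [eLpNorm_one_eq_lintegral_enorm] at h1
  exact ENNReal.toReal_mono (measure_ne_top _ _) h1

end AnalyticFamily

/-! ### Complex interpolation for general extended seminorms. -/

open Complex.HadamardThreeLines

section Interpolation

variable {V : Type*} [AddCommGroup V] [Module ℂ V] {A₀ A₁ : ExtNorm V}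

theorem ExtNorm.sum_le_left (A₀ A₁ : ExtNorm V) (f : V) : A₀.sum A₁ f ≤ A₀ f :=
  (iInf_le _ f).trans (by rw [sub_self, A₁.map_zero', add_zero])

theorem ExtNorm.sum_le_right (A₀ A₁ : ExtNorm V) (f : V) : A₀.sum A₁ f ≤ A₁ f :=
  (iInf_le _ 0).trans (by rw [sub_zero, A₀.map_zero', zero_add])

theorem closure_verticalStrip : closure (verticalStrip 0 1) = verticalClosedStrip 0 1 := by
  rw [verticalStrip, verticalClosedStrip, Complex.closure_preimage_re, closure_Ioo zero_ne_one]

theorem verticalStrip_subset : verticalStrip 0 1 ⊆ verticalClosedStrip 0 1 :=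
  preimage_mono Ioo_subset_Icc_self

theorem mem_verticalClosedStrip_left (t : ℝ) : Complex.I * t ∈ verticalClosedStrip 0 1 := by
  simp [verticalClosedStrip]

theorem mem_verticalClosedStrip_right (t : ℝ) : 1 + Complex.I * t ∈ verticalClosedStrip 0 1 := by
  simp [verticalClosedStrip]

/-- A function which on the strip is uniformly approximated by finite sums of scalar analytic
functions times fixed vectors belongs to the class of admissible functions. -/
theorem exists_isAdmissible {ι : Type*} {g : ℂ → V} {b₀ : V} {b : ι → V} {c : ι → ℂ → ℂ}
    (hb₀ : A₀.sum A₁ b₀ < ∞) (hb : ∀ i, A₀.sum A₁ (b i) < ∞)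
    (hc : ∀ i, Differentiable ℂ (c i))
    (hcb : ∀ i, ∃ C : ℝ, ∀ z ∈ verticalClosedStrip 0 1, ‖c i z‖ ≤ C)
    (happrox : ∀ ε : ℝ≥0, 0 < ε → ∃ S : Finset ι, ∀ z ∈ verticalClosedStrip 0 1,
      A₀.sum A₁ (g z - (b₀ + ∑ i ∈ S, c i z • b i)) ≤ ε)
    {M : ℝ≥0} (h₀ : ∀ t : ℝ, A₀ (g (Complex.I * t)) ≤ M)
    (h₁ : ∀ t : ℝ, A₁ (g (1 + Complex.I * t)) ≤ M) :
    ∃ F, IsAdmissible A₀ A₁ F ∧ (∀ z ∈ verticalClosedStrip 0 1, (F z : V) = g z) ∧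
      stripNorm A₀ A₁ F ≤ M := by
  classical
  let N := A₀.sum A₁
  have hsum : ∀ (S : Finset ι) (z : ℂ), b₀ + ∑ i ∈ S, c i z • b i ∈ N.space := fun S z =>
    N.space.add_mem hb₀ (N.space.sum_mem fun i _ => N.space.smul_mem _ (hb i))
  have hmem : ∀ z ∈ verticalClosedStrip 0 1, g z ∈ N.space := by
    intro z hz
    obtain ⟨S, hS⟩ := happrox 1 one_pos
    have h1 : g z - (b₀ + ∑ i ∈ S, c i z • b i) ∈ N.space :=
      (hS z hz).trans_lt ENNReal.coe_lt_top
    simpa using N.space.add_mem h1 (hsum S z)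
  -- Off the strip `g z` may leave the sum space; the value `0` there is a harmless default.
  let F : ℂ → N.space := fun z => if h : g z ∈ N.space then ⟨g z, h⟩ else 0
  have hF : ∀ z ∈ verticalClosedStrip 0 1, (F z : V) = g z := by
    intro z hz
    simp only [F, dif_pos (hmem z hz)]
  have hnorm : stripNorm A₀ A₁ F ≤ M := by
    refine iSup_le fun t => max_le ?_ ?_
    · rw [hF _ (mem_verticalClosedStrip_left t)]
      exact h₀ t
    · rw [hF _ (mem_verticalClosedStrip_right t)]
      exact h₁ t
  -- A bounded functional turns approximation in the sum norm into uniform scalar approximation by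
  -- entire functions bounded on the strip. Continuity, boundedness and analyticity all pass to the
  -- limit.
  have hunif : ∀ l : N.space →ₗ[ℂ] ℂ, IsBoundedFunctional N l → ∀ ε : ℝ, 0 < ε →
      ∃ u : ℂ → ℂ, Differentiable ℂ u ∧
        (∃ C, ∀ z ∈ verticalClosedStrip 0 1, ‖u z‖ ≤ C) ∧
        ∀ z ∈ verticalClosedStrip 0 1, ‖l (F z) - u z‖ < ε := by
    rintro l ⟨C, hC⟩ ε hε
    obtain ⟨S, hS⟩ := happrox (Real.toNNReal ε / (2 * (C + 1)))
      (div_pos (Real.toNNReal_pos.2 hε) (by positivity))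
    refine ⟨fun z => l ⟨b₀, hb₀⟩ + ∑ i ∈ S, c i z * l ⟨b i, hb i⟩, ?_, ?_, fun z hz => ?_⟩
    · exact (differentiable_const _).add
        (Differentiable.fun_sum fun i _ => (hc i).mul_const _)
    · choose Cc hCc using hcb
      refine ⟨‖l ⟨b₀, hb₀⟩‖ + ∑ i ∈ S, Cc i * ‖l ⟨b i, hb i⟩‖, fun z hz => ?_⟩
      refine (norm_add_le _ _).trans (add_le_add le_rfl ((norm_sum_le _ _).trans
        (Finset.sum_le_sum fun i _ => ?_)))
      rw [norm_mul]
      exact mul_le_mul_of_nonneg_right (hCc i z hz) (norm_nonneg _)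
    · let w : N.space := F z - (⟨b₀, hb₀⟩ + ∑ i ∈ S, c i z • ⟨b i, hb i⟩)
      have hw : (w : V) = g z - (b₀ + ∑ i ∈ S, c i z • b i) := by
        simp [w, hF z hz]
      have hlw : l (F z) - (l ⟨b₀, hb₀⟩ + ∑ i ∈ S, c i z * l ⟨b i, hb i⟩) = l w := by
        simp [w, map_sub, map_add, map_sum]
      have h1 := hC w
      rw [hw] at h1
      have h2 := h1.trans (mul_le_mul_right (hS z hz) _)
      rw [← ENNReal.coe_mul] at h2
      rw [hlw]
      have h3 : ‖l w‖ ≤ C * (Real.toNNReal ε / (2 * (C + 1)) : ℝ≥0) := by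
        have h4 : ‖l w‖₊ ≤ C * (Real.toNNReal ε / (2 * (C + 1))) := ENNReal.coe_le_coe.1 h2
        exact_mod_cast h4
      refine h3.trans_lt ?_
      push_cast
      rw [Real.coe_toNNReal _ hε.le, ← mul_div_assoc, div_lt_iff₀ (by positivity)]
      have hC0 : (0 : ℝ) ≤ C := C.coe_nonneg
      nlinarith
  have hseq : ∀ l : N.space →ₗ[ℂ] ℂ, IsBoundedFunctional N l →
      ∃ u : ℕ → ℂ → ℂ, (∀ n, Differentiable ℂ (u n)) ∧
        TendstoUniformlyOn u (fun z => l (F z)) Filter.atTop (verticalClosedStrip 0 1) := by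
    intro l hl
    choose u hu _ hdist using fun n : ℕ => hunif l hl (1 / ((n : ℝ) + 1)) (by positivity)
    refine ⟨u, hu, Metric.tendstoUniformlyOn_iff.2 fun ε hε => ?_⟩
    obtain ⟨n₀, hn₀⟩ := exists_nat_one_div_lt hε
    filter_upwards [Filter.eventually_ge_atTop n₀] with n hn z hz
    rw [dist_eq_norm]
    refine (hdist n z hz).trans_le (le_trans ?_ hn₀.le)
    have : (n₀ : ℝ) ≤ n := by exact_mod_cast hn
    gcongr
  refine ⟨F, ⟨fun l hl => ?_, fun l hl => ?_, fun l hl => ?_, hnorm.trans_lt ENNReal.coe_lt_top⟩,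
    hF, hnorm⟩
  · obtain ⟨u, hu, hlim⟩ := hseq l hl
    exact hlim.continuousOn (.of_forall fun n => (hu n).continuous.continuousOn)
  · obtain ⟨u, -, ⟨C, hC⟩, hdist⟩ := hunif l hl 1 one_pos
    refine ⟨1 + C, fun z hz => ?_⟩
    have h1 := norm_add_le (l (F z) - u z) (u z)
    rw [sub_add_cancel] at h1
    exact h1.trans (add_le_add (hdist z hz).le (hC z hz))
  · obtain ⟨u, hu, hlim⟩ := hseq l hl
    exact (hlim.mono verticalStrip_subset).tendstoLocallyUniformlyOn.differentiableOn
      (.of_forall fun n => (hu n).differentiableOn)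
      (Complex.continuous_re.isOpen_preimage _ isOpen_Ioo)

/-- The three lines theorem for a finite sum of scalar analytic functions times bounded functionals
of an admissible function. -/
theorem IsAdmissible.norm_le {F : ℂ → (A₀.sum A₁).space} (hF : IsAdmissible A₀ A₁ F) {ι : Type*}
    (S : Finset ι) {l₀ : (A₀.sum A₁).space →ₗ[ℂ] ℂ} {l : ι → (A₀.sum A₁).space →ₗ[ℂ] ℂ}
    (hl₀ : IsBoundedFunctional (A₀.sum A₁) l₀) (hl : ∀ i, IsBoundedFunctional (A₀.sum A₁) (l i))
    {c : ι → ℂ → ℂ} (hc : ∀ i, Differentiable ℂ (c i))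
    (hcb : ∀ i, ∃ C : ℝ, ∀ z ∈ verticalClosedStrip 0 1, ‖c i z‖ ≤ C) {M : ℝ≥0}
    (h₀ : ∀ t : ℝ, ‖l₀ (F (Complex.I * t)) + ∑ i ∈ S, c i (Complex.I * t) *
      l i (F (Complex.I * t))‖ₑ ≤ M)
    (h₁ : ∀ t : ℝ, ‖l₀ (F (1 + Complex.I * t)) + ∑ i ∈ S, c i (1 + Complex.I * t) *
      l i (F (1 + Complex.I * t))‖ₑ ≤ M) {θ : ℝ} (hθ0 : 0 < θ) (hθ1 : θ < 1) :
    ‖l₀ (F θ) + ∑ i ∈ S, c i θ * l i (F θ)‖ₑ ≤ M := by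
  let φ : ℂ → ℂ := fun z => l₀ (F z) + ∑ i ∈ S, c i z * l i (F z)
  have hθ : (θ : ℂ) ∈ verticalClosedStrip 0 1 := by
    simp [verticalClosedStrip, hθ0.le, hθ1.le]
  have key : ‖φ θ‖ ≤ (M : ℝ) ^ (1 - (θ : ℂ).re) * (M : ℝ) ^ (θ : ℂ).re := by
    refine norm_le_interp_of_mem_verticalClosedStrip₀₁' φ hθ ⟨?_, ?_⟩ ?_ ?_ ?_
    · exact (hF.analyticOn l₀ hl₀).add (DifferentiableOn.fun_sum fun i _ =>
        (hc i).differentiableOn.mul (hF.analyticOn (l i) (hl i)))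
    · rw [closure_verticalStrip]
      exact (hF.continuousOn l₀ hl₀).add (continuousOn_finsetSum _ fun i _ =>
        (hc i).continuous.continuousOn.mul (hF.continuousOn (l i) (hl i)))
    · obtain ⟨C₀, hC₀⟩ := hF.bounded l₀ hl₀
      choose C hC using fun i => hF.bounded (l i) (hl i)
      choose Cc hCc using hcb
      refine ⟨C₀ + ∑ i ∈ S, Cc i * C i, ?_⟩
      rintro _ ⟨z, hz, rfl⟩
      refine (norm_add_le _ _).trans (add_le_add (hC₀ z hz) ((norm_sum_le _ _).trans
        (Finset.sum_le_sum fun i _ => ?_)))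
      rw [norm_mul]
      exact mul_le_mul (hCc i z hz) (hC i z hz) (norm_nonneg _)
        ((norm_nonneg _).trans (hCc i z hz))
    · intro z hz
      have hz' : z = Complex.I * (z.im : ℂ) := by
        rw [mul_comm]
        exact Complex.ext (by simpa using hz) (by simp)
      have := h₀ z.im
      rw [← hz'] at this
      exact enorm_le_coe.1 this
    · intro z hz
      have hz' : z = 1 + Complex.I * (z.im : ℂ) := by
        rw [mul_comm]
        exact Complex.ext (by simpa using hz) (by simp)
      have := h₁ z.im
      rw [← hz'] at this
      exact enorm_le_coe.1 this
  rw [enorm_le_coe]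
  refine NNReal.coe_le_coe.1 (key.trans (le_of_eq ?_))
  rw [Complex.ofReal_re]
  -- The product `M^{1-θ} M^θ` is `M`; for `M = 0` this uses `θ ≠ 0`.
  rcases eq_or_ne (M : ℝ) 0 with h | h
  · rw [h, Real.zero_rpow hθ0.ne', mul_zero]
  · rw [← Real.rpow_add (lt_of_le_of_ne M.coe_nonneg h.symm), sub_add_cancel, Real.rpow_one]

theorem IsAdmissible.const_smul {F : ℂ → (A₀.sum A₁).space} (hF : IsAdmissible A₀ A₁ F) (a : ℂ) :
    IsAdmissible A₀ A₁ (fun z => a • F z) ∧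
      stripNorm A₀ A₁ (fun z => a • F z) ≤ ‖a‖ₑ * stripNorm A₀ A₁ F := by
  have h : stripNorm A₀ A₁ (fun z => a • F z) ≤ ‖a‖ₑ * stripNorm A₀ A₁ F := by
    refine iSup_le fun t => max_le ?_ ?_
    · exact (A₀.smul_le' _ _).trans (mul_le_mul_right ((le_max_left _ _).trans
        (le_iSup (fun t : ℝ => max (A₀ (F (Complex.I * t) : V)) (A₁ (F (1 + Complex.I * t) : V))) t)) _)
    · exact (A₁.smul_le' _ _).trans (mul_le_mul_right ((le_max_right _ _).trans
        (le_iSup (fun t : ℝ => max (A₀ (F (Complex.I * t) : V)) (A₁ (F (1 + Complex.I * t) : V))) t)) _)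
  refine ⟨⟨fun l hl => ?_, fun l hl => ?_, fun l hl => ?_,
    h.trans_lt (ENNReal.mul_lt_top enorm_lt_top hF.stripNorm_lt_top)⟩, h⟩
  · simp only [map_smul, smul_eq_mul]
    exact (hF.continuousOn l hl).const_mul a
  · obtain ⟨C, hC⟩ := hF.bounded l hl
    refine ⟨‖a‖ * C, fun z hz => ?_⟩
    rw [map_smul, norm_smul]
    exact mul_le_mul_of_nonneg_left (hC z hz) (norm_nonneg _)
  · simp only [map_smul, smul_eq_mul]
    exact (hF.analyticOn l hl).const_mul a

theorem interpNorm_le {F : ℂ → (A₀.sum A₁).space} (hF : IsAdmissible A₀ A₁ F) {θ : ℝ} {f : V}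
    (hf : (F (θ : ℂ) : V) = f) : interpNorm A₀ A₁ θ f ≤ stripNorm A₀ A₁ F :=
  iInf_le_of_le F (iInf_le_of_le (α := ℝ≥0∞) hF (iInf_le (α := ℝ≥0∞) _ hf))

/-- A criterion for `(A₀, A₁)_{[θ]} = B`. -/
theorem interpEq_of_bounds {B : ExtNorm V} {θ : ℝ} (hB0 : ∀ f, B f = 0 → f = 0)
    {C₁ C₂ : ℝ≥0} (h₁ : ∀ f, B f ≤ 1 → ∃ F, IsAdmissible A₀ A₁ F ∧ (F (θ : ℂ) : V) = f ∧
      stripNorm A₀ A₁ F ≤ C₁)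
    (h₂ : ∀ F, IsAdmissible A₀ A₁ F → B (F (θ : ℂ) : V) ≤ C₂ * stripNorm A₀ A₁ F) :
    InterpEq A₀ A₁ θ B := by
  have h₃ : ∀ f, B f < ∞ → ∃ F, IsAdmissible A₀ A₁ F ∧ (F (θ : ℂ) : V) = f ∧
      stripNorm A₀ A₁ F ≤ C₁ * B f := by
    intro f hf
    -- Rescaling is impossible when `B f = 0`; then `f = 0`, and the zero multiple of any admissible
    -- function represents it.
    rcases eq_or_ne (B f) 0 with h0 | h0
    · obtain ⟨F, hF, hFf, -⟩ := h₁ f (h0 ▸ zero_le_one)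
      obtain ⟨hG, hGn⟩ := hF.const_smul 0
      refine ⟨_, hG, ?_, hGn.trans ?_⟩
      · simp [hB0 f h0]
      · simp
    · set a : ℝ := (B f).toReal with ha
      have hapos : 0 < a := ENNReal.toReal_pos h0 hf.ne
      have hae : ‖(a : ℂ)‖ₑ = B f := by
        rw [← ofReal_norm, Complex.norm_real, Real.norm_of_nonneg hapos.le,
          ENNReal.ofReal_toReal hf.ne]
      have haC : (a : ℂ) ≠ 0 := by exact_mod_cast hapos.ne'
      obtain ⟨F, hF, hFf, hFn⟩ := h₁ ((a : ℂ)⁻¹ • f) <| by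
        refine (B.smul_le' _ _).trans ?_
        rw [enorm_inv haC, hae, ENNReal.inv_mul_cancel h0 hf.ne]
      obtain ⟨hG, hGn⟩ := hF.const_smul (a : ℂ)
      refine ⟨_, hG, ?_, hGn.trans ?_⟩
      · rw [Submodule.coe_smul, hFf, smul_inv_smul₀ haC]
      · rw [hae, mul_comm]
        gcongr
  have h₄ : ∀ f, B f ≤ C₂ * interpNorm A₀ A₁ θ f ∨ interpNorm A₀ A₁ θ f = ∞ := by
    intro f
    by_cases hne : interpNorm A₀ A₁ θ f = ∞
    · exact Or.inr hne
    · left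
      simp only [interpNorm]
      -- A factor `0` does not pass through the infimum, which could be over an empty family;
      -- finiteness of the norm then supplies a representative.
      rcases eq_or_ne C₂ 0 with h0 | h0
      · have : ∃ F, IsAdmissible A₀ A₁ F ∧ (F (θ : ℂ) : V) = f := by
          by_contra! hno
          refine hne ?_
          simp only [interpNorm, iInf_eq_top]
          exact fun F hF hf => absurd hf (hno F hF)
        obtain ⟨F, hF, rfl⟩ := this
        have := h₂ F hF
        rw [h0] at this ⊢
        simpa using this
      · have hC : (C₂ : ℝ≥0∞) ≠ 0 := by exact_mod_cast h0
        simp only [ENNReal.mul_iInf_of_ne hC ENNReal.coe_ne_top]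
        refine le_iInf fun F => le_iInf fun hF => le_iInf fun hf => ?_
        rw [← hf]
        exact h₂ F hF
  refine ⟨Subset.antisymm ?_ ?_, max C₁ C₂, fun f hf => ⟨?_, ?_⟩⟩
  · rintro f ⟨F, hF, rfl⟩
    exact (h₂ F hF).trans_lt (ENNReal.mul_lt_top ENNReal.coe_lt_top hF.stripNorm_lt_top)
  · intro f hf
    obtain ⟨F, hF, hFf, -⟩ := h₃ f hf
    exact ⟨F, hF, hFf⟩
  · obtain ⟨F, hF, hFf, hFn⟩ := h₃ f hf
    have hne : interpNorm A₀ A₁ θ f ≠ ∞ := ((interpNorm_le hF hFf).trans_lt hF.stripNorm_lt_top).ne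
    refine ((h₄ f).resolve_right hne).trans ?_
    gcongr
    exact le_max_right _ _
  · obtain ⟨F, hF, hFf, hFn⟩ := h₃ f hf
    refine (interpNorm_le hF hFf).trans (hFn.trans ?_)
    gcongr
    exact le_max_left _ _

end Interpolation

/-! ### Bounded functionals from bounded test functions, and the converse of Hölder's inequality. -/

section Pairing

variable {X : Type*} [MeasurableSpace X] [DiscreteMeasurableSpace X] [Countable X] {μ : Measure X}
  [IsFiniteMeasure μ]

theorem lintegral_enorm_le_sum {A₀ A₁ : ExtNorm (X → ℂ)} {C : ℝ≥0}
    (h₀ : ∀ f, ∫⁻ x, ‖f x‖ₑ ∂μ ≤ C * A₀ f) (h₁ : ∀ f, ∫⁻ x, ‖f x‖ₑ ∂μ ≤ C * A₁ f) (f : X → ℂ) :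
    ∫⁻ x, ‖f x‖ₑ ∂μ ≤ C * A₀.sum A₁ f := by
  rw [show A₀.sum A₁ f = ⨅ g, A₀ g + A₁ (f - g) from rfl]
  rw [ENNReal.mul_iInf (by simp)]
  refine le_iInf fun g => ?_
  rw [mul_add]
  refine le_trans ?_ (add_le_add (h₀ g) (h₁ (f - g)))
  rw [← lintegral_add_left .of_discrete]
  refine lintegral_mono fun x => ?_
  simpa using enorm_add_le (g x) ((f - g) x)

/-- In a space embedded in `L¹`, integration against a bounded function is a bounded functional;
these are the only functionals applied to admissible functions below. -/
theorem exists_pairing {N : ExtNorm (X → ℂ)} {C : ℝ≥0} (hN : ∀ f, ∫⁻ x, ‖f x‖ₑ ∂μ ≤ C * N f)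
    {A : X → ℂ} {M : ℝ} (hA : ∀ x, ‖A x‖ ≤ M) :
    ∃ l : N.space →ₗ[ℂ] ℂ, IsBoundedFunctional N l ∧
      ∀ f : N.space, l f = ∫ x, (f : X → ℂ) x * A x ∂μ := by
  have hi : ∀ f : N.space, Integrable (fun x => (f : X → ℂ) x * A x) μ := fun f =>
    Integrable.mul_bdd (c := M) ⟨Measurable.of_discrete.aestronglyMeasurable,
      (hN f).trans_lt (ENNReal.mul_lt_top ENNReal.coe_lt_top f.2)⟩
      Measurable.of_discrete.aestronglyMeasurable (.of_forall hA)
  refine ⟨{ toFun := fun f => ∫ x, (f : X → ℂ) x * A x ∂μ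
            map_add' := fun f g => ?_
            map_smul' := fun a f => ?_ }, ⟨Real.toNNReal M * C, fun f => ?_⟩, fun f => rfl⟩
  · rw [← integral_add (hi f) (hi g)]
    simp [add_mul]
  · simp only [Submodule.coe_smul, Pi.smul_apply, smul_eq_mul, RingHom.id_apply, mul_assoc]
    rw [integral_const_mul]
  · refine (enorm_integral_le_lintegral_enorm _).trans ?_
    rw [ENNReal.coe_mul, mul_assoc]
    refine le_trans ?_ (mul_le_mul_right (hN f) _)
    rw [← lintegral_const_mul _ .of_discrete]
    refine lintegral_mono fun x => ?_
    rw [enorm_mul, mul_comm]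
    gcongr
    rw [← ofReal_norm]
    exact ENNReal.ofReal_le_ofReal (hA x)

theorem eLpNorm_eq_lintegral_rpow {p : ℝ} (hp : 0 < p) (f : X → ℂ) :
    eLpNorm f (ENNReal.ofReal p) μ = (∫⁻ x, ‖f x‖ₑ ^ p ∂μ) ^ p⁻¹ := by
  rw [eLpNorm_eq_lintegral_rpow_enorm_toReal (by simpa using hp) ENNReal.ofReal_ne_top,
    ENNReal.toReal_ofReal hp.le, one_div]

/-- The converse of Hölder's inequality, tested on finitely supported functions. -/
theorem eLpNorm_le_of_forall_integral_mul_le (hμ : ∀ x, μ {x} ≠ 0) {p q : ℝ}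
    (hpq : p.HolderConjugate q) {f : X → ℂ} {C : ℝ≥0∞}
    (h : ∀ g : X → ℂ, (Function.support g).Finite → eLpNorm g (ENNReal.ofReal q) μ ≤ 1 →
      ‖∫ x, f x * g x ∂μ‖ₑ ≤ C) : eLpNorm f (ENNReal.ofReal p) μ ≤ C := by
  classical
  have hp := hpq.pos
  have hq := hpq.symm.pos
  rw [eLpNorm_eq_lintegral_rpow hp, ENNReal.rpow_inv_le_iff hp, lintegral_countable',
    ENNReal.tsum_eq_iSup_sum]
  refine iSup_le fun s => ?_
  rw [← ENNReal.rpow_inv_le_iff hp]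
  let m : X → ℝ≥0 := fun x => (μ {x}).toNNReal
  have hm : ∀ x, μ {x} = m x := fun x => (ENNReal.coe_toNNReal (measure_ne_top _ _)).symm
  have hm0 : ∀ x, m x ≠ 0 := fun x h0 => hμ x (by rw [hm, h0, ENNReal.coe_zero])
  -- The extremal vector of the discrete Hölder inequality for `|f x| μ{x}^{1/p}` on the finite set
  -- `s`.
  obtain ⟨⟨ψ, hψ, hψe⟩, -⟩ := NNReal.isGreatest_Lp s (fun x => ‖f x‖₊ * m x ^ p⁻¹) hpq
  let sg : X → ℂ := fun x => if f x = 0 then 0 else (starRingEnd ℂ) (f x) / (‖f x‖ : ℂ)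
  have hsg : ∀ x, f x * sg x = (‖f x‖ : ℂ) := by
    intro x
    by_cases hx : f x = 0
    · simp [sg, hx]
    · have h0 : (‖f x‖ : ℂ) ≠ 0 := by exact_mod_cast norm_ne_zero_iff.2 hx
      simp only [sg, if_neg hx]
      rw [← mul_div_assoc, Complex.mul_conj, Complex.normSq_eq_norm_sq, div_eq_iff h0]
      push_cast
      ring
  have hsg1 : ∀ x, ‖sg x‖₊ ≤ 1 := by
    intro x
    by_cases hx : f x = 0
    · simp [sg, hx]
    · refine NNReal.coe_le_coe.1 ?_
      simp only [sg, if_neg hx, coe_nnnorm, norm_div, RCLike.norm_conj, Complex.norm_real, norm_norm]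
      exact div_self_le_one _
  -- The weight `m^{-1/q}` normalises `g` in `L^q(μ)`; since `1 - 1/q = 1/p`, the product `f g m`
  -- equals `|f| m^{1/p} ψ`.
  let g : X → ℂ := fun x => if x ∈ s then sg x * ((ψ x * m x ^ (-q⁻¹) : ℝ≥0) : ℂ) else 0
  have hg0 : ∀ x ∉ s, g x = 0 := fun x hx => by simp [g, hx]
  have hgs : (Function.support g).Finite := s.finite_toSet.subset fun x hx => by
    by_contra hxs
    exact hx (hg0 x hxs)
  have hgn : eLpNorm g (ENNReal.ofReal q) μ ≤ 1 := by
    rw [eLpNorm_eq_lintegral_rpow hq, ENNReal.rpow_inv_le_iff hq, ENNReal.one_rpow,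
      lintegral_countable', tsum_eq_sum (s := s) fun x hx => by simp [hg0 x hx, hq]]
    calc ∑ x ∈ s, ‖g x‖ₑ ^ q * μ {x} ≤ ∑ x ∈ s, ((ψ x ^ q : ℝ≥0) : ℝ≥0∞) := by
          refine Finset.sum_le_sum fun x hx => ?_
          have h1 : ‖g x‖₊ ≤ ψ x * m x ^ (-q⁻¹) := by
            simp only [g, if_pos hx, nnnorm_mul]
            refine (mul_le_of_le_one_left' (hsg1 x)).trans (le_of_eq ?_)
            refine NNReal.coe_injective ?_
            rw [coe_nnnorm, Complex.norm_real, Real.norm_of_nonneg (NNReal.coe_nonneg _)]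
          rw [hm x, enorm_eq_nnnorm, ← ENNReal.coe_rpow_of_nonneg _ hq.le, ← ENNReal.coe_mul,
            ENNReal.coe_le_coe]
          calc ‖g x‖₊ ^ q * m x ≤ (ψ x * m x ^ (-q⁻¹)) ^ q * m x := by gcongr
            _ = ψ x ^ q := by
                rw [NNReal.mul_rpow, ← NNReal.rpow_mul, neg_mul, inv_mul_cancel₀ hq.ne', mul_assoc,
                  NNReal.rpow_neg_one, inv_mul_cancel₀ (hm0 x), mul_one]
      _ ≤ 1 := by
          rw [← ENNReal.ofNNReal_finsetSum]
          exact_mod_cast hψ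
  have hint : ∫ x, f x * g x ∂μ = ((∑ x ∈ s, ‖f x‖₊ * m x ^ p⁻¹ * ψ x : ℝ≥0) : ℂ) := by
    rw [← setIntegral_eq_integral_of_forall_compl_eq_zero (s := (s : Set X)) fun x hx => by
      rw [hg0 x (by simpa using hx), mul_zero]]
    rw [setIntegral_finset s ?_]
    · push_cast
      refine Finset.sum_congr rfl fun x hx => ?_
      simp only [g, if_pos hx]
      rw [← mul_assoc, hsg]
      have h1 : m x * m x ^ (-q⁻¹) = m x ^ p⁻¹ := by
        nth_rewrite 1 [← NNReal.rpow_one (m x)]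
        rw [← NNReal.rpow_add (hm0 x)]
        congr 1
        linarith [hpq.inv_add_inv_eq_one]
      have h2 : (m x : ℝ) * (m x : ℝ) ^ (-q⁻¹) = (m x : ℝ) ^ p⁻¹ := by exact_mod_cast h1
      rw [show μ.real {x} = (m x : ℝ) from rfl, ← h2, Complex.real_smul]
      push_cast
      ring
    · exact IntegrableOn.finset
  simp only at hψe
  have h3 := h g hgs hgn
  rw [hint] at h3
  refine le_trans (le_of_eq ?_) h3
  rw [← ofReal_norm, Complex.norm_real, Real.norm_of_nonneg (NNReal.coe_nonneg _),
    ENNReal.ofReal_coe_nnreal, hψe, one_div, ENNReal.coe_rpow_of_nonneg _ (inv_nonneg.2 hp.le),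
    ENNReal.ofNNReal_finsetSum]
  congr 1
  refine Finset.sum_congr rfl fun x _ => ?_
  rw [NNReal.mul_rpow, ← NNReal.rpow_mul, inv_mul_cancel₀ hp.ne', NNReal.rpow_one, hm x,
    ENNReal.coe_mul, enorm_eq_nnnorm, ENNReal.coe_rpow_of_nonneg _ hp.le]

end Pairing

/-! ### The Riesz–Thorin family. -/

section PowerFamily

variable {X : Type*} {g : X → ℂ} {s : ℂ} {x : X}

open Classical in
/-- The analytic family `sgn(g) |g| ^ s` through `g`. -/
noncomputable def powFamily (g : X → ℂ) (s : ℂ) (x : X) : ℂ :=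
  if g x = 0 then 0 else g x * Complex.exp ((s - 1) * (Real.log ‖g x‖ : ℂ))

theorem powFamily_one (g : X → ℂ) : powFamily g 1 = g := by
  ext x
  by_cases hx : g x = 0 <;> simp [powFamily, hx]

theorem powFamily_eq_zero (s : ℂ) (hx : g x = 0) : powFamily g s x = 0 := by
  simp [powFamily, hx]

/-- Equality holds where `g x ≠ 0`. At a zero of `g` only the inequality survives, since `0 ^ 0 =
1`. -/
theorem norm_powFamily_le (g : X → ℂ) (s : ℂ) (x : X) : ‖powFamily g s x‖ ≤ ‖g x‖ ^ s.re := by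
  by_cases hx : g x = 0
  · rw [powFamily_eq_zero s hx, norm_zero]
    positivity
  · have hpos : 0 < ‖g x‖ := norm_pos_iff.2 hx
    rw [powFamily, if_neg hx, norm_mul, Complex.norm_exp, Complex.re_mul_ofReal, Complex.sub_re,
      Complex.one_re, Real.rpow_def_of_pos hpos]
    nth_rewrite 1 [← Real.exp_log hpos]
    rw [← Real.exp_add]
    exact le_of_eq (by ring_nf)

theorem enorm_powFamily_le (g : X → ℂ) (hs : 0 ≤ s.re) (x : X) :
    ‖powFamily g s x‖ₑ ≤ ‖g x‖ₑ ^ s.re := by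
  rw [← ofReal_norm, ← ofReal_norm, ENNReal.ofReal_rpow_of_nonneg (norm_nonneg _) hs]
  exact ENNReal.ofReal_le_ofReal (norm_powFamily_le g s x)

/-- A majorant independent of the smaller exponent, hence uniform over the strip. -/
theorem rpow_le_one_add_rpow {a u v : ℝ} (ha : 0 ≤ a) (hu : 0 ≤ u) (huv : u ≤ v) :
    a ^ u ≤ 1 + a ^ v := by
  rcases le_total a 1 with h | h
  · exact (Real.rpow_le_one ha h hu).trans (le_add_of_nonneg_right (by positivity))
  · exact (Real.rpow_le_rpow_of_exponent_le h huv).trans (le_add_of_nonneg_left zero_le_one)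

theorem norm_powFamily_le_one_add {ρ : ℝ} (g : X → ℂ) (h0 : 0 ≤ s.re) (h1 : s.re ≤ ρ) (x : X) :
    ‖powFamily g s x‖ ≤ 1 + ‖g x‖ ^ ρ :=
  (norm_powFamily_le g s x).trans (rpow_le_one_add_rpow (norm_nonneg _) h0 h1)

theorem differentiable_powFamily (g : X → ℂ) (x : X) : Differentiable ℂ fun s => powFamily g s x := by
  unfold powFamily
  by_cases hx : g x = 0
  · simp [hx]
  · simp only [hx, if_false]
    fun_prop

end PowerFamily

/-! ### Embeddings into `L¹`, bounded functions in BMO, and Hölder estimates. -/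

section Embeddings

variable {X : Type*} [MeasurableSpace X] [DiscreteMeasurableSpace X] [Countable X] {μ : Measure X}
  [IsFiniteMeasure μ] {𝒟 : Set (Set X)} {K : ℝ}

theorem exists_lintegral_enorm_le_eLpNorm (μ : Measure X) [IsFiniteMeasure μ] {p : ℝ}
    (hp : 1 ≤ p) : ∃ C : ℝ≥0, ∀ f : X → ℂ,
      ∫⁻ x, ‖f x‖ₑ ∂μ ≤ C * eLpNorm f (ENNReal.ofReal p) μ := by
  set e : ℝ := 1 / (1 : ℝ≥0∞).toReal - 1 / (ENNReal.ofReal p).toReal with he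
  have he0 : 0 ≤ e := by
    rw [he, ENNReal.toReal_ofReal (by linarith), ENNReal.toReal_one, sub_nonneg]
    exact one_div_le_one_div_of_le one_pos hp
  refine ⟨(μ univ ^ e).toNNReal, fun f => ?_⟩
  rw [ENNReal.coe_toNNReal (ENNReal.rpow_ne_top_of_nonneg he0 (measure_ne_top _ _)), mul_comm,
    ← eLpNorm_one_eq_lintegral_enorm]
  exact eLpNorm_le_eLpNorm_mul_rpow_measure_univ (ENNReal.one_le_ofReal.2 hp)
    Measurable.of_discrete.aestronglyMeasurable

theorem IsRegularDyadic.measure_univ_ne_zero (h : IsRegularDyadic μ 𝒟 K) : μ univ ≠ 0 := by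
  intro h0
  have := h.one_le_measure_univ
  simp [measureReal_def, h0] at this
  linarith

theorem IsRegularDyadic.nonempty (h : IsRegularDyadic μ 𝒟 K) : Nonempty X := by
  by_contra hX
  rw [not_nonempty_iff] at hX
  exact h.measure_univ_ne_zero (by rw [univ_eq_empty_iff.2 hX, measure_empty])

theorem IsRegularDyadic.exists_lintegral_le_sum_bmo (h : IsRegularDyadic μ 𝒟 K) {p : ℝ}
    (hp : 1 ≤ p) (hp' : 1 ≤ ENNReal.ofReal p) : ∃ C : ℝ≥0, ∀ f : X → ℂ,
      ∫⁻ x, ‖f x‖ₑ ∂μ ≤ C * (lpNorm μ (ENNReal.ofReal p) hp').sum (bmoNorm μ 𝒟) f := by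
  obtain ⟨C, hC⟩ := exists_lintegral_enorm_le_eLpNorm μ hp
  refine ⟨max C (μ univ + 1).toNNReal, lintegral_enorm_le_sum (fun f => (hC f).trans ?_) fun f =>
    (lintegral_enorm_le_bmoFun h.univ_mem h.measure_univ_ne_zero f).trans ?_⟩
  · exact mul_le_mul_left (by exact_mod_cast le_max_left _ _) _
  · refine mul_le_mul_left ?_ _
    rw [← ENNReal.coe_toNNReal (ENNReal.add_ne_top.2 ⟨measure_ne_top μ univ, ENNReal.one_ne_top⟩)]
    exact_mod_cast le_max_right _ _

theorem exists_lintegral_le_sum_h1 (μ : Measure X) [IsFiniteMeasure μ] (𝒟 : Set (Set X)) {p : ℝ}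
    (hp : 1 ≤ p) (hp' : 1 ≤ ENNReal.ofReal p) : ∃ C : ℝ≥0, ∀ f : X → ℂ,
      ∫⁻ x, ‖f x‖ₑ ∂μ ≤ C * (h1Norm μ 𝒟).sum (lpNorm μ (ENNReal.ofReal p) hp') f := by
  obtain ⟨C, hC⟩ := exists_lintegral_enorm_le_eLpNorm μ hp
  refine ⟨max C 1, lintegral_enorm_le_sum (fun f => (lintegral_enorm_le_h1Fun (𝒟 := 𝒟) f).trans ?_) fun f =>
    (hC f).trans ?_⟩
  · refine le_mul_of_one_le_left bot_le ?_
    exact_mod_cast le_max_right _ _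
  · exact mul_le_mul_left (by exact_mod_cast le_max_left _ _) _

theorem bmoFun_le_of_norm_le_one {f : X → ℂ} (hf : ∀ x, ‖f x‖ ≤ 1) :
    bmoFun μ 𝒟 f ≤ 2 + μ univ := by
  have hfi : Integrable f μ :=
    Integrable.of_bound Measurable.of_discrete.aestronglyMeasurable 1 (.of_forall hf)
  rw [bmoFun, if_pos hfi]
  refine add_le_add (iSup₂_le fun D _ => ?_) ?_
  · have hc : ‖⨍ y in D, f y ∂μ‖ ≤ 1 := by
      rw [setAverage_eq, norm_smul, norm_inv, Real.norm_of_nonneg measureReal_nonneg]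
      have h1 : ‖∫ y in D, f y ∂μ‖ ≤ 1 * μ.real D :=
        norm_setIntegral_le_of_norm_le_const (measure_lt_top _ _) fun x _ => hf x
      refine (mul_le_mul_of_nonneg_left h1 (by positivity)).trans ?_
      rw [one_mul]
      exact inv_mul_le_one
    rw [setLAverage_eq]
    refine ENNReal.div_le_of_le_mul ?_
    rw [← setLIntegral_const]
    refine lintegral_mono fun x => ?_
    rw [← ofReal_norm, ← ENNReal.ofReal_ofNat]
    refine ENNReal.ofReal_le_ofReal ((norm_sub_le _ _).trans ?_)
    linarith [hf x]
  · refine (enorm_integral_le_lintegral_enorm _).trans ?_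
    calc ∫⁻ x, ‖f x‖ₑ ∂μ ≤ ∫⁻ _, 1 ∂μ := by
          refine lintegral_mono fun x => ?_
          rw [← ofReal_norm]
          exact ENNReal.ofReal_le_one.2 (hf x)
      _ = μ univ := by rw [lintegral_const, one_mul]

theorem eLpNorm_lt_top_of_bounded {f : X → ℂ} {M : ℝ} (hf : ∀ x, ‖f x‖ ≤ M) (p : ℝ≥0∞) :
    eLpNorm f p μ < ∞ :=
  (MemLp.of_bound Measurable.of_discrete.aestronglyMeasurable M (.of_forall hf)).2

theorem enorm_integral_mul_le_eLpNorm {p q : ℝ} (hpq : p.HolderConjugate q) (f G : X → ℂ) :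
    ‖∫ x, f x * G x ∂μ‖ₑ ≤ eLpNorm f (ENNReal.ofReal p) μ * eLpNorm G (ENNReal.ofReal q) μ := by
  refine (enorm_integral_le_lintegral_enorm _).trans ?_
  rw [eLpNorm_eq_lintegral_rpow hpq.pos, eLpNorm_eq_lintegral_rpow hpq.symm.pos, ← one_div,
    ← one_div]
  simp only [enorm_mul]
  exact ENNReal.lintegral_mul_le_Lp_mul_Lq μ hpq (Measurable.aemeasurable .of_discrete)
    (Measurable.aemeasurable .of_discrete)

theorem integral_mul_add_sum {ι : Type*} (S : Finset ι) {f A₀ : X → ℂ} {A : ι → X → ℂ} {M₀ : ℝ}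
    {M : ι → ℝ} (hf : Integrable f μ) (hA₀ : ∀ x, ‖A₀ x‖ ≤ M₀) (hA : ∀ i x, ‖A i x‖ ≤ M i)
    (c : ι → ℂ) : ∫ x, f x * A₀ x ∂μ + ∑ i ∈ S, c i * ∫ x, f x * A i x ∂μ =
      ∫ x, f x * (A₀ x + ∑ i ∈ S, c i * A i x) ∂μ := by
  have hi : ∀ {B : X → ℂ} {N : ℝ}, (∀ x, ‖B x‖ ≤ N) → Integrable (fun x => f x * B x) μ :=
    fun hB => hf.mul_bdd Measurable.of_discrete.aestronglyMeasurable (.of_forall hB)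
  simp only [mul_add, Finset.mul_sum, mul_left_comm (f _)]
  rw [integral_add (hi hA₀) (integrable_finsetSum _ fun i _ => (hi (hA i)).const_mul (c i)),
    integral_finsetSum _ fun i _ => (hi (hA i)).const_mul (c i)]
  simp only [integral_const_mul]

theorem lintegral_rpow_le_one {p : ℝ} (hp : 0 < p) {f : X → ℂ}
    (hf : eLpNorm f (ENNReal.ofReal p) μ ≤ 1) : ∫⁻ x, ‖f x‖ₑ ^ p ∂μ ≤ 1 := by
  rwa [eLpNorm_eq_lintegral_rpow hp, ENNReal.rpow_inv_le_iff hp, ENNReal.one_rpow] at hf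

theorem eLpNorm_powFamily_le_one {p p₁ : ℝ} (hp : 0 < p) (hp₁ : 0 < p₁) {f : X → ℂ}
    (hf : eLpNorm f (ENNReal.ofReal p) μ ≤ 1) {s : ℂ} (hs : s.re = p / p₁) :
    eLpNorm (powFamily f s) (ENNReal.ofReal p₁) μ ≤ 1 := by
  rw [eLpNorm_eq_lintegral_rpow hp₁, ENNReal.rpow_inv_le_iff hp₁, ENNReal.one_rpow]
  refine (lintegral_mono fun x => ?_).trans (lintegral_rpow_le_one hp hf)
  have h0 : 0 ≤ s.re := hs ▸ by positivity
  calc ‖powFamily f s x‖ₑ ^ p₁ ≤ (‖f x‖ₑ ^ s.re) ^ p₁ := by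
        gcongr
        exact enorm_powFamily_le f h0 x
    _ = ‖f x‖ₑ ^ p := by rw [← ENNReal.rpow_mul, hs, div_mul_cancel₀ _ hp₁.ne']

end Embeddings

theorem left_le_stripNorm {V : Type*} [AddCommGroup V] [Module ℂ V] {A₀ A₁ : ExtNorm V}
    (F : ℂ → (A₀.sum A₁).space) (t : ℝ) : A₀ (F (Complex.I * t) : V) ≤ stripNorm A₀ A₁ F :=
  (le_max_left _ _).trans
    (le_iSup (fun t : ℝ => max (A₀ (F (Complex.I * t) : V)) (A₁ (F (1 + Complex.I * t) : V))) t)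

theorem right_le_stripNorm {V : Type*} [AddCommGroup V] [Module ℂ V] {A₀ A₁ : ExtNorm V}
    (F : ℂ → (A₀.sum A₁).space) (t : ℝ) : A₁ (F (1 + Complex.I * t) : V) ≤ stripNorm A₀ A₁ F :=
  (le_max_right _ _).trans
    (le_iSup (fun t : ℝ => max (A₀ (F (Complex.I * t) : V)) (A₁ (F (1 + Complex.I * t) : V))) t)

theorem norm_levelCoeff_le {s : ℂ} {r : ℝ} (hs : s.re ≤ r) (k : ℕ) :
    ‖levelCoeff k s‖ ≤ (2 : ℝ) ^ ((k : ℝ) * r) := by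
  rw [norm_levelCoeff]
  gcongr
  · exact one_le_two
  · linarith

/-! ### The four inclusions. -/

section Inclusions

variable {X : Type*} [MeasurableSpace X] [DiscreteMeasurableSpace X] [Countable X] {μ : Measure X}
  [IsFiniteMeasure μ] {𝒟 : Set (Set X)} {K : ℝ} {θ p₁ p : ℝ}

/-- The Riesz–Thorin family of `f`: on the right edge it is bounded by one, hence bounded in BMO. -/
theorem exists_isAdmissible_lpNorm_bmoNorm (μ : Measure X) [IsFiniteMeasure μ]
    (𝒟 : Set (Set X)) (hθ0 : 0 < θ) (hθ1 : θ < 1) (hp₁ : 1 < p₁) (hp : p₁ < p)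
    (hpθ : 1 / p = (1 - θ) / p₁) (hp' : 1 ≤ ENNReal.ofReal p₁) {f : X → ℂ}
    (hf : eLpNorm f (ENNReal.ofReal p) μ ≤ 1) :
    ∃ F, IsAdmissible (lpNorm μ (ENNReal.ofReal p₁) hp') (bmoNorm μ 𝒟) F ∧
      (F (θ : ℂ) : X → ℂ) = f ∧
      stripNorm (lpNorm μ (ENNReal.ofReal p₁) hp') (bmoNorm μ 𝒟) F ≤ (3 + μ univ).toNNReal := by
  classical
  have hp0 : 0 < p := by linarith
  have hp₁0 : 0 < p₁ := by linarith
  -- `Re σ` is `p / p₁` on the left edge and `0` on the right edge, and `σ θ = 1`.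
  let σ : ℂ → ℂ := fun z => (p / p₁ : ℝ) * (1 - z)
  have hσd : Differentiable ℂ σ := by unfold σ; fun_prop
  have hσre : ∀ z, (σ z).re = p / p₁ * (1 - z.re) := fun z => by
    simp only [σ, Complex.re_ofReal_mul, Complex.sub_re, Complex.one_re]
  have hσθ : σ θ = 1 := by
    simp only [σ]
    rw [← Complex.ofReal_one, ← Complex.ofReal_sub, ← Complex.ofReal_mul]
    congr 1
    field_simp at hpθ ⊢
    linarith
  have hσ0 : ∀ z ∈ verticalClosedStrip 0 1, 0 ≤ (σ z).re ∧ (σ z).re ≤ p / p₁ := by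
    intro z hz
    have hz' : 0 ≤ z.re ∧ z.re ≤ 1 := hz
    have : 0 < p / p₁ := by positivity
    rw [hσre]
    constructor <;> nlinarith
  have hM : ((3 + μ univ).toNNReal : ℝ≥0∞) = 3 + μ univ :=
    ENNReal.coe_toNNReal (ENNReal.add_ne_top.2 ⟨by simp, measure_ne_top _ _⟩)
  have hsingle : ∀ x : X, (lpNorm μ (ENNReal.ofReal p₁) hp').sum (bmoNorm μ 𝒟)
      (Pi.single x (1 : ℂ)) < ∞ := fun x =>
    (ExtNorm.sum_le_left _ _ _).trans_lt (eLpNorm_lt_top_of_bounded (M := 1) (fun y => by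
      by_cases hy : y = x
      · subst hy; simp
      · simp [hy]) _)
  refine Exists.imp ?_ (exists_isAdmissible (A₀ := lpNorm μ (ENNReal.ofReal p₁) hp')
    (A₁ := bmoNorm μ 𝒟) (g := fun z => powFamily f (σ z)) (b₀ := 0)
    (b := fun x : X => Pi.single x (1 : ℂ)) (c := fun x z => powFamily f (σ z) x)
    (M := (3 + μ univ).toNNReal) (by simp [ExtNorm.map_zero']) hsingle
    (fun x => (differentiable_powFamily f x).comp hσd)
    (fun x => ⟨1 + ‖f x‖ ^ (p / p₁), fun z hz =>
      norm_powFamily_le_one_add f (hσ0 z hz).1 (hσ0 z hz).2 x⟩) ?_ ?_ ?_)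
  · rintro F ⟨hF, hFg, hFn⟩
    refine ⟨hF, ?_, hFn⟩
    rw [hFg _ (by simp [verticalClosedStrip, hθ0.le, hθ1.le]), hσθ, powFamily_one]
  · intro ε hε
    -- Truncating to finitely many points is uniform in `z`: `1 + |f|^p` is integrable and dominates
    -- the `p₁`-th power of the family throughout the strip.
    have hfin : ∑' x, (1 + ‖f x‖ₑ ^ p) * μ {x} ≠ ∞ := by
      rw [← lintegral_countable', lintegral_add_left .of_discrete, lintegral_const, one_mul]
      exact (ENNReal.add_lt_top.2 ⟨measure_lt_top _ _,
        (lintegral_rpow_le_one hp0 hf).trans_lt ENNReal.one_lt_top⟩).ne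
    have hεp : (0 : ℝ≥0∞) < (ε : ℝ≥0∞) ^ p₁ :=
      ENNReal.rpow_pos (ENNReal.coe_pos.2 hε) ENNReal.coe_ne_top
    obtain ⟨S, hS⟩ := ((ENNReal.tendsto_tsum_compl_atTop_zero hfin).eventually
      (gt_mem_nhds hεp)).exists
    refine ⟨S, fun z hz => (ExtNorm.sum_le_left _ _ _).trans ?_⟩
    show eLpNorm _ _ _ ≤ _
    rw [eLpNorm_eq_lintegral_rpow hp₁0, ENNReal.rpow_inv_le_iff hp₁0, lintegral_countable']
    refine le_trans ?_ hS.le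
    refine le_trans ?_ (tsum_subtype {x | x ∉ S} (fun x => (1 + ‖f x‖ₑ ^ p) * μ {x})).ge
    refine ENNReal.tsum_le_tsum fun y => ?_
    have hval : (powFamily f (σ z) - (0 + ∑ x ∈ S, powFamily f (σ z) x • Pi.single x (1 : ℂ))) y =
        if y ∈ S then 0 else powFamily f (σ z) y := by
      simp only [zero_add, Pi.sub_apply, Finset.sum_apply, Pi.smul_apply, smul_eq_mul,
        Pi.single_apply, mul_ite, mul_one, mul_zero, Finset.sum_ite_eq]
      split_ifs <;> simp
    rw [hval]
    by_cases hy : y ∈ S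
    · simp [hy, hp₁0]
    · rw [if_neg hy, indicator_of_mem (show y ∈ {x | x ∉ S} from hy)]
      gcongr
      have h1 : ‖powFamily f (σ z) y‖ ^ p₁ ≤ 1 + ‖f y‖ ^ p := by
        calc ‖powFamily f (σ z) y‖ ^ p₁ ≤ (‖f y‖ ^ (σ z).re) ^ p₁ := by
              gcongr
              exact norm_powFamily_le _ _ _
          _ = ‖f y‖ ^ ((σ z).re * p₁) := by rw [Real.rpow_mul (norm_nonneg _)]
          _ ≤ _ := by
              refine rpow_le_one_add_rpow (norm_nonneg _) (mul_nonneg (hσ0 z hz).1 hp₁0.le) ?_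
              rw [← le_div_iff₀ hp₁0]
              exact (hσ0 z hz).2
      have h2 := ENNReal.ofReal_le_ofReal h1
      rwa [ENNReal.ofReal_add zero_le_one (by positivity), ENNReal.ofReal_one,
        ← ENNReal.ofReal_rpow_of_nonneg (norm_nonneg _) hp₁0.le,
        ← ENNReal.ofReal_rpow_of_nonneg (norm_nonneg _) hp0.le, ofReal_norm, ofReal_norm] at h2
  · intro t
    refine (eLpNorm_powFamily_le_one hp0 hp₁0 hf (by rw [hσre]; simp)).trans ?_
    rw [hM]
    exact le_add_right (by norm_num)
  · intro t
    refine (bmoFun_le_of_norm_le_one fun x => ?_).trans ?_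
    · refine (norm_powFamily_le f _ x).trans ?_
      rw [hσre]
      simp
    · rw [hM]
      gcongr
      norm_num

/-- Here `czFamily` of `f` itself is the admissible function, with the pieces as fixed vectors and
the level coefficients as scalar functions. -/
theorem IsRegularDyadic.exists_isAdmissible_h1Norm_lpNorm (h : IsRegularDyadic μ 𝒟 K)
    (hθ0 : 0 < θ) (hθ1 : θ < 1) (hp : 1 < p) (hp₁ : p < p₁)
    (hpθ : 1 / p = 1 - θ + θ / p₁) (hp' : 1 ≤ ENNReal.ofReal p₁) :
    ∃ C : ℝ≥0, ∀ f : X → ℂ, eLpNorm f (ENNReal.ofReal p) μ ≤ 1 →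
    ∃ F, IsAdmissible (h1Norm μ 𝒟) (lpNorm μ (ENNReal.ofReal p₁) hp') F ∧
      (F (θ : ℂ) : X → ℂ) = f ∧
      stripNorm (h1Norm μ 𝒟) (lpNorm μ (ENNReal.ofReal p₁) hp') F ≤ C := by
  have hX := h.nonempty
  have hp0 : 0 < p := by linarith
  have hp₁0 : 0 < p₁ := by linarith
  obtain ⟨C₁, hC₁⟩ := h.exists_tsum_measure_overAvg_le hp
  obtain ⟨C₂, hC₂⟩ := h.exists_lintegral_czFamily_le (r₁ := p₁) hp0 (by linarith)
  let m : ℝ≥0 := (μ univ).toNNReal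
  have hm : (m : ℝ≥0∞) = μ univ := ENNReal.coe_toNNReal (measure_ne_top _ _)
  let M₀ : ℝ≥0 := Real.toNNReal (3 * K) * (m + C₁)
  let M₁ : ℝ≥0 := (C₂ * (m + C₁)) ^ p₁⁻¹
  refine ⟨max M₀ M₁, fun f hf => ?_⟩
  obtain ⟨hfi, hf1⟩ := h.average_norm_le_one hp.le hf
  have hW : ∑' k, levelMass μ 𝒟 f p k ≤ C₁ :=
    (hC₁ f hfi).trans (mul_le_of_le_one_right bot_le (lintegral_rpow_le_one hp0 hf))
  -- `Re σ` runs from `p` (the `H¹` edge) to `p / p₁` (the `L^{p₁}` edge), with `σ θ = 1`.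
  let σ : ℂ → ℂ := fun z => (p : ℝ) * (1 - z + z / (p₁ : ℝ))
  have hσd : Differentiable ℂ σ := by unfold σ; fun_prop
  have hσre : ∀ z, (σ z).re = p * (1 - z.re + z.re / p₁) := fun z => by
    simp only [σ, Complex.re_ofReal_mul, Complex.sub_re, Complex.add_re, Complex.one_re,
      Complex.div_ofReal_re]
  have hσθ : σ θ = 1 := by
    simp only [σ]
    rw [← Complex.ofReal_one, ← Complex.ofReal_sub, ← Complex.ofReal_div, ← Complex.ofReal_add,
      ← Complex.ofReal_mul, ← hpθ, mul_one_div_cancel hp0.ne']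
  have hσ1 : ∀ z ∈ verticalClosedStrip 0 1, (σ z).re ≤ p := by
    intro z hz
    have hz' : 0 ≤ z.re ∧ z.re ≤ 1 := hz
    have h1 : z.re / p₁ ≤ z.re := div_le_self hz'.1 (by linarith)
    rw [hσre]
    nlinarith
  refine Exists.imp ?_ (exists_isAdmissible (A₀ := h1Norm μ 𝒟)
    (A₁ := lpNorm μ (ENNReal.ofReal p₁) hp') (g := fun z => czFamily μ 𝒟 f (σ z))
    (b₀ := goodPart μ 𝒟 f 1) (b := fun k => czPiece μ 𝒟 f k) (c := fun k z => levelCoeff k (σ z))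
    (M := max M₀ M₁) ?_ (fun k => ?_) (fun k => (differentiable_levelCoeff k).comp hσd)
    (fun k => ⟨(2 : ℝ) ^ ((k : ℝ) * p), fun z hz => norm_levelCoeff_le (hσ1 z hz) k⟩)
    ?_ (fun t => ?_) (fun t => ?_))
  · rintro F ⟨hF, hFg, hFn⟩
    refine ⟨hF, ?_, hFn⟩
    rw [hFg _ (by simp [verticalClosedStrip, hθ0.le, hθ1.le]), hσθ, h.czFamily_one hfi]
  · exact (ExtNorm.sum_le_right _ _ _).trans_lt
      (eLpNorm_lt_top_of_bounded (h.norm_goodPart_one_le hfi hf1) _)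
  · exact (ExtNorm.sum_le_right _ _ _).trans_lt
      (eLpNorm_lt_top_of_bounded (h.isMolecule_czPiece hfi hf1 k).norm_le _)
  · intro ε hε
    have hlim := ENNReal.Tendsto.const_mul (a := ENNReal.ofReal (3 * K))
      (ENNReal.tendsto_tsum_compl_atTop_zero (hW.trans_lt ENNReal.coe_lt_top).ne)
      (Or.inr ENNReal.ofReal_ne_top)
    rw [mul_zero] at hlim
    obtain ⟨S, hS⟩ := (hlim.eventually (gt_mem_nhds (ENNReal.coe_pos.2 hε))).exists
    exact ⟨S, fun z hz => (ExtNorm.sum_le_left _ _ _).trans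
      ((h.h1Fun_czFamily_sub_le hfi hf1 (hσ1 z hz) S).trans hS.le)⟩
  · refine (h.h1Fun_czFamily_le hfi hf1 (hσ1 _ (mem_verticalClosedStrip_left t))).trans
      (le_trans ?_ (ENNReal.coe_le_coe.2 (le_max_left M₀ M₁)))
    simp only [M₀, ENNReal.coe_mul, ENNReal.coe_add, hm]
    exact mul_le_mul_right (add_le_add le_rfl hW) _
  · refine le_trans ?_ (ENNReal.coe_le_coe.2 (le_max_right M₀ M₁))
    show eLpNorm _ _ _ ≤ _
    rw [eLpNorm_eq_lintegral_rpow hp₁0]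
    simp only [M₁]
    rw [ENNReal.coe_rpow_of_nonneg _ (inv_nonneg.2 hp₁0.le)]
    refine ENNReal.rpow_le_rpow ?_ (inv_nonneg.2 hp₁0.le)
    refine (hC₂ f _ hfi hf1 (by rw [hσre]; simp [div_eq_mul_inv])).trans ?_
    simp only [ENNReal.coe_mul, ENNReal.coe_add, hm]
    gcongr

/-- Test `F θ` against `g` of the dual exponent, and apply the three lines theorem to the pairing of
`F z` with `czFamily` of `g`: Hölder bounds it on the left edge, the molecule estimate against BMO
on the right. -/
theorem IsRegularDyadic.exists_eLpNorm_le_stripNorm_bmo (h : IsRegularDyadic μ 𝒟 K)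
    (hθ0 : 0 < θ) (hθ1 : θ < 1) (hp₁ : 1 < p₁) (hp : p₁ < p)
    (hpθ : 1 / p = (1 - θ) / p₁) (hp' : 1 ≤ ENNReal.ofReal p₁) :
    ∃ C : ℝ≥0, ∀ F, IsAdmissible (lpNorm μ (ENNReal.ofReal p₁) hp') (bmoNorm μ 𝒟) F →
      eLpNorm (F (θ : ℂ) : X → ℂ) (ENNReal.ofReal p) μ ≤
        C * stripNorm (lpNorm μ (ENNReal.ofReal p₁) hp') (bmoNorm μ 𝒟) F := by
  obtain ⟨q, hpq⟩ : ∃ q, p.HolderConjugate q := ⟨_, .conjExponent (hp₁.trans hp)⟩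
  obtain ⟨q₁, hpq₁⟩ : ∃ q₁, p₁.HolderConjugate q₁ := ⟨_, .conjExponent hp₁⟩
  have hq1 := hpq.symm.lt
  have hq0 := hpq.symm.pos
  have hq₁1 := hpq₁.symm.lt
  have hq₁0 := hpq₁.symm.pos
  obtain ⟨C₀, hC₀⟩ := h.exists_lintegral_le_sum_bmo hp₁.le hp'
  obtain ⟨C₁, hC₁⟩ := h.exists_tsum_measure_overAvg_le hq1
  obtain ⟨C₂, hC₂⟩ := h.exists_lintegral_czFamily_le (r₁ := q₁) hq0 hq₁1.le
  let m : ℝ≥0 := (μ univ).toNNReal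
  have hm : (m : ℝ≥0∞) = μ univ := ENNReal.coe_toNNReal (measure_ne_top _ _)
  let M₀ : ℝ≥0 := (C₂ * (m + C₁)) ^ q₁⁻¹
  let M₁ : ℝ≥0 := Real.toNNReal (3 * K) * (m + 1 + C₁)
  refine ⟨max M₀ M₁, fun F hF =>
    eLpNorm_le_of_forall_integral_mul_le h.measure_singleton_ne_zero hpq fun g hgs hg => ?_⟩
  set N := stripNorm (lpNorm μ (ENNReal.ofReal p₁) hp') (bmoNorm μ 𝒟) F with hN
  have hNc : (N.toNNReal : ℝ≥0∞) = N := ENNReal.coe_toNNReal hF.stripNorm_lt_top.ne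
  obtain ⟨hgi, hg1⟩ := h.average_norm_le_one hq1.le hg
  have hW : ∑' k, levelMass μ 𝒟 g q k ≤ C₁ :=
    (hC₁ g hgi).trans (mul_le_of_le_one_right bot_le (lintegral_rpow_le_one hq0 hg))
  -- `Re σ` is `q / q₁` on the left edge and `q` on the right; `σ θ = 1` is the relation `θ + (1 -
  -- θ) / q₁ = 1 / q` dual to `hpθ`.
  let σ : ℂ → ℂ := fun z => (q : ℝ) * (z + (1 - z) / (q₁ : ℝ))
  have hσd : Differentiable ℂ σ := by unfold σ; fun_prop
  have hσre : ∀ z, (σ z).re = q * (z.re + (1 - z.re) / q₁) := fun z => by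
    simp only [σ, Complex.re_ofReal_mul, Complex.sub_re, Complex.add_re, Complex.one_re,
      Complex.div_ofReal_re]
  have hσθ : σ θ = 1 := by
    simp only [σ]
    rw [← Complex.ofReal_one, ← Complex.ofReal_sub, ← Complex.ofReal_div, ← Complex.ofReal_add,
      ← Complex.ofReal_mul]
    congr 1
    have h1 := hpq.inv_add_inv_eq_one
    have h2 := hpq₁.inv_add_inv_eq_one
    have h3 : θ + (1 - θ) / q₁ = q⁻¹ := by
      rw [one_div, div_eq_mul_inv] at hpθ
      rw [div_eq_mul_inv]
      linear_combination (-1 : ℝ) * h1 + (1 - θ) * h2 + hpθ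
    rw [h3, mul_inv_cancel₀ hq0.ne']
  have hσ1 : ∀ z ∈ verticalClosedStrip 0 1, (σ z).re ≤ q := by
    intro z hz
    have hz' : 0 ≤ z.re ∧ z.re ≤ 1 := hz
    have h1 : (1 - z.re) / q₁ ≤ 1 - z.re := div_le_self (by linarith) hq₁1.le
    rw [hσre]
    nlinarith
  -- A finitely supported `g` is bounded, so the level sets are empty from some level on and the
  -- family is a finite sum, as the three lines argument requires.
  obtain ⟨B, hB⟩ : ∃ B : ℝ, ∀ x, ‖g x‖ ≤ B := by
    obtain ⟨B, hB⟩ := (hgs.image fun x => ‖g x‖).bddAbove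
    refine ⟨max B 0, fun x => ?_⟩
    by_cases hx : g x = 0
    · simp [hx]
    · exact (hB ⟨x, hx, rfl⟩).trans (le_max_left _ _)
  obtain ⟨n, hn⟩ := pow_unbounded_of_one_lt B one_lt_two
  have hzero : ∀ k ∉ Finset.range n, ∀ x, czPiece μ 𝒟 g k x = 0 := by
    intro k hk x
    refine h.czPiece_eq_zero ?_
    rw [overAvg_eq_empty h.measure_singleton_ne_zero hB
      (hn.le.trans (pow_le_pow_right₀ one_le_two (by simpa using hk)))]
    exact notMem_empty x
  have hfam : ∀ s x, czFamily μ 𝒟 g s x = goodPart μ 𝒟 g 1 x +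
      ∑ k ∈ Finset.range n, levelCoeff k s * czPiece μ 𝒟 g k x := by
    intro s x
    rw [czFamily, tsum_eq_sum fun k hk => by rw [hzero k hk x, mul_zero]]
  obtain ⟨l₀, hl₀, hl₀e⟩ := exists_pairing hC₀ (h.norm_goodPart_one_le hgi hg1)
  choose l hl hle using fun k => exists_pairing hC₀ (h.isMolecule_czPiece hgi hg1 k).norm_le
  have hint : ∀ z, Integrable (F z : X → ℂ) μ := fun z =>
    ⟨Measurable.of_discrete.aestronglyMeasurable,
      (hC₀ _).trans_lt (ENNReal.mul_lt_top ENNReal.coe_lt_top (F z).2)⟩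
  have hval : ∀ z s, l₀ (F z) + ∑ k ∈ Finset.range n, levelCoeff k s * l k (F z) =
      ∫ x, (F z : X → ℂ) x * czFamily μ 𝒟 g s x ∂μ := by
    intro z s
    simp only [hl₀e, hle, hfam]
    exact integral_mul_add_sum _ (hint z) (h.norm_goodPart_one_le hgi hg1)
      (fun k => (h.isMolecule_czPiece hgi hg1 k).norm_le) _
  have key := hF.norm_le (Finset.range n) hl₀ hl (c := fun k z => levelCoeff k (σ z))
    (fun k => (differentiable_levelCoeff k).comp hσd)
    (fun k => ⟨(2 : ℝ) ^ ((k : ℝ) * q), fun z hz => norm_levelCoeff_le (hσ1 z hz) k⟩)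
    (M := max M₀ M₁ * N.toNNReal) (fun t => ?_) (fun t => ?_) hθ0 hθ1
  · rw [hval, hσθ, h.czFamily_one hgi, ENNReal.coe_mul, hNc] at key
    exact key
  · rw [hval, ENNReal.coe_mul, hNc, mul_comm ((max M₀ M₁ : ℝ≥0) : ℝ≥0∞)]
    refine (enorm_integral_mul_le_eLpNorm hpq₁ _ _).trans
      (mul_le_mul' (left_le_stripNorm F t) (le_trans ?_ (ENNReal.coe_le_coe.2 (le_max_left M₀ M₁))))
    rw [eLpNorm_eq_lintegral_rpow hq₁0]
    simp only [M₀]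
    rw [ENNReal.coe_rpow_of_nonneg _ (inv_nonneg.2 hq₁0.le)]
    refine ENNReal.rpow_le_rpow ?_ (inv_nonneg.2 hq₁0.le)
    refine (hC₂ g _ hgi hg1 (by rw [hσre]; simp [div_eq_mul_inv])).trans ?_
    simp only [ENNReal.coe_mul, ENNReal.coe_add, hm]
    gcongr
  · simp only [hl₀e, hle]
    refine (h.enorm_integral_mul_czFamily_le hgi hg1 (hσ1 _ (mem_verticalClosedStrip_right t)) _
      (hint _)).trans ?_
    rw [ENNReal.coe_mul, hNc]
    refine mul_le_mul' (le_trans ?_ (ENNReal.coe_le_coe.2 (le_max_right M₀ M₁)))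
      (right_le_stripNorm F t)
    simp only [M₁, ENNReal.coe_mul, ENNReal.coe_add, hm, ENNReal.coe_one]
    exact mul_le_mul_right (add_le_add le_rfl hW) _

/-- The Riesz–Thorin family of a dual test function is bounded by one on the left edge, so only the
embedding of `H¹` into `L¹` is needed there. All constants are one. -/
theorem IsRegularDyadic.eLpNorm_le_stripNorm_h1 (h : IsRegularDyadic μ 𝒟 K)
    (hθ0 : 0 < θ) (hθ1 : θ < 1) (hp : 1 < p) (hp₁ : p < p₁)
    (hpθ : 1 / p = 1 - θ + θ / p₁) (hp' : 1 ≤ ENNReal.ofReal p₁)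
    {F : ℂ → ((h1Norm μ 𝒟).sum (lpNorm μ (ENNReal.ofReal p₁) hp')).space}
    (hF : IsAdmissible (h1Norm μ 𝒟) (lpNorm μ (ENNReal.ofReal p₁) hp') F) :
    eLpNorm (F (θ : ℂ) : X → ℂ) (ENNReal.ofReal p) μ ≤
      stripNorm (h1Norm μ 𝒟) (lpNorm μ (ENNReal.ofReal p₁) hp') F := by
  classical
  obtain ⟨q, hpq⟩ : ∃ q, p.HolderConjugate q := ⟨_, .conjExponent hp⟩
  obtain ⟨q₁, hpq₁⟩ : ∃ q₁, p₁.HolderConjugate q₁ := ⟨_, .conjExponent (hp.trans hp₁)⟩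
  have hq0 := hpq.symm.pos
  have hq₁0 := hpq₁.symm.pos
  obtain ⟨C₀, hC₀⟩ := exists_lintegral_le_sum_h1 μ 𝒟 (hp.trans hp₁).le hp'
  refine eLpNorm_le_of_forall_integral_mul_le h.measure_singleton_ne_zero hpq fun g hgs hg => ?_
  set N := stripNorm (h1Norm μ 𝒟) (lpNorm μ (ENNReal.ofReal p₁) hp') F with hN
  have hNc : (N.toNNReal : ℝ≥0∞) = N := ENNReal.coe_toNNReal hF.stripNorm_lt_top.ne
  -- `Re σ` is `0` on the left edge and `q / q₁` on the right, and `σ θ = 1`.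
  let σ : ℂ → ℂ := fun z => (q / q₁ : ℝ) * z
  have hσd : Differentiable ℂ σ := by unfold σ; fun_prop
  have hσre : ∀ z, (σ z).re = q / q₁ * z.re := fun z => by
    simp only [σ, Complex.re_ofReal_mul]
  have hσθ : σ θ = 1 := by
    simp only [σ]
    rw [← Complex.ofReal_one, ← Complex.ofReal_mul]
    congr 1
    have h1 := hpq.inv_add_inv_eq_one
    have h2 := hpq₁.inv_add_inv_eq_one
    have h3 : θ * q₁⁻¹ = q⁻¹ := by
      rw [one_div, div_eq_mul_inv] at hpθ
      linear_combination (-1 : ℝ) * h1 + θ * h2 + hpθ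
    rw [div_eq_mul_inv, mul_assoc, mul_comm _ θ, h3, mul_inv_cancel₀ hq0.ne']
  have hσ0 : ∀ z ∈ verticalClosedStrip 0 1, 0 ≤ (σ z).re ∧ (σ z).re ≤ q / q₁ := by
    intro z hz
    have hz' : 0 ≤ z.re ∧ z.re ≤ 1 := hz
    have : 0 < q / q₁ := by positivity
    rw [hσre]
    constructor <;> nlinarith
  have hsingle : ∀ x y : X, ‖(Pi.single x (1 : ℂ) : X → ℂ) y‖ ≤ 1 := by
    intro x y
    by_cases hy : y = x
    · subst hy; simp
    · simp [hy]
  have hfam : ∀ s y, powFamily g s y =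
      0 + ∑ x ∈ hgs.toFinset, powFamily g s x * (Pi.single x (1 : ℂ) : X → ℂ) y := by
    intro s y
    simp only [zero_add, Pi.single_apply, mul_ite, mul_one, mul_zero, Finset.sum_ite_eq]
    split_ifs with hy
    · rfl
    · exact powFamily_eq_zero s (by simpa using hy)
  -- The family is a sum of point masses with no constant term, so the distinguished functional is
  -- zero.
  obtain ⟨l₀, hl₀, hl₀e⟩ := exists_pairing hC₀ (A := 0) (M := 0) (by simp)
  choose l hl hle using fun x : X => exists_pairing hC₀ (hsingle x)
  have hval : ∀ z s, l₀ (F z) + ∑ x ∈ hgs.toFinset, powFamily g s x * l x (F z) =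
      ∫ x, (F z : X → ℂ) x * powFamily g s x ∂μ := by
    intro z s
    have hint : Integrable (F z : X → ℂ) μ := ⟨Measurable.of_discrete.aestronglyMeasurable,
      (hC₀ _).trans_lt (ENNReal.mul_lt_top ENNReal.coe_lt_top (F z).2)⟩
    simp only [hl₀e, hle]
    rw [integral_mul_add_sum (A₀ := 0) (M₀ := 0) hgs.toFinset hint (by simp) hsingle]
    exact integral_congr_ae (.of_forall fun y => congrArg ((F z : X → ℂ) y * ·) (hfam s y).symm)
  have key := hF.norm_le hgs.toFinset hl₀ hl (c := fun x z => powFamily g (σ z) x)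
    (fun x => (differentiable_powFamily g x).comp hσd)
    (fun x => ⟨1 + ‖g x‖ ^ (q / q₁), fun z hz =>
      norm_powFamily_le_one_add g (hσ0 z hz).1 (hσ0 z hz).2 x⟩)
    (M := N.toNNReal) (fun t => ?_) (fun t => ?_) hθ0 hθ1
  · rwa [hval, hσθ, powFamily_one, hNc] at key
  · rw [hval, hNc]
    refine (enorm_integral_le_lintegral_enorm _).trans (le_trans (lintegral_mono fun x => ?_)
      ((lintegral_enorm_le_h1Fun _).trans (left_le_stripNorm F t)))
    have h1 : ‖powFamily g (σ (Complex.I * t)) x‖ₑ ≤ 1 := by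
      rw [← ofReal_norm]
      refine ENNReal.ofReal_le_one.2 ((norm_powFamily_le g _ x).trans ?_)
      rw [hσre]
      simp
    rw [enorm_mul]
    exact mul_le_of_le_one_right bot_le h1
  · rw [hval, hNc]
    refine (enorm_integral_mul_le_eLpNorm hpq₁ _ _).trans
      ((mul_le_mul' (right_le_stripNorm F t) (eLpNorm_powFamily_le_one hq0 hq₁0 hg ?_)).trans
        (mul_one _).le)
    rw [hσre]
    simp

theorem eq_zero_of_eLpNorm_eq_zero (hμ : ∀ x, μ {x} ≠ 0) {p : ℝ≥0∞} (hp : p ≠ 0) {f : X → ℂ}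
    (hf : eLpNorm f p μ = 0) : f = 0 := by
  rw [eLpNorm_eq_zero_iff Measurable.of_discrete.aestronglyMeasurable hp] at hf
  ext x
  by_contra hx
  exact hμ x (measure_mono_null (singleton_subset_iff.2 (show x ∈ {x | ¬ f x = (0 : X → ℂ) x} from hx))
    (ae_iff.1 hf))

/-- Complex interpolation between `L^p` and `BMO`. -/
theorem IsRegularDyadic.interpEq_lpNorm_bmoNorm (h : IsRegularDyadic μ 𝒟 K)
    (hθ0 : 0 < θ) (hθ1 : θ < 1) (hp₁ : 1 < p₁) (hp : p₁ < p) (hpθ : 1 / p = (1 - θ) / p₁)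
    (hp₁' : 1 ≤ ENNReal.ofReal p₁) (hp' : 1 ≤ ENNReal.ofReal p) :
    InterpEq (lpNorm μ (ENNReal.ofReal p₁) hp₁') (bmoNorm μ 𝒟) θ
      (lpNorm μ (ENNReal.ofReal p) hp') := by
  obtain ⟨C, hC⟩ := h.exists_eLpNorm_le_stripNorm_bmo hθ0 hθ1 hp₁ hp hpθ hp₁'
  exact interpEq_of_bounds (fun f hf => eq_zero_of_eLpNorm_eq_zero h.measure_singleton_ne_zero
    (zero_lt_one.trans_le hp').ne' hf)
    (fun f hf => exists_isAdmissible_lpNorm_bmoNorm μ 𝒟 hθ0 hθ1 hp₁ hp hpθ hp₁' hf) hC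

/-- Complex interpolation between `H¹` and `L^p`. -/
theorem IsRegularDyadic.interpEq_h1Norm_lpNorm (h : IsRegularDyadic μ 𝒟 K)
    (hθ0 : 0 < θ) (hθ1 : θ < 1) (hp : 1 < p) (hp₁ : p < p₁) (hpθ : 1 / p = 1 - θ + θ / p₁)
    (hp₁' : 1 ≤ ENNReal.ofReal p₁) (hp' : 1 ≤ ENNReal.ofReal p) :
    InterpEq (h1Norm μ 𝒟) (lpNorm μ (ENNReal.ofReal p₁) hp₁') θ
      (lpNorm μ (ENNReal.ofReal p) hp') := by
  obtain ⟨C, hC⟩ := h.exists_isAdmissible_h1Norm_lpNorm hθ0 hθ1 hp hp₁ hpθ hp₁'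
  refine interpEq_of_bounds (fun f hf => eq_zero_of_eLpNorm_eq_zero h.measure_singleton_ne_zero
    (zero_lt_one.trans_le hp').ne' hf) hC (C₂ := 1) fun F hF => ?_
  rw [ENNReal.coe_one, one_mul]
  exact h.eLpNorm_le_stripNorm_h1 hθ0 hθ1 hp hp₁ hpθ hp₁' hF

end Inclusions

end TreeInterp

theorem mainTheorem1 {X : Type*} [MeasurableSpace X] [DiscreteMeasurableSpace X]
    (q : ℕ) (hq : 1 < q) (G : SimpleGraph X) [G.LocallyFinite] (hG : G.IsTree)
    (hreg : G.IsRegularOfDegree (q + 1)) (o : X) (α : ℝ) (hα : 1 < α) :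
    (∀ (θ p₁ p : ℝ) (_ : 0 < θ) (_ : θ < 1) (hp₁ : 1 < p₁) (hp : p₁ < p)
        (_ : 1 / p = (1 - θ) / p₁),
      TreeInterp.InterpEq
        (TreeInterp.lpNorm (TreeInterp.expMeasure G o q α) (ENNReal.ofReal p₁)
          (ENNReal.one_le_ofReal.2 hp₁.le))
        (TreeInterp.bmoNorm (TreeInterp.expMeasure G o q α) (TreeInterp.dyadicSets G o))
        θ
        (TreeInterp.lpNorm (TreeInterp.expMeasure G o q α) (ENNReal.ofReal p)
          (ENNReal.one_le_ofReal.2 (hp₁.trans hp).le))) ∧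
    (∀ (θ p₁ p : ℝ) (_ : 0 < θ) (_ : θ < 1) (hp : 1 < p) (hp₁ : p < p₁)
        (_ : 1 / p = 1 - θ + θ / p₁),
      TreeInterp.InterpEq
        (TreeInterp.h1Norm (TreeInterp.expMeasure G o q α) (TreeInterp.dyadicSets G o))
        (TreeInterp.lpNorm (TreeInterp.expMeasure G o q α) (ENNReal.ofReal p₁)
          (ENNReal.one_le_ofReal.2 (hp.trans hp₁).le))
        θ
        (TreeInterp.lpNorm (TreeInterp.expMeasure G o q α) (ENNReal.ofReal p)
          (ENNReal.one_le_ofReal.2 hp.le))) := by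
  have := TreeInterp.countable_of_isTree hG o
  have := TreeInterp.isFiniteMeasure_expMeasure hq hG hreg o hα
  obtain ⟨K, h⟩ := TreeInterp.isRegularDyadic_dyadicSets hq hG hreg o hα
  exact ⟨fun θ p₁ p hθ0 hθ1 hp₁ hp hpθ => h.interpEq_lpNorm_bmoNorm hθ0 hθ1 hp₁ hp hpθ _ _,
    fun θ p₁ p hθ0 hθ1 hp hp₁ hpθ => h.interpEq_h1Norm_lpNorm hθ0 hθ1 hp hp₁ hpθ _ _⟩
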